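/- **Counting connected components (permutations, set partitions, perfect matchings).** **Conventions.** All parameters below ($x,y,u,v,\zeta,\lambda,\dots$, and the families $\mathbf w=(w_\ell)_{\ell\ge0}$, $\mathsf a,\mathsf b,\mathsf c,\mathsf d,\mathsf e$) are arbitrary elements of a commutative ring $R$ (in particular they may be indeterminates). Write $[n]_{p,q}=\sum_{j=0}^{n-1}p^jq^{n-1-j}$; for $n\ge 1$ put $$L_n(p,q;x,u)=p^{n-1}x+q\,[n-1]_{p,q}\,u .$$ For a doubly indexed family put $\mathsf a^\star_{n-1}=\sum_{\ell=0}^{n-1}\mathsf a_{\ell,\,n-1-\ell}$ and $\mathsf d^\natural_{n-1}=\sum_{\ell=0}^{n-1}\mathsf d_{n-1,\ell}$ (both $0$ for $n=0$). The S-fraction with coefficients $\alpha_1,\alpha_2,\dots$ and the J-fraction with coefficients $\gamma_0,\gamma_1,\dots$ and $\beta_1,\beta_2,\dots$ are the formal power series $$\cfrac{1}{1-\cfrac{\alpha_1t}{1-\cfrac{\alpha_2t}{1-\cdots}}},\qquad \cfrac{1}{1-\gamma_0t-\cfrac{\beta_1t^2}{1-\gamma_1t-\cfrac{\beta_2t^2}{1-\cdots}}}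 .$$ **Connected components.** For $\sigma\in\mathfrak S_n$, an index $i\in[n]=\{1,\dots,n\}$ is a *divider* if $\sigma$ maps $\{1,\dots,i\}$ into itself; for a set partition $\pi$ of $[n]$, $i$ is a divider if $\{1,\dots,i\}$ is a union of blocks. $\mathrm{cc}$ is the number of dividers. (If $0=d_0<d_1<\dots<d_k=n$ are $0$ and the dividers, the intervals $\{d_{i-1}+1,\dots,d_i\}$ are the connected components.) An object is *indecomposable* if $\mathrm{cc}=1$. Perfect matchings of $[2n]$ are regarded either as fixed-point-free involutions of $[2n]$ or as partitions of $[2n]$ into blocks of size $2$; cc is the same in both views. **Theorem.** For each polynomial $P_n=\sum_s \mathrm{wt}(s)$ listed in A, B, C below, put $P_n(\zeta)=\sum_s\zeta^{\mathrm{cc}(s)}\mathrm{wt}(s)$ and $P_n^{\rm ind}=\sum_{s:\,\mathrm{cc}(s)=1}\mathrm{wt}(s)$, where $s$ ranges over $\mathfrak S_n$, over the set partitions of $[n]$, or over the perfect matchings of $[2n]$, respectively. (i) If $\sum_{n\ge0} P_nt^n$ is the S-fraction with coefficients $\alpha_1,\alpha_2,\dots$, then for every $\zeta\in R$ the series $\sum_{n\ge0}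 P_n(\zeta)t^n$ is the S-fraction with coefficients $\zeta\alpha_1,\alpha_2,\alpha_3,\dots$, and $$\sum_{n\ge1}P_n^{\rm ind}t^n=\cfrac{\alpha_1t}{1-\cfrac{\alpha_2t}{1-\cfrac{\alpha_3t}{1-\cdots}}} .$$ (ii) If $\sum_{n\ge0} P_nt^n$ is the J-fraction with coefficients $\gamma,\beta$, then for every $\zeta\in R$ the series $\sum_{n\ge0} P_n(\zeta)t^n$ is the J-fraction with coefficients $\zeta\gamma_0,\gamma_1,\gamma_2,\dots$ and $\zeta\beta_1,\beta_2,\beta_3,\dots$, and $$\sum_{n\ge1}P_n^{\rm ind}t^n=\gamma_0t+\cfrac{\beta_1t^2}{1-\gamma_1t-\cfrac{\beta_2t^2}{1-\gamma_2t-\cdots}} .$$ (iii) The continued fractions stated with each polynomial in A, B, C hold for $\sum_{n\ge 0} P_nt^n$; hence so do their modifications in (i), (ii). Below "S:" and "J:" give the coefficients; $k,n\ge1$ except where $\gamma_0$ is included. **A. Permutations.** *Statistics.* $i$ is a record if $\sigma(j)<\sigma(i)$ for all $j<i$, an antirecord if $\sigma(j)>\sigma(i)$ for all $j>i$, an exclusive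 record if a record but not an antirecord, an exclusive antirecord in the opposite case, and an nrar if neither. $i$ is a cycle peak (cpeak) if $\sigma^{-1}(i)<i>\sigma(i)$, a cycle valley (cval) if $\sigma^{-1}(i)>i<\sigma(i)$, a cycle double rise (cdrise) if $\sigma^{-1}(i)<i<\sigma(i)$, a cycle double fall (cdfall) if $\sigma^{-1}(i)>i>\sigma(i)$, and otherwise a fixed point (fix). arec, erec, exc, cyc count antirecords, exclusive records, excedances ($i<\sigma(i)$) and cycles (fixed points included). eareccpeak, eareccdfall, ereccval, ereccdrise, nrcpeak, nrcdfall, nrcval, nrcdrise count the indices in both of the named classes (ear = exclusive antirecord, erec = exclusive record, nr = nrar). Put $$\begin{aligned}\mathrm{ucross}(j)&=\#\{i<j<k<l: k=\sigma(i),\,l=\sigma(j)\},& \mathrm{unest}(j)&=\#\{i<j<k<l: k=\sigma(j),\,l=\sigma(i)\},\\ \mathrm{lcross}(k)&=\#\{i<j<k<l: i=\sigma(k),\,j=\sigma(l)\},& \mathrm{lnest}(k)&=\#\{i<j<k<l: i=\sigma(l),\,j=\sigma(k)\},\end{aligned}$$ counting quadruples with the displayed argument fixed; $\mathrm{lev}(j)=\#\{i<j: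 \sigma(i)>j\}$. ucross, unest, lcross, lnest without argument are the sums over all indices, and ucrosscval, ucrosscdrise, unestcval, unestcdrise, lcrosscpeak, lcrosscdfall, lnestcpeak, lnestcdfall the sums over the indices of the named class. $\mathrm{ujoin}=\#\{i<j<l: j=\sigma(i),l=\sigma(j)\}$, $\mathrm{ljoin}=\#\{i<j<l: i=\sigma(j),j=\sigma(l)\}$, $\mathrm{psnest}=\sum_{j\in\mathrm{fix}}\mathrm{lev}(j)$. 1. $x^{\rm arec}y^{\rm erec}u^{n-{\rm exc}-{\rm arec}}v^{{\rm exc}-{\rm erec}}$. S: $\alpha_{2k-1}=x+(k-1)u$, $\alpha_{2k}=y+(k-1)v$. 2. $x^{\rm cyc}y^{\rm erec}u^{n-{\rm exc}-{\rm cyc}}v^{{\rm exc}-{\rm erec}}$. S: as in 1. 3. $Q=x_1^{\rm eareccpeak}x_2^{\rm eareccdfall}y_1^{\rm ereccval}y_2^{\rm ereccdrise}u_1^{\rm nrcpeak}u_2^{\rm nrcdfall}v_1^{\rm nrcval}v_2^{\rm nrcdrise}\prod_{i\in\rm fix}w_{\mathrm{lev}(i)}$. J: $\gamma_0=w_0$,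 $\gamma_n=[x_2+(n-1)u_2]+[y_2+(n-1)v_2]+w_n$, $\beta_n=[x_1+(n-1)u_1][y_1+(n-1)v_1]$. 4. $Q\,\lambda^{\rm cyc}$. J, when $v_1=y_1$, $v_2=y_2$: $\gamma_0=\lambda w_0$, $\gamma_n=[x_2+(n-1)u_2]+ny_2+\lambda w_n$, $\beta_n=(\lambda+n-1)[x_1+(n-1)u_1]y_1$. 5. $C\,r_+^{\rm ujoin}r_-^{\rm ljoin}s^{\rm psnest}$, where $C=p_{+1}^{\rm ucrosscval}p_{+2}^{\rm ucrosscdrise}p_{-1}^{\rm lcrosscpeak}p_{-2}^{\rm lcrosscdfall}q_{+1}^{\rm unestcval}q_{+2}^{\rm unestcdrise}q_{-1}^{\rm lnestcpeak}q_{-2}^{\rm lnestcdfall}$. J: $\gamma_n=[n]_{p_{+2},q_{+2}}r_++[n]_{p_{-2},q_{-2}}r_-+s^n$ ($n\ge0$), $\beta_n=[n]_{p_{+1},q_{+1}}[n]_{p_{-1},q_{-1}}$. If $p_{\pm1}=p_{\pm2}=p_\pm$ and $q_{\pm1}=q_{\pm2}=q_\pm$: for $(r_+,r_-,s)=(1,p_-,q_-)$,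 S: $\alpha_{2k-1}=[k]_{p_-,q_-}$, $\alpha_{2k}=[k]_{p_+,q_+}$; for $(r_+,r_-,s)=(p_+,1,q_+)$, S: $\alpha_{2k-1}=[k]_{p_+,q_+}$, $\alpha_{2k}=[k]_{p_-,q_-}$. 6. $Q\,C\,s^{\rm psnest}$. J: $\gamma_0=w_0$, $\gamma_n=L_n(p_{-2},q_{-2};x_2,u_2)+L_n(p_{+2},q_{+2};y_2,v_2)+s^nw_n$, $\beta_n=L_n(p_{-1},q_{-1};x_1,u_1)\,L_n(p_{+1},q_{+1};y_1,v_1)$. If $x_1=x_2=x$, $y_1=y$, $y_2=p_+y$, $u_1=u_2=u$, $v_1=v$, $v_2=p_+v$, $w_0=y$, $w_\ell=v$ ($\ell\ge1$), $p_{\pm1}=p_{\pm2}=p_\pm$, $q_{\pm1}=q_{\pm2}=q_\pm$, $s=q_+$, S: $\alpha_{2k-1}=L_k(p_+,q_+;y,v)$, $\alpha_{2k}=L_k(p_-,q_-;x,u)$. 7. $x^{\rm arec}y^{\rm erec}u^{n-{\rm exc}-{\rm arec}}v^{{\rm exc}-{\rm erec}}p_+^{\rm ucross}p_-^{\rm lcross+ljoin}q_+^{\rm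 unest}q_-^{\rm lnest+psnest}$. S: $\alpha_{2k-1}=L_k(p_-,q_-;x,u)$, $\alpha_{2k}=L_k(p_+,q_+;y,v)$. 8. $\prod_{i\in\rm cval}\mathsf a_{\mathrm{ucross}(i),\mathrm{unest}(i)}\prod_{i\in\rm cpeak}\mathsf b_{\mathrm{lcross}(i),\mathrm{lnest}(i)}\prod_{i\in\rm cdfall}\mathsf c_{\mathrm{lcross}(i),\mathrm{lnest}(i)}\prod_{i\in\rm cdrise}\mathsf d_{\mathrm{ucross}(i),\mathrm{unest}(i)}\prod_{i\in\rm fix}\mathsf e_{\mathrm{lev}(i)}$. J: $\gamma_n=\mathsf c^\star_{n-1}+\mathsf d^\star_{n-1}+\mathsf e_n$ ($n\ge0$), $\beta_n=\mathsf a^\star_{n-1}\mathsf b^\star_{n-1}$. If $\mathsf c^\star_{n-1}+\mathsf d^\star_{n-1}+\mathsf e_n=\mathsf a^\star_{n-1}+\mathsf b^\star_n$ for all $n\ge0$, S: $\alpha_{2k-1}=\mathsf b^\star_{k-1}$, $\alpha_{2k}=\mathsf a^\star_{k-1}$; if $\mathsf c^\star_{n-1}+\mathsf d^\star_{n-1}+\mathsf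 e_n=\mathsf b^\star_{n-1}+\mathsf a^\star_n$ for all $n\ge0$, S: $\alpha_{2k-1}=\mathsf a^\star_{k-1}$, $\alpha_{2k}=\mathsf b^\star_{k-1}$. 9. $Q\,C\,s^{\rm psnest}\lambda^{\rm cyc}$. J, when $v_1=y_1$, $v_2=y_2$, $q_{+1}=p_{+1}$, $q_{+2}=p_{+2}$: $\gamma_0=\lambda w_0$, $\gamma_n=L_n(p_{-2},q_{-2};x_2,u_2)+n\,p_{+2}^{n-1}y_2+\lambda s^nw_n$, $\beta_n=(\lambda+n-1)\,L_n(p_{-1},q_{-1};x_1,u_1)\,p_{+1}^{n-1}y_1$. If moreover $x_1=x_2=x$, $y_1=y$, $y_2=p_+y$, $u_1=u_2=u$, $w_\ell=y$ ($\ell\ge0$), $p_{\pm1}=p_{\pm2}=p_\pm$, $q_{-1}=q_{-2}=q_-$, $s=p_+$, S: $\alpha_{2k-1}=(\lambda+k-1)p_+^{k-1}y$, $\alpha_{2k}=L_k(p_-,q_-;x,u)$. 10. $\lambda^{\rm cyc}\prod_{i\in\rm cval}\mathsf a_{\mathrm{ucross}(i)+\mathrm{unest}(i)}\prod_{i\in\rm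 cpeak}\mathsf b_{\mathrm{lcross}(i),\mathrm{lnest}(i)}\prod_{i\in\rm cdfall}\mathsf c_{\mathrm{lcross}(i),\mathrm{lnest}(i)}\prod_{i\in\rm cdrise}\mathsf d_{\mathrm{ucross}(i)+\mathrm{unest}(i),\,\mathrm{unest}(\sigma^{-1}(i))}\prod_{i\in\rm fix}\mathsf e_{\mathrm{lev}(i)}$ (here $\mathsf a$ has one index). J: $\gamma_n=\mathsf c^\star_{n-1}+\mathsf d^\natural_{n-1}+\lambda\mathsf e_n$ ($n\ge0$), $\beta_n=(\lambda+n-1)\,\mathsf a_{n-1}\mathsf b^\star_{n-1}$. If $\mathsf e_n=\mathsf a_n$ and $\mathsf c^\star_{n-1}+\mathsf d^\natural_{n-1}=\mathsf b^\star_{n-1}+n\,\mathsf a_n$ for all $n\ge0$, S: $\alpha_{2k-1}=(\lambda+k-1)\mathsf a_{k-1}$, $\alpha_{2k}=\mathsf b^\star_{k-1}$. In 4 and 9, (i) and (ii) are asserted for all values of the parameters, (iii) under the stated specializations. **B. Set partitions $\pi$ of $[n]$.** *Statistics.* $|\pi|$ is the number of blocks; $m_1$, $m_{\ge2}$ count blocks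 of size $1$ and of size $\ge2$. An opener (closer) is the smallest (largest) element of a block of size $\ge2$, an insider is an element of a block that is neither smallest nor largest, a singleton is the element of a block of size $1$. Edges of $\pi$ are the pairs $(i,l)$, $i<l$, of consecutive elements of a block. An exclusive record is an $i$ that has an edge $(i,l)$ such that every edge $(j,m)$ with $j<i$ has $m<l$; a block-record is an opener or insider $j$ of a block $B$ such that no block $B'$ has $\min B'<j<\max B<\max B'$. erec counts exclusive records; erecin, erecop, nerecin, nerecop count the insiders/openers that are/are not exclusive records; brecin, brecop, nbrecin, nbrecop likewise for block-records. For $j\in[n]$ in the block $B_2$, $$\begin{aligned}\mathrm{cr}(j)&=\#\{i<j<k<l: (i,k),(j,l)\text{ edges}\},& \mathrm{ne}(j)&=\#\{i<j<k<l:(i,l),(j,k)\text{ edges}\},\\ \mathrm{qne}(j)&=\#\{i<j<l:(i,l)\text{ edge}\},& &\\ \mathrm{ov}(j)&=\#\{B_1:\min B_1<j<\max B_1<\max B_2\},& \mathrm{cov}(j)&=\#\{B_1:\min B_1<j<\max B_2<\max B_1\}.\end{aligned}$$ crin, nein, ovin, covin (crop, neop) are the sums over insiders (openers); psne is the sum of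 qne over singletons; ov, cov, pscov count the pairs of blocks with $\min B_1<\min B_2<\max B_1<\max B_2$, with $\min B_1<\min B_2<\max B_2<\max B_1$, and with $\min B_1<\min B_2=\max B_2<\max B_1$. 1. $x^{|\pi|}y^{\rm erec}v^{n-|\pi|-{\rm erec}}$. S: $\alpha_{2k-1}=x$, $\alpha_{2k}=y+(k-1)v$. 2. $x_1^{m_1}x_2^{m_{\ge2}}y_1^{\rm erecin}y_2^{\rm erecop}v_1^{\rm nerecin}v_2^{\rm nerecop}$. J: $\gamma_0=x_1$, $\gamma_n=x_1+y_1+(n-1)v_1$, $\beta_n=x_2[y_2+(n-1)v_2]$. 3. The weight of 2 times $p_1^{\rm crin}p_2^{\rm crop}q_1^{\rm nein}q_2^{\rm neop}r^{\rm psne}$. J: $\gamma_0=x_1$, $\gamma_n=r^nx_1+L_n(p_1,q_1;y_1,v_1)$, $\beta_n=x_2L_n(p_2,q_2;y_2,v_2)$. If $x_1=x_2=x$, $y_1=y_2=y$, $v_1=v_2=v$, $p_1=p$, $p_2=rp$, $q_1=q$, $q_2=rq$, S: $\alpha_{2k-1}=r^{k-1}x$, $\alpha_{2k}=L_k(p,q;y,v)$.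 4. $x_1^{m_1}x_2^{m_{\ge2}}y_1^{\rm brecin}y_2^{\rm brecop}v_1^{\rm nbrecin}v_2^{\rm nbrecop}p_1^{\rm ovin}p_2^{\rm ov}q_1^{\rm covin}q_2^{\rm cov}r^{\rm pscov}$. J and S: as in 3. 5. Four polynomials: $\prod_{i\ \rm opener}\mathsf a_{\bullet}\prod_{i\ \rm closer}\mathsf b_{\mathrm{qne}(i)}\prod_{i\ \rm insider}\mathsf d_{\bullet'}\prod_{i\ \rm singleton}\mathsf e_{\mathrm{qne}(i)}$, where each of $\bullet$, $\bullet'$ is, independently, either $(\mathrm{cr}(i),\mathrm{ne}(i))$ or $(\mathrm{ov}(i),\mathrm{cov}(i))$. J: $\gamma_n=\mathsf d^\star_{n-1}+\mathsf e_n$ ($n\ge0$), $\beta_n=\mathsf a^\star_{n-1}\mathsf b_{n-1}$. If $\mathsf d^\star_{n-1}+\mathsf e_n=\mathsf a^\star_{n-1}+\mathsf b_n$ for all $n\ge0$, S: $\alpha_{2k-1}=\mathsf b_{k-1}$, $\alpha_{2k}=\mathsf a^\star_{k-1}$. **C. Perfect matchings of $[2n]$.** In 1, 2 they are fixed-point-free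 involutions $\sigma\in\mathfrak S_{2n}$, in 3 partitions into pairs. 1. $x^{\rm ecpar}y^{\rm ocpar}u^{\rm ecpnar}v^{\rm ocpnar}$, where these count the even cycle peaks that are antirecords, the odd cycle peaks that are antirecords, the even ones that are not, and the odd ones that are not; and $x^{\rm ocvr}y^{\rm ecvr}u^{\rm ocvnr}v^{\rm ecvnr}$, where these count the odd cycle valleys that are records, the even cycle valleys that are records, the odd ones that are not, and the even ones that are not. S (both): $\alpha_{2k-1}=x+(2k-2)u$, $\alpha_{2k}=y+(2k-1)v$. 2. Each of the two weights in 1 times $p^{\rm cr}q^{\rm ne}$, where cr, ne are the total numbers of crossings and nestings of the matching (i.e. ucross and unest of $\sigma$). S (both): $\alpha_{2k-1}=L_{2k-1}(p,q;x,u)$, $\alpha_{2k}=L_{2k}(p,q;y,v)$. 3. $\prod_{i\ \rm opener}\mathsf a_{\mathrm{cr}(i),\mathrm{ne}(i)}\prod_{i\ \rm closer}\mathsf b_{\mathrm{qne}(i)}$. S: $\alpha_n=\mathsf a^\star_{n-1}\mathsf b_{n-1}$. -/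

import Mathlib

open Finset

/-! ## Stieltjes and Jacobi continued fractions as formal power series -/

namespace CFrac

/-- The `N`-th truncation of the tail
`1/(1 - α_{k+1} t/(1 - α_{k+2} t/(1 - ⋯)))` of an S-fraction
(after `N` levels the rest is replaced by `1`). -/
noncomputable def sConv {R : Type*} [CommRing R] (α : ℕ → R) : ℕ → ℕ → PowerSeries R
  | 0, _ => 1
  | N + 1, k => PowerSeries.invOfUnit
      (1 - PowerSeries.C (α (k + 1)) * PowerSeries.X * sConv α N (k + 1)) 1

/-- The formal power series `1/(1 - α_{k+1} t/(1 - α_{k+2} t/(1 - ⋯)))`. The coefficient of `t^n`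
of the truncations is constant from the `n`-th one on. -/
noncomputable def sTail {R : Type*} [CommRing R] (α : ℕ → R) (k : ℕ) : PowerSeries R :=
  PowerSeries.mk fun n => PowerSeries.coeff n (sConv α n k)

/-- The S-fraction `1/(1 - α₁ t/(1 - α₂ t/(1 - ⋯)))`; the value `α 0` is not used. -/
noncomputable def sFrac {R : Type*} [CommRing R] (α : ℕ → R) : PowerSeries R := sTail α 0

/-- The `N`-th truncation of the tail
`1/(1 - γ_k t - β_{k+1} t²/(1 - γ_{k+1} t - β_{k+2} t²/(1 - ⋯)))` of a J-fraction. -/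
noncomputable def jConv {R : Type*} [CommRing R] (γ β : ℕ → R) : ℕ → ℕ → PowerSeries R
  | 0, _ => 1
  | N + 1, k => PowerSeries.invOfUnit
      (1 - PowerSeries.C (γ k) * PowerSeries.X
        - PowerSeries.C (β (k + 1)) * PowerSeries.X ^ 2 * jConv γ β N (k + 1)) 1

/-- The formal power series
`1/(1 - γ_k t - β_{k+1} t²/(1 - γ_{k+1} t - β_{k+2} t²/(1 - ⋯)))`. -/
noncomputable def jTail {R : Type*} [CommRing R] (γ β : ℕ → R) (k : ℕ) : PowerSeries R :=
  PowerSeries.mk fun n => PowerSeries.coeff n (jConv γ β n k)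

/-- The J-fraction `1/(1 - γ₀ t - β₁ t²/(1 - γ₁ t - β₂ t²/(1 - ⋯)))`;
the value `β 0` is not used. -/
noncomputable def jFrac {R : Type*} [CommRing R] (γ β : ℕ → R) : PowerSeries R := jTail γ β 0

theorem sConv_mul {R : Type*} [CommRing R] (α : ℕ → R) (N k : ℕ) :
    (1 - PowerSeries.C (α (k + 1)) * PowerSeries.X * sConv α N (k + 1)) * sConv α (N + 1) k
      = 1 := by
  rw [sConv]
  exact PowerSeries.mul_invOfUnit _ _ (by simp)

theorem sConv_dvd {R : Type*} [CommRing R] (α : ℕ → R) (N k : ℕ) :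
    (PowerSeries.X : PowerSeries R) ^ (N + 1) ∣ sConv α (N + 1) k - sConv α N k := by
  induction N generalizing k with
  | zero =>
    have h := sConv_mul α 0 k
    refine ⟨PowerSeries.C (α (k + 1)) * sConv α 0 (k + 1) * sConv α 1 k, ?_⟩
    have h0 : sConv α 0 k = 1 := by rw [sConv]
    rw [h0]
    linear_combination h
  | succ N ih =>
    obtain ⟨D, hD⟩ := ih (k + 1)
    have h1 := sConv_mul α N k
    have h2 := sConv_mul α (N + 1) k
    refine ⟨PowerSeries.C (α (k + 1)) * D * sConv α (N + 1) k * sConv α (N + 2) k, ?_⟩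
    linear_combination (sConv α (N + 1) k) * h2 - (sConv α (N + 2) k) * h1 +
      (PowerSeries.C (α (k + 1)) * PowerSeries.X * sConv α (N + 1) k * sConv α (N + 2) k) * hD

theorem sConv_coeff {R : Type*} [CommRing R] (α : ℕ → R) (n d k : ℕ) :
    PowerSeries.coeff n (sConv α (n + d) k) = PowerSeries.coeff n (sConv α n k) := by
  induction d with
  | zero => rfl
  | succ d ih =>
    have h := (PowerSeries.X_pow_dvd_iff.mp (sConv_dvd α (n + d) k)) n (by omega)
    rw [map_sub, sub_eq_zero] at h
    rw [← ih, ← h]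
    rfl

/-- The recurrence that characterizes the S-fraction. -/
theorem sTail_spec {R : Type*} [CommRing R] (α : ℕ → R) (k : ℕ) :
    (1 - PowerSeries.C (α (k + 1)) * PowerSeries.X * sTail α (k + 1)) * sTail α k = 1 := by
  ext n
  have key : ∀ j, (PowerSeries.X : PowerSeries R) ^ (n + 1) ∣ sTail α j - sConv α (n + 1) j := by
    intro j
    rw [PowerSeries.X_pow_dvd_iff]
    intro m hm
    rw [map_sub, sub_eq_zero, sTail, PowerSeries.coeff_mk]
    obtain ⟨d, hd⟩ := Nat.exists_eq_add_of_le (show m ≤ n + 1 by omega)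
    rw [hd, sConv_coeff]
  have key' : (PowerSeries.X : PowerSeries R) ^ (n + 1) ∣
      sTail α (k + 1) - sConv α n (k + 1) := by
    have := dvd_add (key (k + 1)) (sConv_dvd α n (k + 1))
    simpa using this
  obtain ⟨A, hA⟩ := key k
  obtain ⟨B, hB⟩ := key'
  have h := sConv_mul α n k
  have hd : (PowerSeries.X : PowerSeries R) ^ (n + 1) ∣
      (1 - PowerSeries.C (α (k + 1)) * PowerSeries.X * sTail α (k + 1)) * sTail α k - 1 := by
    refine ⟨(1 - PowerSeries.C (α (k + 1)) * PowerSeries.X * sTail α (k + 1)) * A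
      - PowerSeries.C (α (k + 1)) * PowerSeries.X * B * sConv α (n + 1) k, ?_⟩
    linear_combination h + (1 - PowerSeries.C (α (k + 1)) * PowerSeries.X * sTail α (k + 1)) * hA
      - (PowerSeries.C (α (k + 1)) * PowerSeries.X * sConv α (n + 1) k) * hB
  have := (PowerSeries.X_pow_dvd_iff.mp hd) n (by omega)
  rwa [map_sub, sub_eq_zero] at this

theorem jConv_mul {R : Type*} [CommRing R] (γ β : ℕ → R) (N k : ℕ) :
    (1 - PowerSeries.C (γ k) * PowerSeries.X
      - PowerSeries.C (β (k + 1)) * PowerSeries.X ^ 2 * jConv γ β N (k + 1)) * jConv γ β (N + 1) k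
      = 1 := by
  rw [jConv]
  exact PowerSeries.mul_invOfUnit _ _ (by simp)

theorem jConv_dvd {R : Type*} [CommRing R] (γ β : ℕ → R) (N k : ℕ) :
    (PowerSeries.X : PowerSeries R) ^ (N + 1) ∣ jConv γ β (N + 1) k - jConv γ β N k := by
  induction N generalizing k with
  | zero =>
    have h := jConv_mul γ β 0 k
    refine ⟨(PowerSeries.C (γ k) + PowerSeries.C (β (k + 1)) * PowerSeries.X * jConv γ β 0 (k + 1))
      * jConv γ β 1 k, ?_⟩
    have h0 : jConv γ β 0 k = 1 := by rw [jConv]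
    rw [h0]
    linear_combination h
  | succ N ih =>
    obtain ⟨D, hD⟩ := ih (k + 1)
    have h1 := jConv_mul γ β N k
    have h2 := jConv_mul γ β (N + 1) k
    refine ⟨PowerSeries.C (β (k + 1)) * PowerSeries.X * D * jConv γ β (N + 1) k
      * jConv γ β (N + 2) k, ?_⟩
    linear_combination (jConv γ β (N + 1) k) * h2 - (jConv γ β (N + 2) k) * h1 +
      (PowerSeries.C (β (k + 1)) * PowerSeries.X ^ 2 * jConv γ β (N + 1) k
        * jConv γ β (N + 2) k) * hD

theorem jConv_coeff {R : Type*} [CommRing R] (γ β : ℕ → R) (n d k : ℕ) :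
    PowerSeries.coeff n (jConv γ β (n + d) k) = PowerSeries.coeff n (jConv γ β n k) := by
  induction d with
  | zero => rfl
  | succ d ih =>
    have h := (PowerSeries.X_pow_dvd_iff.mp (jConv_dvd γ β (n + d) k)) n (by omega)
    rw [map_sub, sub_eq_zero] at h
    rw [← ih, ← h]
    rfl

/-- The recurrence that characterizes the J-fraction. -/
theorem jTail_spec {R : Type*} [CommRing R] (γ β : ℕ → R) (k : ℕ) :
    (1 - PowerSeries.C (γ k) * PowerSeries.X
      - PowerSeries.C (β (k + 1)) * PowerSeries.X ^ 2 * jTail γ β (k + 1)) * jTail γ β k = 1 := by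
  ext n
  have key : ∀ j, (PowerSeries.X : PowerSeries R) ^ (n + 1) ∣
      jTail γ β j - jConv γ β (n + 1) j := by
    intro j
    rw [PowerSeries.X_pow_dvd_iff]
    intro m hm
    rw [map_sub, sub_eq_zero, jTail, PowerSeries.coeff_mk]
    obtain ⟨d, hd⟩ := Nat.exists_eq_add_of_le (show m ≤ n + 1 by omega)
    rw [hd, jConv_coeff]
  have key' : (PowerSeries.X : PowerSeries R) ^ (n + 1) ∣
      jTail γ β (k + 1) - jConv γ β n (k + 1) := by
    have := dvd_add (key (k + 1)) (jConv_dvd γ β n (k + 1))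
    simpa using this
  obtain ⟨A, hA⟩ := key k
  obtain ⟨B, hB⟩ := key'
  have h := jConv_mul γ β n k
  have hd : (PowerSeries.X : PowerSeries R) ^ (n + 1) ∣
      (1 - PowerSeries.C (γ k) * PowerSeries.X
        - PowerSeries.C (β (k + 1)) * PowerSeries.X ^ 2 * jTail γ β (k + 1)) * jTail γ β k - 1 := by
    refine ⟨(1 - PowerSeries.C (γ k) * PowerSeries.X
        - PowerSeries.C (β (k + 1)) * PowerSeries.X ^ 2 * jTail γ β (k + 1)) * A
      - PowerSeries.C (β (k + 1)) * PowerSeries.X ^ 2 * B * jConv γ β (n + 1) k, ?_⟩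
    linear_combination h + (1 - PowerSeries.C (γ k) * PowerSeries.X
        - PowerSeries.C (β (k + 1)) * PowerSeries.X ^ 2 * jTail γ β (k + 1)) * hA
      - (PowerSeries.C (β (k + 1)) * PowerSeries.X ^ 2 * jConv γ β (n + 1) k) * hB
  have := (PowerSeries.X_pow_dvd_iff.mp hd) n (by omega)
  rwa [map_sub, sub_eq_zero] at this

/-- `Σ_n t^n Σ_{s ∈ S_n} ζ^{cc(s)} w(s)`. -/
noncomputable def gfCC {R : Type*} [CommRing R] {S : ℕ → Type} [∀ n, Fintype (S n)]
    (cc : ∀ n, S n → ℕ) (w : ∀ n, S n → R) (ζ : R) : PowerSeries R :=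
  PowerSeries.mk fun n => ∑ s : S n, ζ ^ cc n s * w n s

/-- The generating function of the indecomposable objects,
`Σ_n t^n Σ_{s ∈ S_n, cc(s) = 1} w(s)`. -/
noncomputable def gfIndec {R : Type*} [CommRing R] {S : ℕ → Type} [∀ n, Fintype (S n)]
    (cc : ∀ n, S n → ℕ) (w : ∀ n, S n → R) : PowerSeries R :=
  PowerSeries.mk fun n => ∑ s : S n with cc n s = 1, w n s

/-- With the factor `ζ^{cc}` inserted, the generating function is the S-fraction with
coefficients `ζ α₁, α₂, α₃, …` (for `ζ = 1`: with `α₁, α₂, α₃, …`), and the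
generating function of the indecomposable objects is `α₁ t/(1 - α₂ t/(1 - α₃ t/(1 - ⋯)))`. -/
def CountsS {R : Type*} [CommRing R] {S : ℕ → Type} [∀ n, Fintype (S n)]
    (cc : ∀ n, S n → ℕ) (w : ∀ n, S n → R) (α : ℕ → R) : Prop :=
  (∀ ζ : R, gfCC cc w ζ = sFrac (Function.update α 1 (ζ * α 1))) ∧
  gfIndec cc w = PowerSeries.C (α 1) * PowerSeries.X * sTail α 1

/-- With the factor `ζ^{cc}` inserted, the generating function is the J-fraction with
coefficients `ζ γ₀, γ₁, γ₂, …` and `ζ β₁, β₂, β₃, …` (for `ζ = 1`: with `γ` and `β`),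
and the generating function of the indecomposable objects is
`γ₀ t + β₁ t²/(1 - γ₁ t - β₂ t²/(1 - γ₂ t - ⋯))`. -/
def CountsJ {R : Type*} [CommRing R] {S : ℕ → Type} [∀ n, Fintype (S n)]
    (cc : ∀ n, S n → ℕ) (w : ∀ n, S n → R) (γ β : ℕ → R) : Prop :=
  (∀ ζ : R, gfCC cc w ζ
    = jFrac (Function.update γ 0 (ζ * γ 0)) (Function.update β 1 (ζ * β 1))) ∧
  gfIndec cc w = PowerSeries.C (γ 0) * PowerSeries.X
    + PowerSeries.C (β 1) * PowerSeries.X ^ 2 * jTail γ β 1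

/-- Inserting the factor `ζ^{cc}` has the stated effect on each continued fraction which the
generating function without this factor has, whatever its coefficients. -/
def Modifies {R : Type*} [CommRing R] {S : ℕ → Type} [∀ n, Fintype (S n)]
    (cc : ∀ n, S n → ℕ) (w : ∀ n, S n → R) : Prop :=
  (∀ α : ℕ → R, gfCC cc w 1 = sFrac α → CountsS cc w α) ∧
  (∀ γ β : ℕ → R, gfCC cc w 1 = jFrac γ β → CountsJ cc w γ β)

/-- The sequence with `α_{2k-1} = f k` and `α_{2k} = g k` for `k ≥ 1`. -/
def oddEven {R : Type*} (f g : ℕ → R) (n : ℕ) : R :=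
  if Even n then g (n / 2) else f ((n + 1) / 2)

/-- `[n]_{p,q} = Σ_{j<n} p^j q^{n-1-j}`. -/
def pq {R : Type*} [CommRing R] (p q : R) (n : ℕ) : R := ∑ j ∈ range n, p ^ j * q ^ (n - 1 - j)

/-- `starSum a n` is `a*_{n-1} = Σ_{ℓ=0}^{n-1} a_{ℓ,n-1-ℓ}` (which is `0` for `n = 0`). -/
def starSum {R : Type*} [CommRing R] (a : ℕ → ℕ → R) (n : ℕ) : R :=
  ∑ l ∈ range n, a l (n - 1 - l)

/-- `naturalSum d n` is `d♮_{n-1} = Σ_{ℓ=0}^{n-1} d_{n-1,ℓ}` (which is `0` for `n = 0`). -/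
def naturalSum {R : Type*} [CommRing R] (d : ℕ → ℕ → R) (n : ℕ) : R :=
  ∑ l ∈ range n, d (n - 1) l

/-- `p^{n-1} x + q [n-1]_{p,q} u`, for `n ≥ 1`. -/
def lin {R : Type*} [CommRing R] (p q x u : R) (n : ℕ) : R :=
  p ^ (n - 1) * x + q * pq p q (n - 1) * u

end CFrac

/-! ## Permutation statistics. The set `{1,…,n}` is modelled by `Fin n`. -/

namespace PermStat

open Equiv

/-- The number of dividers, which is the number of connected components: `i` is a divider if
`σ` maps `{1,…,i}` into itself. -/
def cc (n : ℕ) (σ : Perm (Fin n)) : ℕ := #{i | ∀ j ≤ i, σ j ≤ i}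

/-- `i` is a record. -/
abbrev IsRec {n : ℕ} (σ : Perm (Fin n)) (i : Fin n) : Prop := ∀ j < i, σ j < σ i
/-- `i` is an antirecord. -/
abbrev IsArec {n : ℕ} (σ : Perm (Fin n)) (i : Fin n) : Prop := ∀ j > i, σ i < σ j
/-- `i` is an exclusive record. -/
abbrev IsErec {n : ℕ} (σ : Perm (Fin n)) (i : Fin n) : Prop := IsRec σ i ∧ ¬ IsArec σ i
/-- `i` is an exclusive antirecord. -/
abbrev IsEarec {n : ℕ} (σ : Perm (Fin n)) (i : Fin n) : Prop := IsArec σ i ∧ ¬ IsRec σ i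
/-- `i` is neither a record nor an antirecord. -/
abbrev IsNrar {n : ℕ} (σ : Perm (Fin n)) (i : Fin n) : Prop := ¬ IsRec σ i ∧ ¬ IsArec σ i
/-- `i` is a cycle peak. -/
abbrev IsCpeak {n : ℕ} (σ : Perm (Fin n)) (i : Fin n) : Prop := σ⁻¹ i < i ∧ σ i < i
/-- `i` is a cycle valley. -/
abbrev IsCval {n : ℕ} (σ : Perm (Fin n)) (i : Fin n) : Prop := i < σ⁻¹ i ∧ i < σ i
/-- `i` is a cycle double rise. -/
abbrev IsCdrise {n : ℕ} (σ : Perm (Fin n)) (i : Fin n) : Prop := σ⁻¹ i < i ∧ i < σ i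
/-- `i` is a cycle double fall. -/
abbrev IsCdfall {n : ℕ} (σ : Perm (Fin n)) (i : Fin n) : Prop := i < σ⁻¹ i ∧ σ i < i

def arec {n : ℕ} (σ : Perm (Fin n)) : ℕ := #{i | IsArec σ i}
def erec {n : ℕ} (σ : Perm (Fin n)) : ℕ := #{i | IsErec σ i}
/-- The number of excedances. -/
def exc {n : ℕ} (σ : Perm (Fin n)) : ℕ := #{i | i < σ i}
/-- The number of cycles, fixed points included. -/
def cyc {n : ℕ} (σ : Perm (Fin n)) : ℕ := Multiset.card σ.cycleType + #{i | σ i = i}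

def eareccpeak {n : ℕ} (σ : Perm (Fin n)) : ℕ := #{i | IsEarec σ i ∧ IsCpeak σ i}
def eareccdfall {n : ℕ} (σ : Perm (Fin n)) : ℕ := #{i | IsEarec σ i ∧ IsCdfall σ i}
def ereccval {n : ℕ} (σ : Perm (Fin n)) : ℕ := #{i | IsErec σ i ∧ IsCval σ i}
def ereccdrise {n : ℕ} (σ : Perm (Fin n)) : ℕ := #{i | IsErec σ i ∧ IsCdrise σ i}
def nrcpeak {n : ℕ} (σ : Perm (Fin n)) : ℕ := #{i | IsNrar σ i ∧ IsCpeak σ i}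
def nrcdfall {n : ℕ} (σ : Perm (Fin n)) : ℕ := #{i | IsNrar σ i ∧ IsCdfall σ i}
def nrcval {n : ℕ} (σ : Perm (Fin n)) : ℕ := #{i | IsNrar σ i ∧ IsCval σ i}
def nrcdrise {n : ℕ} (σ : Perm (Fin n)) : ℕ := #{i | IsNrar σ i ∧ IsCdrise σ i}

/-- The number of upper crossings `i < j < k < l`, `k = σ i`, `l = σ j`, with given `j`
(they are determined by `i`). -/
def ucross {n : ℕ} (σ : Perm (Fin n)) (j : Fin n) : ℕ := #{i | i < j ∧ j < σ i ∧ σ i < σ j}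
/-- The number of upper nestings `i < j < k < l`, `k = σ j`, `l = σ i`, with given `j`. -/
def unest {n : ℕ} (σ : Perm (Fin n)) (j : Fin n) : ℕ := #{i | i < j ∧ j < σ j ∧ σ j < σ i}
/-- The number of lower crossings `i < j < k < l`, `i = σ k`, `j = σ l`, with given `k`
(they are determined by `l`). -/
def lcross {n : ℕ} (σ : Perm (Fin n)) (k : Fin n) : ℕ := #{l | σ k < σ l ∧ σ l < k ∧ k < l}
/-- The number of lower nestings `i < j < k < l`, `i = σ l`, `j = σ k`, with given `k`. -/
def lnest {n : ℕ} (σ : Perm (Fin n)) (k : Fin n) : ℕ := #{l | σ l < σ k ∧ σ k < k ∧ k < l}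
/-- The level of a fixed point `j`. -/
def lev {n : ℕ} (σ : Perm (Fin n)) (j : Fin n) : ℕ := #{i | i < j ∧ j < σ i}

def ucrosscval {n : ℕ} (σ : Perm (Fin n)) : ℕ := ∑ j with IsCval σ j, ucross σ j
def ucrosscdrise {n : ℕ} (σ : Perm (Fin n)) : ℕ := ∑ j with IsCdrise σ j, ucross σ j
def lcrosscpeak {n : ℕ} (σ : Perm (Fin n)) : ℕ := ∑ k with IsCpeak σ k, lcross σ k
def lcrosscdfall {n : ℕ} (σ : Perm (Fin n)) : ℕ := ∑ k with IsCdfall σ k, lcross σ k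
def unestcval {n : ℕ} (σ : Perm (Fin n)) : ℕ := ∑ j with IsCval σ j, unest σ j
def unestcdrise {n : ℕ} (σ : Perm (Fin n)) : ℕ := ∑ j with IsCdrise σ j, unest σ j
def lnestcpeak {n : ℕ} (σ : Perm (Fin n)) : ℕ := ∑ k with IsCpeak σ k, lnest σ k
def lnestcdfall {n : ℕ} (σ : Perm (Fin n)) : ℕ := ∑ k with IsCdfall σ k, lnest σ k
/-- The total number of upper crossings; similarly for the next three. -/
def ucrossT {n : ℕ} (σ : Perm (Fin n)) : ℕ := ∑ j, ucross σ j
def lcrossT {n : ℕ} (σ : Perm (Fin n)) : ℕ := ∑ k, lcross σ k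
def unestT {n : ℕ} (σ : Perm (Fin n)) : ℕ := ∑ j, unest σ j
def lnestT {n : ℕ} (σ : Perm (Fin n)) : ℕ := ∑ k, lnest σ k
/-- Upper joinings `i < j < l`, `j = σ i`, `l = σ j`. -/
def ujoin {n : ℕ} (σ : Perm (Fin n)) : ℕ := #{i | i < σ i ∧ σ i < σ (σ i)}
/-- Lower joinings `i < j < l`, `i = σ j`, `j = σ l`. -/
def ljoin {n : ℕ} (σ : Perm (Fin n)) : ℕ := #{l | σ (σ l) < σ l ∧ σ l < l}
/-- (Upper) pseudo-nestings `i < j < l`, `l = σ i`, `j = σ j`. -/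
def psnest {n : ℕ} (σ : Perm (Fin n)) : ℕ := ∑ j with σ j = j, lev σ j

/-- `x^arec y^erec u^(n-exc-arec) v^(exc-erec)`. -/
def wArec {R : Type*} [CommRing R] (x y u v : R) (n : ℕ) (σ : Perm (Fin n)) : R :=
  x ^ arec σ * y ^ erec σ * u ^ (n - exc σ - arec σ) * v ^ (exc σ - erec σ)

/-- `x^cyc y^erec u^(n-exc-cyc) v^(exc-erec)`. -/
def wCyc {R : Type*} [CommRing R] (x y u v : R) (n : ℕ) (σ : Perm (Fin n)) : R :=
  x ^ cyc σ * y ^ erec σ * u ^ (n - exc σ - cyc σ) * v ^ (exc σ - erec σ)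

/-- The weight of the record-and-cycle classification, fixed points being weighted by level. -/
def wRecCyc {R : Type*} [CommRing R] (x₁ x₂ y₁ y₂ u₁ u₂ v₁ v₂ : R) (w : ℕ → R)
    (n : ℕ) (σ : Perm (Fin n)) : R :=
  x₁ ^ eareccpeak σ * x₂ ^ eareccdfall σ * y₁ ^ ereccval σ * y₂ ^ ereccdrise σ
    * u₁ ^ nrcpeak σ * u₂ ^ nrcdfall σ * v₁ ^ nrcval σ * v₂ ^ nrcdrise σ
    * ∏ i with σ i = i, w (lev σ i)

/-- The weight of the record-and-cycle classification and of the number of cycles. -/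
def wRecCycHat {R : Type*} [CommRing R] (x₁ x₂ y₁ y₂ u₁ u₂ v₁ v₂ : R) (w : ℕ → R) (lam : R)
    (n : ℕ) (σ : Perm (Fin n)) : R :=
  wRecCyc x₁ x₂ y₁ y₂ u₁ u₂ v₁ v₂ w n σ * lam ^ cyc σ

/-- The weight of the refined crossings and nestings; `pp1 = p₊₁`, `pm1 = p₋₁`, etc. -/
def wCrossNest {R : Type*} [CommRing R] (pp1 pp2 pm1 pm2 qp1 qp2 qm1 qm2 : R)
    (n : ℕ) (σ : Perm (Fin n)) : R :=
  pp1 ^ ucrosscval σ * pp2 ^ ucrosscdrise σ * pm1 ^ lcrosscpeak σ * pm2 ^ lcrosscdfall σ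
    * qp1 ^ unestcval σ * qp2 ^ unestcdrise σ * qm1 ^ lnestcpeak σ * qm2 ^ lnestcdfall σ

/-- The weight of crossings, nestings, joinings and pseudo-nestings. -/
def wPQ {R : Type*} [CommRing R] (pp1 pp2 pm1 pm2 qp1 qp2 qm1 qm2 rp rm s : R)
    (n : ℕ) (σ : Perm (Fin n)) : R :=
  wCrossNest pp1 pp2 pm1 pm2 qp1 qp2 qm1 qm2 n σ * rp ^ ujoin σ * rm ^ ljoin σ * s ^ psnest σ

/-- Record-and-cycle classification together with crossings, nestings, pseudo-nestings. -/
def wBig {R : Type*} [CommRing R] (x₁ x₂ y₁ y₂ u₁ u₂ v₁ v₂ : R) (w : ℕ → R)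
    (pp1 pp2 pm1 pm2 qp1 qp2 qm1 qm2 s : R) (n : ℕ) (σ : Perm (Fin n)) : R :=
  wRecCyc x₁ x₂ y₁ y₂ u₁ u₂ v₁ v₂ w n σ
    * wCrossNest pp1 pp2 pm1 pm2 qp1 qp2 qm1 qm2 n σ * s ^ psnest σ

/-- The preceding weight, together with the number of cycles. -/
def wBigHat {R : Type*} [CommRing R] (x₁ x₂ y₁ y₂ u₁ u₂ v₁ v₂ : R) (w : ℕ → R)
    (pp1 pp2 pm1 pm2 qp1 qp2 qm1 qm2 s lam : R) (n : ℕ) (σ : Perm (Fin n)) : R :=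
  wBig x₁ x₂ y₁ y₂ u₁ u₂ v₁ v₂ w pp1 pp2 pm1 pm2 qp1 qp2 qm1 qm2 s n σ * lam ^ cyc σ

/-- The eight-variable weight
`x^arec y^erec u^(n-exc-arec) v^(exc-erec) p₊^ucross p₋^(lcross+ljoin) q₊^unest q₋^(lnest+psnest)`. -/
def wArecPQ {R : Type*} [CommRing R] (x y u v pp pm qp qm : R) (n : ℕ) (σ : Perm (Fin n)) : R :=
  wArec x y u v n σ * pp ^ ucrossT σ * pm ^ (lcrossT σ + ljoin σ)
    * qp ^ unestT σ * qm ^ (lnestT σ + psnest σ)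

/-- The weight of the first master polynomial. -/
def wMaster1 {R : Type*} [CommRing R] (a b c d : ℕ → ℕ → R) (e : ℕ → R)
    (n : ℕ) (σ : Perm (Fin n)) : R :=
  (∏ i with IsCval σ i, a (ucross σ i) (unest σ i))
    * (∏ i with IsCpeak σ i, b (lcross σ i) (lnest σ i))
    * (∏ i with IsCdfall σ i, c (lcross σ i) (lnest σ i))
    * (∏ i with IsCdrise σ i, d (ucross σ i) (unest σ i))
    * ∏ i with σ i = i, e (lev σ i)

/-- The weight of the second master polynomial. -/
def wMaster2 {R : Type*} [CommRing R] (a : ℕ → R) (b c d : ℕ → ℕ → R) (e : ℕ → R) (lam : R)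
    (n : ℕ) (σ : Perm (Fin n)) : R :=
  lam ^ cyc σ * (∏ i with IsCval σ i, a (ucross σ i + unest σ i))
    * (∏ i with IsCpeak σ i, b (lcross σ i) (lnest σ i))
    * (∏ i with IsCdfall σ i, c (lcross σ i) (lnest σ i))
    * (∏ i with IsCdrise σ i, d (ucross σ i + unest σ i) (unest σ (σ⁻¹ i)))
    * ∏ i with σ i = i, e (lev σ i)

end PermStat

/-! ## Set partitions of `{1,…,n}`, modelled by `Fin n` -/

/-- The set partitions of `{1,…,n}`. -/
abbrev SetPart (n : ℕ) : Type := Finpartition (univ : Finset (Fin n))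

namespace PartStat

/-- The number of dividers, which is the number of connected components: `i` is a divider if
`{1,…,i}` is a union of blocks. -/
def cc (n : ℕ) (π : SetPart n) : ℕ := #{i | ∀ j ≤ i, ∀ k ∈ π.part j, k ≤ i}

/-- `i < j` are consecutive elements of a block. -/
abbrev Edge {n : ℕ} (π : SetPart n) (i j : Fin n) : Prop :=
  i < j ∧ j ∈ π.part i ∧ ∀ k ∈ π.part i, ¬ (i < k ∧ k < j)

abbrev IsOpener {n : ℕ} (π : SetPart n) (i : Fin n) : Prop :=
  2 ≤ #(π.part i) ∧ ∀ j ∈ π.part i, i ≤ j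
abbrev IsCloser {n : ℕ} (π : SetPart n) (i : Fin n) : Prop :=
  2 ≤ #(π.part i) ∧ ∀ j ∈ π.part i, j ≤ i
abbrev IsInsider {n : ℕ} (π : SetPart n) (i : Fin n) : Prop :=
  3 ≤ #(π.part i) ∧ ¬ IsOpener π i ∧ ¬ IsCloser π i
abbrev IsSingleton {n : ℕ} (π : SetPart n) (i : Fin n) : Prop := #(π.part i) = 1

/-- `i` is an exclusive record: it has a right neighbour `l` within its block, and the right
neighbour of any `j < i`, if there is one, is smaller than `l`. -/
abbrev IsErec {n : ℕ} (π : SetPart n) (i : Fin n) : Prop :=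
  ∃ l, Edge π i l ∧ ∀ j < i, ∀ m, Edge π j m → m < l

/-- `max B < max B'` (for nonempty sets). -/
abbrev MaxLT {n : ℕ} (B B' : Finset (Fin n)) : Prop := ∃ c ∈ B', ∀ b ∈ B, b < c
/-- `min B < min B'` (for nonempty sets). -/
abbrev MinLT {n : ℕ} (B B' : Finset (Fin n)) : Prop := ∃ c ∈ B, ∀ b ∈ B', c < b
/-- `min B < j`. -/
abbrev MinBelow {n : ℕ} (B : Finset (Fin n)) (j : Fin n) : Prop := ∃ a ∈ B, a < j
/-- `j < max B`. -/
abbrev MaxAbove {n : ℕ} (B : Finset (Fin n)) (j : Fin n) : Prop := ∃ b ∈ B, j < b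

/-- `j` is a block-record: an opener or insider of a block `B` such that no block `B'` satisfies
`min B' < j < max B < max B'`. -/
abbrev IsBrec {n : ℕ} (π : SetPart n) (j : Fin n) : Prop :=
  (IsOpener π j ∨ IsInsider π j) ∧
    ¬ ∃ B' ∈ π.parts, MinBelow B' j ∧ MaxAbove (π.part j) j ∧ MaxLT (π.part j) B'

def erec {n : ℕ} (π : SetPart n) : ℕ := #{i | IsErec π i}
/-- The number of singletons. -/
def m1 {n : ℕ} (π : SetPart n) : ℕ := #{B ∈ π.parts | #B = 1}
/-- The number of blocks of size at least `2`. -/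
def m2 {n : ℕ} (π : SetPart n) : ℕ := #{B ∈ π.parts | 2 ≤ #B}
def erecin {n : ℕ} (π : SetPart n) : ℕ := #{i | IsInsider π i ∧ IsErec π i}
def erecop {n : ℕ} (π : SetPart n) : ℕ := #{i | IsOpener π i ∧ IsErec π i}
def nerecin {n : ℕ} (π : SetPart n) : ℕ := #{i | IsInsider π i ∧ ¬ IsErec π i}
def nerecop {n : ℕ} (π : SetPart n) : ℕ := #{i | IsOpener π i ∧ ¬ IsErec π i}
def brecin {n : ℕ} (π : SetPart n) : ℕ := #{i | IsInsider π i ∧ IsBrec π i}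
def brecop {n : ℕ} (π : SetPart n) : ℕ := #{i | IsOpener π i ∧ IsBrec π i}
def nbrecin {n : ℕ} (π : SetPart n) : ℕ := #{i | IsInsider π i ∧ ¬ IsBrec π i}
def nbrecop {n : ℕ} (π : SetPart n) : ℕ := #{i | IsOpener π i ∧ ¬ IsBrec π i}

/-- Crossings `i < j < k < l` with edges `(i,k)`, `(j,l)` and given `j`. -/
def cr {n : ℕ} (π : SetPart n) (j : Fin n) : ℕ :=
  #{t : Fin n × Fin n × Fin n | t.1 < j ∧ j < t.2.1 ∧ t.2.1 < t.2.2 ∧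
    Edge π t.1 t.2.1 ∧ Edge π j t.2.2}
/-- Nestings `i < j < k < l` with edges `(i,l)`, `(j,k)` and given `j`. -/
def ne {n : ℕ} (π : SetPart n) (j : Fin n) : ℕ :=
  #{t : Fin n × Fin n × Fin n | t.1 < j ∧ j < t.2.1 ∧ t.2.1 < t.2.2 ∧
    Edge π t.1 t.2.2 ∧ Edge π j t.2.1}
/-- Quasi-nestings `i < j < l` with an edge `(i,l)` and given `j`. -/
def qne {n : ℕ} (π : SetPart n) (j : Fin n) : ℕ :=
  #{t : Fin n × Fin n | t.1 < j ∧ j < t.2 ∧ Edge π t.1 t.2}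
def crin {n : ℕ} (π : SetPart n) : ℕ := ∑ j with IsInsider π j, cr π j
def crop {n : ℕ} (π : SetPart n) : ℕ := ∑ j with IsOpener π j, cr π j
def nein {n : ℕ} (π : SetPart n) : ℕ := ∑ j with IsInsider π j, ne π j
def neop {n : ℕ} (π : SetPart n) : ℕ := ∑ j with IsOpener π j, ne π j
/-- Pseudo-nestings `i < j < l` with `j` a singleton and an edge `(i,l)`. -/
def psne {n : ℕ} (π : SetPart n) : ℕ := ∑ j with IsSingleton π j, qne π j

/-- The number of blocks `B₁` with `min B₁ < j < max B₁ < max B₂`, where `B₂ ∋ j`. -/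
def ovAt {n : ℕ} (π : SetPart n) (j : Fin n) : ℕ :=
  #{B ∈ π.parts | MinBelow B j ∧ MaxAbove B j ∧ MaxLT B (π.part j)}
/-- The number of blocks `B₁` with `min B₁ < j < max B₂ < max B₁`, where `B₂ ∋ j`. -/
def covAt {n : ℕ} (π : SetPart n) (j : Fin n) : ℕ :=
  #{B ∈ π.parts | MinBelow B j ∧ MaxAbove (π.part j) j ∧ MaxLT (π.part j) B}
/-- Overlaps: pairs of blocks with `min B₁ < min B₂ < max B₁ < max B₂`. -/
def ov {n : ℕ} (π : SetPart n) : ℕ :=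
  #{P ∈ π.parts ×ˢ π.parts | MinLT P.1 P.2 ∧ (∃ a ∈ P.2, ∃ b ∈ P.1, a < b) ∧ MaxLT P.1 P.2}
/-- Coverings: pairs of blocks with `min B₁ < min B₂ < max B₂ < max B₁`. -/
def cov {n : ℕ} (π : SetPart n) : ℕ :=
  #{P ∈ π.parts ×ˢ π.parts | MinLT P.1 P.2 ∧ 2 ≤ #P.2 ∧ MaxLT P.2 P.1}
/-- Pseudo-coverings: pairs of blocks with `min B₁ < min B₂ = max B₂ < max B₁`. -/
def pscov {n : ℕ} (π : SetPart n) : ℕ :=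
  #{P ∈ π.parts ×ˢ π.parts | MinLT P.1 P.2 ∧ #P.2 = 1 ∧ MaxLT P.2 P.1}
def ovin {n : ℕ} (π : SetPart n) : ℕ := ∑ j with IsInsider π j, ovAt π j
def covin {n : ℕ} (π : SetPart n) : ℕ := ∑ j with IsInsider π j, covAt π j

/-- `x^|π| y^erec v^(n-|π|-erec)`. -/
def wErec {R : Type*} [CommRing R] (x y v : R) (n : ℕ) (π : SetPart n) : R :=
  x ^ #π.parts * y ^ erec π * v ^ (n - #π.parts - erec π)

/-- The weight that distinguishes exclusive records among insiders and openers. -/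
def wErecInOp {R : Type*} [CommRing R] (x₁ x₂ y₁ y₂ v₁ v₂ : R) (n : ℕ) (π : SetPart n) : R :=
  x₁ ^ m1 π * x₂ ^ m2 π * y₁ ^ erecin π * y₂ ^ erecop π * v₁ ^ nerecin π * v₂ ^ nerecop π

/-- The preceding weight, together with refined crossings and nestings. -/
def wCrNe {R : Type*} [CommRing R] (x₁ x₂ y₁ y₂ v₁ v₂ p₁ p₂ q₁ q₂ r : R)
    (n : ℕ) (π : SetPart n) : R :=
  wErecInOp x₁ x₂ y₁ y₂ v₁ v₂ n π
    * p₁ ^ crin π * p₂ ^ crop π * q₁ ^ nein π * q₂ ^ neop π * r ^ psne π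

/-- The weight of block-records, overlaps and coverings. -/
def wOvCov {R : Type*} [CommRing R] (x₁ x₂ y₁ y₂ v₁ v₂ p₁ p₂ q₁ q₂ r : R)
    (n : ℕ) (π : SetPart n) : R :=
  x₁ ^ m1 π * x₂ ^ m2 π * y₁ ^ brecin π * y₂ ^ brecop π * v₁ ^ nbrecin π * v₂ ^ nbrecop π
    * p₁ ^ ovin π * p₂ ^ ov π * q₁ ^ covin π * q₂ ^ cov π * r ^ pscov π

/-- The weight of the first master polynomial. -/
def wMaster1 {R : Type*} [CommRing R] (a : ℕ → ℕ → R) (b : ℕ → R) (d : ℕ → ℕ → R) (e : ℕ → R)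
    (n : ℕ) (π : SetPart n) : R :=
  (∏ i with IsOpener π i, a (cr π i) (ne π i)) * (∏ i with IsCloser π i, b (qne π i))
    * (∏ i with IsInsider π i, d (cr π i) (ne π i)) * ∏ i with IsSingleton π i, e (qne π i)

/-- The weight of the second master polynomial. -/
def wMaster2 {R : Type*} [CommRing R] (a : ℕ → ℕ → R) (b : ℕ → R) (d : ℕ → ℕ → R) (e : ℕ → R)
    (n : ℕ) (π : SetPart n) : R :=
  (∏ i with IsOpener π i, a (ovAt π i) (covAt π i)) * (∏ i with IsCloser π i, b (qne π i))
    * (∏ i with IsInsider π i, d (ovAt π i) (covAt π i)) * ∏ i with IsSingleton π i, e (qne π i)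

/-- The weight of the third master polynomial. -/
def wMaster3 {R : Type*} [CommRing R] (a : ℕ → ℕ → R) (b : ℕ → R) (d : ℕ → ℕ → R) (e : ℕ → R)
    (n : ℕ) (π : SetPart n) : R :=
  (∏ i with IsOpener π i, a (ovAt π i) (covAt π i)) * (∏ i with IsCloser π i, b (qne π i))
    * (∏ i with IsInsider π i, d (cr π i) (ne π i)) * ∏ i with IsSingleton π i, e (qne π i)

/-- The weight of the fourth master polynomial. -/
def wMaster4 {R : Type*} [CommRing R] (a : ℕ → ℕ → R) (b : ℕ → R) (d : ℕ → ℕ → R) (e : ℕ → R)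
    (n : ℕ) (π : SetPart n) : R :=
  (∏ i with IsOpener π i, a (cr π i) (ne π i)) * (∏ i with IsCloser π i, b (qne π i))
    * (∏ i with IsInsider π i, d (ovAt π i) (covAt π i)) * ∏ i with IsSingleton π i, e (qne π i)

end PartStat

/-! ## Perfect matchings of `{1,…,2n}` -/

/-- The fixed-point-free involutions of `{1,…,2n}`. -/
abbrev FPFInvol (n : ℕ) : Type :=
  {σ : Equiv.Perm (Fin (2 * n)) // ∀ i, σ (σ i) = i ∧ σ i ≠ i}

/-- The set partitions of `{1,…,2n}` into blocks of size `2`. -/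
abbrev PerfMatch (n : ℕ) : Type := {π : SetPart (2 * n) // ∀ B ∈ π.parts, #B = 2}

namespace MatchStat

open PermStat

/-- The number of connected components of a fixed-point-free involution. -/
def cc (n : ℕ) (σ : FPFInvol n) : ℕ := PermStat.cc (2 * n) σ.1

/-- The number of connected components of a partition into pairs. -/
def ccPart (n : ℕ) (π : PerfMatch n) : ℕ := PartStat.cc (2 * n) π.1

/-- The element of `{1,…,m}` modelled by `i : Fin m` is `i + 1`; this says that it is even. -/
abbrev IsEven {m : ℕ} (i : Fin m) : Prop := Even ((i : ℕ) + 1)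

/-- `x^ecpar y^ocpar u^ecpnar v^ocpnar`: even/odd cycle peaks that are (not) antirecords. -/
def wPeak {R : Type*} [CommRing R] (x y u v : R) (n : ℕ) (σ : FPFInvol n) : R :=
  x ^ #{i | IsCpeak σ.1 i ∧ IsEven i ∧ IsArec σ.1 i}
    * y ^ #{i | IsCpeak σ.1 i ∧ ¬ IsEven i ∧ IsArec σ.1 i}
    * u ^ #{i | IsCpeak σ.1 i ∧ IsEven i ∧ ¬ IsArec σ.1 i}
    * v ^ #{i | IsCpeak σ.1 i ∧ ¬ IsEven i ∧ ¬ IsArec σ.1 i}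

/-- `x^ocvr y^ecvr u^ocvnr v^ecvnr`: odd/even cycle valleys that are (not) records. -/
def wVal {R : Type*} [CommRing R] (x y u v : R) (n : ℕ) (σ : FPFInvol n) : R :=
  x ^ #{i | IsCval σ.1 i ∧ ¬ IsEven i ∧ IsRec σ.1 i}
    * y ^ #{i | IsCval σ.1 i ∧ IsEven i ∧ IsRec σ.1 i}
    * u ^ #{i | IsCval σ.1 i ∧ ¬ IsEven i ∧ ¬ IsRec σ.1 i}
    * v ^ #{i | IsCval σ.1 i ∧ IsEven i ∧ ¬ IsRec σ.1 i}

/-- The preceding weights, together with `p^cr q^ne`. -/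
def wPeakPQ {R : Type*} [CommRing R] (x y u v p q : R) (n : ℕ) (σ : FPFInvol n) : R :=
  wPeak x y u v n σ * p ^ ucrossT σ.1 * q ^ unestT σ.1
def wValPQ {R : Type*} [CommRing R] (x y u v p q : R) (n : ℕ) (σ : FPFInvol n) : R :=
  wVal x y u v n σ * p ^ ucrossT σ.1 * q ^ unestT σ.1

/-- The weight of the master polynomial for perfect matchings. -/
def wMaster {R : Type*} [CommRing R] (a : ℕ → ℕ → R) (b : ℕ → R) (n : ℕ) (π : PerfMatch n) : R :=
  (∏ i with PartStat.IsOpener π.1 i, a (PartStat.cr π.1 i) (PartStat.ne π.1 i))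
    * ∏ i with PartStat.IsCloser π.1 i, b (PartStat.qne π.1 i)

end MatchStat

open CFrac

/-! ### Continued fractions: uniqueness of tails, contraction, and the effect of `ζ` on the first
level -/

namespace CFrac

variable {R : Type*} [CommRing R]

/-! Every polynomial is rewritten as a sum of products of local weights, one factor for each index.
The factor depends on the type of the index (cycle valley, peak, double rise, double fall or fixed
point; opener, closer, insider or singleton) and on crossing and nesting numbers there. When an
object is scanned from left to right, the number of arcs over the current gap is the height of a
Motzkin path, and the types of the indices are its steps. The crossing and nesting numbers at an
index add up to the height or to the height minus one, so the height and one of them, kept as a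
label of the step, give the local factor. If labelled words correspond bijectively to objects, the
generating function is a J-fraction: `γ_h` is the total weight of the level letters at height `h`,
and `β_h` is that of the up letters at height `h - 1` times that of the down letters at height `h`.

Only the injectivity of the codes is proved directly: arcs are reconstructed one by one, a label
being the rank of the correct end among those that are still free. Bijectivity then follows by
counting (`sum_eq_coeff_jFrac`): the number of words is itself a coefficient of a J-fraction, which
is `n!` by Euler's fraction for permutations, and at most the number of partitions by
`coeff_jFrac_bell_le`.

For permutations two codes are needed. `crossCode` labels an upper arc at its beginning and yields
the first master polynomial. `chainCode` labels it at its end, where it can be seen whether a cycle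
closes: of the `h` loose arcs that can be attached to a cycle peak, exactly one closes a cycle,
whence the factor `lam + (h - 1) * mu`. The price is that a valley carries no label, so its weight
may depend only on the sum of its crossing and nesting numbers. The remaining permutation
polynomials are specializations, in one case after inversion.

The factor `ζ^cc` is handled in two ways. For permutations the local weights are multiplicative
under direct sums, so the series `G(ζ)` and the indecomposable series `I` satisfy `(1 - ζ I) G(ζ) =
1` (`Decomposes`). At `ζ = 1` this identifies `I` with the first level of the fraction, and then `ζ`
just multiplies that level. For set partitions direct sums are avoided: a divider is a closer or
singleton with no edge above it, so `ζ^cc` replaces `b 0` and `e 0` by `ζ` times them, within the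
same family of weights. Taking `ζ` to be the dual number `ε` isolates the indecomposable objects.

Perfect matchings are the partitions that survive when insiders and singletons get weight zero. Then
all `γ` vanish, and the J-fraction is an S-fraction in `t²`. Along a matching the height has the
parity of the position, which gives the parity-refined weights; reversal exchanges valleys with
peaks. All other S-fractions come from J-fractions by contraction (`sFrac_eq_jFrac`). -/

open PowerSeries in
theorem eq_of_left_inv {a b c : PowerSeries R} (hb : a * b = 1) (hc : a * c = 1) : b = c := by
  linear_combination (-b) * hc + c * hb

/-- A family that satisfies the recurrence of the tails of a J-fraction equals these tails. -/
theorem eq_jTail (γ β : ℕ → R) (F : ℕ → PowerSeries R)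
    (hF : ∀ k, (1 - PowerSeries.C (γ k) * PowerSeries.X
      - PowerSeries.C (β (k + 1)) * PowerSeries.X ^ 2 * F (k + 1)) * F k = 1) (k : ℕ) :
    F k = jTail γ β k := by
  have key : ∀ n k, (PowerSeries.X : PowerSeries R) ^ n ∣ F k - jTail γ β k := by
    intro n
    induction n with
    | zero => intro k; simp
    | succ n ih =>
      intro k
      obtain ⟨A, hA⟩ := ih (k + 1)
      -- The difference at `k` is `β_{k+1} X²` times the difference at `k + 1` times `F k * jTail γ
      -- β k`; one factor `X` already raises the exponent.
      refine ⟨PowerSeries.C (β (k + 1)) * PowerSeries.X * A * F k * jTail γ β k, ?_⟩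
      linear_combination (jTail γ β k) * hF k - F k * jTail_spec γ β k
        + PowerSeries.C (β (k + 1)) * PowerSeries.X ^ 2 * F k * jTail γ β k * hA
  ext n
  have := (PowerSeries.X_pow_dvd_iff.mp (key (n + 1) k)) n (by omega)
  rwa [map_sub, sub_eq_zero] at this

theorem eq_sTail (α : ℕ → R) (F : ℕ → PowerSeries R)
    (hF : ∀ k, (1 - PowerSeries.C (α (k + 1)) * PowerSeries.X * F (k + 1)) * F k = 1) (k : ℕ) :
    F k = sTail α k := by
  have key : ∀ n k, (PowerSeries.X : PowerSeries R) ^ n ∣ F k - sTail α k := by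
    intro n
    induction n with
    | zero => intro k; simp
    | succ n ih =>
      intro k
      obtain ⟨A, hA⟩ := ih (k + 1)
      refine ⟨PowerSeries.C (α (k + 1)) * A * F k * sTail α k, ?_⟩
      linear_combination (sTail α k) * hF k - F k * sTail_spec α k
        + PowerSeries.C (α (k + 1)) * PowerSeries.X * F k * sTail α k * hA
  ext n
  have := (PowerSeries.X_pow_dvd_iff.mp (key (n + 1) k)) n (by omega)
  rwa [map_sub, sub_eq_zero] at this

/-- After a shift of the index by `k` both families of tails solve the same recurrence, so
uniqueness applies. -/
theorem jTail_congr {γ γ' β β' : ℕ → R} {k : ℕ} (hγ : ∀ n, k ≤ n → γ n = γ' n)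
    (hβ : ∀ n, k < n → β n = β' n) : jTail γ β k = jTail γ' β' k := by
  have h := eq_jTail (fun n => γ (n + k)) (fun n => β (n + k)) (fun j => jTail γ β (j + k))
    (fun j => by simpa [add_right_comm] using jTail_spec γ β (j + k)) 0
  have h' := eq_jTail (fun n => γ (n + k)) (fun n => β (n + k)) (fun j => jTail γ' β' (j + k))
    (fun j => by
      have := jTail_spec γ' β' (j + k)
      rw [← hγ _ (by omega), ← hβ _ (by omega)] at this
      simpa [add_right_comm] using this) 0
  simpa using h.trans h'.symm

theorem sTail_congr {α α' : ℕ → R} {k : ℕ} (hα : ∀ n, k < n → α n = α' n) :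
    sTail α k = sTail α' k := by
  have h := eq_sTail (fun n => α (n + k)) (fun j => sTail α (j + k))
    (fun j => by simpa [add_right_comm] using sTail_spec α (j + k)) 0
  have h' := eq_sTail (fun n => α (n + k)) (fun j => sTail α' (j + k))
    (fun j => by
      have := sTail_spec α' (j + k)
      rw [← hα _ (by omega)] at this
      simpa [add_right_comm] using this) 0
  simpa using h.trans h'.symm

/-- Contraction of an S-fraction to a J-fraction. -/
theorem sFrac_eq_jFrac {α γ β : ℕ → R} (h0 : γ 0 = α 1)
    (hγ : ∀ n, γ (n + 1) = α (2 * n + 2) + α (2 * n + 3))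
    (hβ : ∀ n, β (n + 1) = α (2 * n + 1) * α (2 * n + 2)) : sFrac α = jFrac γ β := by
  -- Two consecutive levels of the S-fraction form one level of the J-fraction, except at the top,
  -- where level `0` is taken alone.
  let F : ℕ → PowerSeries R := fun k =>
    if k = 0 then sTail α 0 else sTail α (2 * k - 1) * sTail α (2 * k)
  have := eq_jTail γ β F ?_ 0
  · simpa [F, sFrac, jFrac] using this
  intro k
  rcases k with _ | k
  · simp only [F, h0, hβ]
    have h1 := sTail_spec α 0
    have h2 := sTail_spec α 1
    simp only [zero_add, if_true, one_ne_zero, if_false, mul_zero, mul_one, map_mul] at *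
    norm_num at *
    linear_combination h1 + (PowerSeries.C (α 1) * PowerSeries.X * sTail α 0) * h2
  · have h1 := sTail_spec α (2 * k + 1)
    have h2 := sTail_spec α (2 * k + 2)
    have h3 := sTail_spec α (2 * k + 3)
    have e2 : 2 * (k + 1) = 2 * k + 2 := by omega
    have e4 : 2 * (k + 1 + 1) = 2 * k + 4 := by omega
    simp only [F, hγ, hβ, e2, e4, map_mul, map_add, Nat.succ_ne_zero, if_false]
    set a := PowerSeries.C (α (2 * k + 2))
    set b := PowerSeries.C (α (2 * k + 3))
    set c := PowerSeries.C (α (2 * k + 4))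
    set A := sTail α (2 * k + 1)
    set B := sTail α (2 * k + 2)
    set D := sTail α (2 * k + 3)
    set E := sTail α (2 * k + 4)
    set X : PowerSeries R := PowerSeries.X
    have h1' : (1 - a * X * B) * A = 1 := h1
    have h2' : (1 - b * X * D) * B = 1 := h2
    have h3' : (1 - c * X * E) * D = 1 := h3
    change (1 - (a + b) * X - b * c * X ^ 2 * (D * E)) * (A * B) = 1
    linear_combination h1' + A * h2' + b * X * A * B * h3'

/-- A J-fraction with vanishing `γ` is an S-fraction in `t²`. -/
theorem jTail_zero_coeff (β : ℕ → R) (k n : ℕ) :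
    PowerSeries.coeff (2 * n) (jTail (fun _ => 0) β k) = PowerSeries.coeff n (sTail β k) := by
  have h := eq_jTail (fun _ => 0) β (fun k => PowerSeries.expand 2 two_ne_zero (sTail β k)) ?_ k
  · rw [← h, PowerSeries.coeff_expand_mul]
  · intro k
    have := congrArg (PowerSeries.expand 2 two_ne_zero) (sTail_spec β k)
    simpa [PowerSeries.expand_C] using this

/-- The generating function factors over the connected components. -/
def Decomposes {S : ℕ → Type} [∀ n, Fintype (S n)]
    (cc : ∀ n, S n → ℕ) (w : ∀ n, S n → R) : Prop :=
  ∀ ζ : R, (1 - PowerSeries.C ζ * gfIndec cc w) * gfCC cc w ζ = 1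

variable {S : ℕ → Type} [∀ n, Fintype (S n)] {cc : ∀ n, S n → ℕ} {w : ∀ n, S n → R}

/-- Only the first level of the fraction contains `ζ`; the tail below it is the one that occurs in
the series of the indecomposable objects. -/
theorem CountsS.decomposes {α : ℕ → R} (h : CountsS cc w α) : Decomposes cc w := by
  intro ζ
  rw [h.1, h.2]
  have := sTail_spec (Function.update α 1 (ζ * α 1)) 0
  rw [sTail_congr (k := 0 + 1) (α' := α)] at this
  · simpa [sFrac, mul_assoc] using this
  · intro n hn
    rw [Function.update_of_ne (by omega)]

theorem CountsJ.decomposes {γ β : ℕ → R} (h : CountsJ cc w γ β) : Decomposes cc w := by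
  intro ζ
  rw [h.1, h.2]
  have := jTail_spec (Function.update γ 0 (ζ * γ 0)) (Function.update β 1 (ζ * β 1)) 0
  rw [jTail_congr (k := 0 + 1) (γ' := γ) (β' := β)] at this
  · simp only [jFrac, Function.update_self, zero_add, map_mul] at *
    linear_combination this
  · intro n hn
    rw [Function.update_of_ne (by omega)]
  · intro n hn
    rw [Function.update_of_ne (by omega)]

/-- At `ζ = 1` the factorization makes the indecomposable series equal to one minus the inverse of
the full series, which is the first level of the fraction. For general `ζ` this level is multiplied
by `ζ`. Hence only the continued fraction at `ζ = 1` has to be found. -/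
theorem Decomposes.countsS (h : Decomposes cc w) {α : ℕ → R} (hα : gfCC cc w 1 = sFrac α) :
    CountsS cc w α := by
  have hI : gfIndec cc w = PowerSeries.C (α 1) * PowerSeries.X * sTail α 1 := by
    have h1 := h 1
    rw [hα, map_one, one_mul] at h1
    have h2 := sTail_spec α 0
    rw [← sFrac, zero_add] at h2
    rw [mul_comm] at h1 h2
    linear_combination - eq_of_left_inv h1 h2
  refine ⟨fun ζ => ?_, hI⟩
  have h1 := h ζ
  have h2 := sTail_spec (Function.update α 1 (ζ * α 1)) 0
  rw [sTail_congr (k := 0 + 1) (α' := α)] at h2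
  · rw [hI] at h1
    refine eq_of_left_inv h1 ?_
    simpa [sFrac, mul_assoc] using h2
  · intro n hn
    rw [Function.update_of_ne (by omega)]

theorem Decomposes.countsJ (h : Decomposes cc w) {γ β : ℕ → R} (hγ : gfCC cc w 1 = jFrac γ β) :
    CountsJ cc w γ β := by
  have hI : gfIndec cc w = PowerSeries.C (γ 0) * PowerSeries.X
      + PowerSeries.C (β 1) * PowerSeries.X ^ 2 * jTail γ β 1 := by
    have h1 := h 1
    rw [hγ, map_one, one_mul] at h1
    have h2 := jTail_spec γ β 0
    rw [← jFrac, zero_add] at h2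
    rw [mul_comm] at h1 h2
    linear_combination - eq_of_left_inv h1 h2
  refine ⟨fun ζ => ?_, hI⟩
  have h1 := h ζ
  have h2 := jTail_spec (Function.update γ 0 (ζ * γ 0)) (Function.update β 1 (ζ * β 1)) 0
  rw [jTail_congr (k := 0 + 1) (γ' := γ) (β' := β)] at h2
  · rw [hI] at h1
    refine eq_of_left_inv h1 ?_
    simp only [jFrac, Function.update_self, zero_add, map_mul] at *
    linear_combination h2
  · intro n hn
    rw [Function.update_of_ne (by omega)]
  · intro n hn
    rw [Function.update_of_ne (by omega)]

theorem Decomposes.modifies (h : Decomposes cc w) : Modifies cc w :=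
  ⟨fun _ => h.countsS, fun _ _ => h.countsJ⟩

theorem CountsJ.gf_eq {γ β : ℕ → R} (h : CountsJ cc w γ β) : gfCC cc w 1 = jFrac γ β := by
  simpa using h.1 1

theorem CountsS.gf_eq {α : ℕ → R} (h : CountsS cc w α) : gfCC cc w 1 = sFrac α := by
  simpa using h.1 1

/-- Passing through `Decomposes` reduces the comparison to `ζ = 1`. The value `β 0` is left free,
since no level of the fraction uses it. -/
theorem CountsJ.congr {γ β γ' β' : ℕ → R} (h : CountsJ cc w γ β) (hγ : ∀ n, γ n = γ' n)
    (hβ : ∀ n, β (n + 1) = β' (n + 1)) : CountsJ cc w γ' β' := by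
  refine h.decomposes.countsJ (h.gf_eq.trans (jTail_congr (fun n _ => hγ n) fun n hn => ?_))
  obtain ⟨m, rfl⟩ := Nat.exists_eq_succ_of_ne_zero hn.ne'
  exact hβ m

theorem CountsJ.toS {γ β α : ℕ → R} (h : CountsJ cc w γ β) (h0 : γ 0 = α 1)
    (hγ : ∀ n, γ (n + 1) = α (2 * n + 2) + α (2 * n + 3))
    (hβ : ∀ n, β (n + 1) = α (2 * n + 1) * α (2 * n + 2)) : CountsS cc w α :=
  h.decomposes.countsS (h.gf_eq.trans (sFrac_eq_jFrac h0 hγ hβ).symm)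

theorem oddEven_odd {T : Type*} (f g : ℕ → T) (n : ℕ) : oddEven f g (2 * n + 1) = f (n + 1) := by
  have : ¬ Even (2 * n + 1) := by simp
  rw [oddEven, if_neg this]
  congr 1
  omega

theorem oddEven_even {T : Type*} (f g : ℕ → T) (n : ℕ) : oddEven f g (2 * n + 2) = g (n + 1) := by
  have : Even (2 * n + 2) := by simp [Nat.even_add]
  rw [oddEven, if_pos this]
  congr 1
  omega

theorem CountsJ.toOddEven {γ β f g : ℕ → R} (h : CountsJ cc w γ β) (h0 : γ 0 = f 1)
    (hγ : ∀ n, γ (n + 1) = g (n + 1) + f (n + 2))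
    (hβ : ∀ n, β (n + 1) = f (n + 1) * g (n + 1)) : CountsS cc w (oddEven f g) := by
  refine h.toS ?_ (fun n => ?_) (fun n => ?_)
  · rw [h0]; exact (oddEven_odd f g 0).symm
  · rw [hγ, oddEven_even, show 2 * n + 3 = 2 * (n + 1) + 1 by ring, oddEven_odd]
  · rw [hβ, oddEven_even, oddEven_odd]

theorem CountsS.congr {f g f' g' : ℕ → R} (h : CountsS cc w (oddEven f g))
    (hf : ∀ n, f (n + 1) = f' (n + 1)) (hg : ∀ n, g (n + 1) = g' (n + 1)) :
    CountsS cc w (oddEven f' g') := by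
  refine h.decomposes.countsS (h.gf_eq.trans (sTail_congr fun n hn => ?_))
  rcases Nat.even_or_odd' n with ⟨m, rfl | rfl⟩
  · obtain ⟨m, rfl⟩ := Nat.exists_eq_succ_of_ne_zero (show m ≠ 0 by omega)
    rw [show 2 * (m + 1) = 2 * m + 2 by ring, oddEven_even, oddEven_even, hg]
  · rw [oddEven_odd, oddEven_odd, hf]

theorem gfCC_congr {S' : ℕ → Type} [∀ n, Fintype (S' n)] {cc' : ∀ n, S' n → ℕ}
    {w' : ∀ n, S' n → R} (e : ∀ n, S n ≃ S' n) (hcc : ∀ n s, cc' n (e n s) = cc n s)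
    (hw : ∀ n s, w' n (e n s) = w n s) (ζ : R) : gfCC cc w ζ = gfCC cc' w' ζ := by
  ext n
  simp only [gfCC, PowerSeries.coeff_mk]
  exact Fintype.sum_equiv (e n) _ _ fun s => by rw [hcc, hw]

theorem gfIndec_congr {S' : ℕ → Type} [∀ n, Fintype (S' n)] {cc' : ∀ n, S' n → ℕ}
    {w' : ∀ n, S' n → R} (e : ∀ n, S n ≃ S' n) (hcc : ∀ n s, cc' n (e n s) = cc n s)
    (hw : ∀ n s, w' n (e n s) = w n s) : gfIndec cc w = gfIndec cc' w' := by
  ext n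
  simp only [gfIndec, PowerSeries.coeff_mk, Finset.sum_filter]
  exact Fintype.sum_equiv (e n) _ _ fun s => by rw [hcc, hw]

end CFrac

/-! ## Labelled Motzkin words -/

namespace MotzkinWord

/-- Letters of labelled Motzkin words: up, level, down steps with labels in `U`, `L`, `D`. -/
abbrev Letter (U L D : Type) : Type := U ⊕ (L ⊕ D)

variable {U L D : Type}

/-- The height after a letter is read at height `h`. -/
def nextHeight (h : ℕ) : Letter U L D → ℕ
  | .inl _ => h + 1
  | .inr (.inl _) => h
  | .inr (.inr _) => h - 1

/-- The letters that are allowed at height `h`. -/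
def allowed (VU : ℕ → Finset U) (VL : ℕ → Finset L) (VD : ℕ → Finset D) (h : ℕ) :
    Finset (Letter U L D) :=
  (VU h).disjSum ((VL h).disjSum (VD h))

open Classical in
/-- The words of length `n` that lead from height `h` to height `0`. -/
noncomputable def words (VU : ℕ → Finset U) (VL : ℕ → Finset L) (VD : ℕ → Finset D) :
    ℕ → ℕ → Finset (List (Letter U L D))
  | 0, h => if h = 0 then {[]} else ∅
  | n + 1, h => (allowed VU VL VD h).biUnion fun k =>
      (words VU VL VD n (nextHeight h k)).image (List.cons k)

variable {R : Type*} [CommRing R]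

/-- The product of the weights of the letters of a word. -/
def weight (wt : ℕ → Letter U L D → R) : ℕ → List (Letter U L D) → R
  | _, [] => 1
  | h, k :: l => wt h k * weight wt (nextHeight h k) l

variable (VU : ℕ → Finset U) (VL : ℕ → Finset L) (VD : ℕ → Finset D)

noncomputable def wordSum (wt : ℕ → Letter U L D → R) (n h : ℕ) : R :=
  ∑ l ∈ words VU VL VD n h, weight wt h l

theorem wordSum_succ' (wt : ℕ → Letter U L D → R) (n h : ℕ) :
    wordSum VU VL VD wt (n + 1) h
      = ∑ k ∈ allowed VU VL VD h, wt h k * wordSum VU VL VD wt n (nextHeight h k) := by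
  classical
  rw [wordSum, words, Finset.sum_biUnion]
  · refine Finset.sum_congr rfl fun k _ => ?_
    rw [Finset.sum_image (by simp), wordSum, Finset.mul_sum]
    rfl
  · intro k _ k' _ hk
    rw [Function.onFun, Finset.disjoint_left]
    intro l hl hl'
    simp only [Finset.mem_image] at hl hl'
    obtain ⟨a, _, rfl⟩ := hl
    obtain ⟨b, _, hb⟩ := hl'
    exact hk (List.cons.inj hb).1.symm

theorem wordSum_succ (wt : ℕ → Letter U L D → R) (n h : ℕ) :
    wordSum VU VL VD wt (n + 1) h
      = (∑ k ∈ VU h, wt h (.inl k)) * wordSum VU VL VD wt n (h + 1)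
        + (∑ k ∈ VL h, wt h (.inr (.inl k))) * wordSum VU VL VD wt n h
        + (∑ k ∈ VD h, wt h (.inr (.inr k))) * wordSum VU VL VD wt n (h - 1) := by
  rw [wordSum_succ', allowed, Finset.sum_disjSum, Finset.sum_disjSum, Finset.sum_mul,
    Finset.sum_mul, Finset.sum_mul, add_assoc]
  rfl

theorem wordSum_zero (wt : ℕ → Letter U L D → R) (h : ℕ) :
    wordSum VU VL VD wt 0 h = if h = 0 then 1 else 0 := by
  classical
  rw [wordSum, words]
  split_ifs <;> simp [weight]

/-- A function that satisfies the recurrence for weighted Motzkin paths is given by a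
J-fraction. -/
theorem motzkin_eq_jFrac (u l d : ℕ → R) (Z : ℕ → ℕ → R) (h0 : ∀ h, Z 0 h = if h = 0 then 1 else 0)
    (hZ0 : ∀ n, Z (n + 1) 0 = u 0 * Z n 1 + l 0 * Z n 0)
    (hZ : ∀ n h, Z (n + 1) (h + 1)
      = u (h + 1) * Z n (h + 2) + l (h + 1) * Z n (h + 1) + d (h + 1) * Z n h) (n : ℕ) :
    Z n 0 = PowerSeries.coeff n (CFrac.jFrac l fun h => u (h - 1) * d h) := by
  set β : ℕ → R := fun h => u (h - 1) * d h with hβ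
  -- `H h` is the generating function of paths from height `h` to `0`. Such a path stays at or above
  -- `h` (the factor `jTail l β h`) until its first step down to `h - 1`, and continues from there.
  let H : ℕ → PowerSeries R := fun h => Nat.rec (CFrac.jTail l β 0)
    (fun h F => PowerSeries.C (d (h + 1)) * PowerSeries.X * CFrac.jTail l β (h + 1) * F) h
  have hH : ∀ h, H (h + 1) = PowerSeries.C (d (h + 1)) * PowerSeries.X
    * CFrac.jTail l β (h + 1) * H h := fun h => rfl
  have r0 : H 0 = 1 + PowerSeries.X * (PowerSeries.C (u 0) * H 1 + PowerSeries.C (l 0) * H 0) := by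
    have := CFrac.jTail_spec l β 0
    rw [show H 1 = _ from hH 0]
    change CFrac.jTail l β 0 = 1 + _ * (_ * (_ * CFrac.jTail l β 0) + _ * CFrac.jTail l β 0)
    simp only [hβ, zero_add, Nat.sub_self, map_mul] at this ⊢
    linear_combination this
  have r : ∀ h, H (h + 1) = PowerSeries.X * (PowerSeries.C (u (h + 1)) * H (h + 2)
      + PowerSeries.C (l (h + 1)) * H (h + 1) + PowerSeries.C (d (h + 1)) * H h) := by
    intro h
    have := CFrac.jTail_spec l β (h + 1)
    rw [hH (h + 1), hH h]
    simp only [hβ, Nat.add_sub_cancel, map_mul] at this ⊢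
    linear_combination PowerSeries.C (d (h + 1)) * PowerSeries.X * H h * this
  have key : ∀ n h, Z n h = PowerSeries.coeff n (H h) := by
    intro n
    induction n with
    | zero =>
      rintro (_ | h)
      · rw [r0, h0]; simp
      · rw [r, h0]; simp
    | succ n ih =>
      rintro (_ | h)
      · rw [r0, hZ0, map_add, PowerSeries.coeff_succ_X_mul, map_add, PowerSeries.coeff_C_mul,
          PowerSeries.coeff_C_mul, ih, ih]
        simp
      · rw [r, hZ, PowerSeries.coeff_succ_X_mul, map_add, map_add, PowerSeries.coeff_C_mul,
          PowerSeries.coeff_C_mul, PowerSeries.coeff_C_mul, ih, ih, ih]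
  exact key n 0

theorem wordSum_eq_jFrac (wt : ℕ → Letter U L D → R) (hD : VD 0 = ∅) (n : ℕ) :
    wordSum VU VL VD wt n 0
      = PowerSeries.coeff n (CFrac.jFrac (fun h => ∑ k ∈ VL h, wt h (.inr (.inl k)))
          fun h => (∑ k ∈ VU (h - 1), wt (h - 1) (.inl k)) * ∑ k ∈ VD h, wt h (.inr (.inr k))) := by
  refine motzkin_eq_jFrac (fun h => ∑ k ∈ VU h, wt h (.inl k)) _
    (fun h => ∑ k ∈ VD h, wt h (.inr (.inr k))) (wordSum VU VL VD wt)
    (wordSum_zero VU VL VD wt) (fun n => ?_) (fun n h => ?_) n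
  · rw [wordSum_succ, hD]; simp
  · exact wordSum_succ VU VL VD wt n (h + 1)

/-- The induction removes the first letter and shifts the height function, hence the arbitrary
initial height `H 0`. -/
theorem ofFn_mem_words {n : ℕ} (c : Fin n → Letter U L D) (H : ℕ → ℕ) (hn : H n = 0)
    (hc : ∀ i : Fin n, c i ∈ allowed VU VL VD (H i))
    (hH : ∀ i : Fin n, H (i + 1) = nextHeight (H i) (c i)) :
    List.ofFn c ∈ words VU VL VD n (H 0) := by
  classical
  induction n generalizing H with
  | zero => simp [words, hn]
  | succ n ih =>
    rw [List.ofFn_succ, words, Finset.mem_biUnion]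
    refine ⟨c 0, hc 0, Finset.mem_image_of_mem _ ?_⟩
    have := ih (fun i => c i.succ) (fun m => H (m + 1)) hn (fun i => hc i.succ)
      (fun i => hH i.succ)
    have h0 := hH 0
    simp only [Fin.val_zero, zero_add] at h0 this ⊢
    rwa [h0] at this

theorem weight_ofFn {n : ℕ} (wt : ℕ → Letter U L D → R) (c : Fin n → Letter U L D) (H : ℕ → ℕ)
    (hH : ∀ i : Fin n, H (i + 1) = nextHeight (H i) (c i)) :
    weight wt (H 0) (List.ofFn c) = ∏ i : Fin n, wt (H i) (c i) := by
  induction n generalizing H with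
  | zero => simp [weight]
  | succ n ih =>
    rw [List.ofFn_succ, weight, Fin.prod_univ_succ]
    have := ih (fun i => c i.succ) (fun m => H (m + 1)) (fun i => hH i.succ)
    have h0 := hH 0
    simp only [Fin.val_zero, zero_add] at h0 this
    rw [h0] at this
    rw [this]
    simp

/-- If the objects of size `n` are encoded injectively by allowed words, and there are at least as
many objects as words, then the weighted sum over the objects is a coefficient of a J-fraction. -/
theorem sum_eq_coeff_jFrac {S : Type*} [Fintype S] {n : ℕ} (c : S → Fin n → Letter U L D)
    (H : S → ℕ → ℕ) (h0 : ∀ s, H s 0 = 0) (hn : ∀ s, H s n = 0)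
    (hc : ∀ s (i : Fin n), c s i ∈ allowed VU VL VD (H s i))
    (hH : ∀ s (i : Fin n), H s (i + 1) = nextHeight (H s i) (c s i))
    (hinj : Function.Injective c) (hD : VD 0 = ∅)
    (hcard : PowerSeries.coeff n (CFrac.jFrac (fun h => (#(VL h) : ℤ))
      fun h => (#(VU (h - 1)) : ℤ) * #(VD h)) ≤ Fintype.card S)
    (wt : ℕ → Letter U L D → R) :
    ∑ s, ∏ i : Fin n, wt (H s i) (c s i)
      = PowerSeries.coeff n (CFrac.jFrac (fun h => ∑ k ∈ VL h, wt h (.inr (.inl k)))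
          fun h => (∑ k ∈ VU (h - 1), wt (h - 1) (.inl k)) * ∑ k ∈ VD h, wt h (.inr (.inr k))) := by
  classical
  have hmem : ∀ s, List.ofFn (c s) ∈ words VU VL VD n 0 := fun s => by
    have := ofFn_mem_words VU VL VD (c s) (H s) (hn s) (hc s) (hH s)
    rwa [h0] at this
  have hinj' : Function.Injective fun s => List.ofFn (c s) :=
    fun s t h => hinj (List.ofFn_injective h)
  have hw1 : ∀ h (l : List (Letter U L D)), weight (fun _ _ => (1 : ℤ)) h l = 1 := by
    intro h l
    induction l generalizing h with
    | nil => rfl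
    | cons k l ih => rw [weight, ih, mul_one]
  -- The words are counted by giving weight `1` to each letter. An injection into a set that is not
  -- larger is onto, so the code reaches every word.
  have hcw : (#(words VU VL VD n 0) : ℤ) ≤ Fintype.card S := by
    refine le_trans (le_of_eq ?_) hcard
    have := wordSum_eq_jFrac VU VL VD (fun _ _ => (1 : ℤ)) hD n
    simpa [wordSum, hw1] using this
  have himg : (univ : Finset S).image (fun s => List.ofFn (c s)) = words VU VL VD n 0 := by
    refine Finset.eq_of_subset_of_card_le (by simpa [Finset.subset_iff] using hmem) ?_
    rw [Finset.card_image_of_injective _ hinj', Finset.card_univ]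
    exact_mod_cast hcw
  rw [← wordSum_eq_jFrac VU VL VD wt hD, wordSum, ← himg, Finset.sum_image hinj'.injOn]
  refine Finset.sum_congr rfl fun s _ => ?_
  have := weight_ofFn wt (c s) (H s) (hH s)
  rw [h0] at this
  exact this.symm

/-- Euler's J-fraction for the factorials. -/
theorem coeff_jFrac_factorial (n : ℕ) :
    PowerSeries.coeff n (CFrac.jFrac (fun h => 2 * (h : ℤ) + 1) fun h => (h : ℤ) ^ 2)
      = (n.factorial : ℤ) := by
  -- With up weights `1`, the closed form `n! · n(n-1)⋯(n-h+1)` solves the path recurrence; at `h =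
  -- 0` it is `n!`.
  have := motzkin_eq_jFrac (fun _ => (1 : ℤ)) (fun h => 2 * (h : ℤ) + 1) (fun h => (h : ℤ) ^ 2)
    (fun n h => (n.factorial * n.descFactorial h : ℤ)) ?_ ?_ ?_ n
  · simpa using this.symm
  · rintro (_ | h) <;> simp
  · intro n
    simp [Nat.factorial_succ]
    ring
  · intro n h
    have e1 : ((n + 1).descFactorial (h + 1) : ℤ) = (n + 1) * n.descFactorial h := by
      rw [Nat.succ_descFactorial_succ]; push_cast; ring
    have e2 : (n.descFactorial (h + 1) : ℤ) = (n - h) * n.descFactorial h := by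
      rw [Nat.descFactorial_succ]
      rcases le_or_gt h n with hh | hh
      · push_cast [hh]; ring
      · simp [Nat.descFactorial_of_lt hh]
    have e3 : (n.descFactorial (h + 2) : ℤ) = (n - h - 1) * n.descFactorial (h + 1) := by
      rw [Nat.descFactorial_succ]
      rcases le_or_gt (h + 1) n with hh | hh
      · push_cast [hh]; ring
      · rw [Nat.descFactorial_of_lt hh]; simp
    simp only [e1, e3, e2, Nat.factorial_succ]
    push_cast
    ring

end MotzkinWord

/-! ### Permutations as labelled words: heights, and labels given by crossings -/

namespace PermStat
open Equiv CFrac MotzkinWord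

variable {n : ℕ} {α : Type*}

theorem inv_apply (σ : Perm α) (i : α) : σ⁻¹ (σ i) = i := σ.symm_apply_apply i

theorem apply_inv (σ : Perm α) (i : α) : σ (σ⁻¹ i) = i := σ.apply_symm_apply i

theorem card_filter_perm [Fintype α] (σ : Perm α) (p : α → Prop) [DecidablePred p] :
    #{v | p v} = #{l | p (σ l)} := by
  refine (Finset.card_equiv σ fun l => ?_).symm
  simp

/-- The number of arcs of the diagram of `σ` from positions `< m` to values `≥ m`. -/
def hgt (σ : Perm (Fin n)) (m : ℕ) : ℕ := #{j : Fin n | (j : ℕ) < m ∧ m ≤ (σ j : ℕ)}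

theorem hgt_zero (σ : Perm (Fin n)) : hgt σ 0 = 0 := by simp [hgt]

theorem hgt_self (σ : Perm (Fin n)) : hgt σ n = 0 := by
  simp only [hgt, Finset.card_eq_zero, Finset.filter_eq_empty_iff]
  intro j _ h
  exact absurd h.2 (by have := (σ j).2; omega)

/-- An arc over the gap before `i` either passes over `i` or ends at `i`. -/
theorem hgt_eq (σ : Perm (Fin n)) (i : Fin n) :
    hgt σ i = lev σ i + if σ⁻¹ i < i then 1 else 0 := by
  have : (#{j | j = σ⁻¹ i ∧ σ⁻¹ i < i}) = if σ⁻¹ i < i then 1 else 0 := by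
    split_ifs with h <;> simp [-Perm.coe_inv, h, Finset.filter_eq']
  rw [← this, hgt, lev, ← Finset.card_union_of_disjoint]
  · congr 1
    ext j
    simp only [Finset.mem_filter, Finset.mem_univ, true_and, Finset.mem_union, ← Fin.lt_def,
      ← Fin.le_def]
    rw [Perm.eq_inv_iff_eq]
    constructor
    · rintro ⟨h1, h2⟩
      rcases h2.lt_or_eq with h | h
      · exact Or.inl ⟨h1, h⟩
      · exact Or.inr ⟨h.symm, by rw [h, inv_apply, ← h]; exact h1⟩
    · rintro (⟨h1, h2⟩ | ⟨rfl, h⟩)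
      · exact ⟨h1, h2.le⟩
      · exact ⟨by rwa [inv_apply] at h, le_rfl⟩
  · rw [Finset.disjoint_left]
    intro j hj hj'
    simp only [Finset.mem_filter, Finset.mem_univ, true_and, Perm.eq_inv_iff_eq] at hj hj'
    exact absurd hj.2 (by rw [hj'.1]; exact lt_irrefl _)

theorem hgt_succ (σ : Perm (Fin n)) (i : Fin n) :
    hgt σ (i + 1) = lev σ i + if i < σ i then 1 else 0 := by
  have : (#{j | j = i ∧ i < σ i}) = if i < σ i then 1 else 0 := by
    split_ifs with h <;> simp [-Perm.coe_inv, h, Finset.filter_eq']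
  rw [← this, hgt, lev, ← Finset.card_union_of_disjoint]
  · congr 1
    ext j
    simp only [Finset.mem_filter, Finset.mem_univ, true_and, Finset.mem_union,
      Nat.lt_succ_iff, Nat.succ_le_iff, ← Fin.lt_def, ← Fin.le_def]
    constructor
    · rintro ⟨h1, h2⟩
      rcases h1.lt_or_eq with h | rfl
      · exact Or.inl ⟨h, h2⟩
      · exact Or.inr ⟨rfl, h2⟩
    · rintro (⟨h1, h2⟩ | ⟨rfl, h⟩)
      · exact ⟨h1.le, h2⟩
      · exact ⟨le_rfl, h⟩
  · rw [Finset.disjoint_left]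
    intro j hj hj'
    simp only [Finset.mem_filter, Finset.mem_univ, true_and] at hj hj'
    exact absurd hj.1 (by rw [hj'.1]; exact lt_irrefl _)

/-- As many arcs cross a gap upwards as downwards: both numbers are the size of the initial segment
minus the number of arcs inside it. -/
theorem hgt_inv (σ : Perm (Fin n)) (m : ℕ) : hgt σ⁻¹ m = hgt σ m := by
  have h1 := Finset.card_filter_add_card_filter_not (s := ({j : Fin n | (j : ℕ) < m} : Finset _))
    (fun j => (σ j : ℕ) < m)
  have h2 := Finset.card_filter_add_card_filter_not (s := ({j : Fin n | (j : ℕ) < m} : Finset _))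
    (fun j => (σ⁻¹ j : ℕ) < m)
  rw [Finset.filter_filter, Finset.filter_filter] at h1 h2
  have h3 := card_filter_perm σ fun v => (v : ℕ) < m ∧ (σ⁻¹ v : ℕ) < m
  simp only [inv_apply] at h3
  have h4 : #{l : Fin n | (σ l : ℕ) < m ∧ (l : ℕ) < m} = #{l : Fin n | (l : ℕ) < m ∧ (σ l : ℕ) < m} :=
    by simp only [and_comm]
  simp only [not_lt] at h1 h2
  simp only [hgt]
  omega

/-- The height read off from the lower arcs, whose crossing and nesting numbers add up to `lev σ⁻¹`.
-/
theorem hgt_eq' (σ : Perm (Fin n)) (i : Fin n) :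
    hgt σ i = lev σ⁻¹ i + if σ i < i then 1 else 0 := by
  rw [← hgt_inv, hgt_eq, inv_inv]

/-- An arc that passes over `i` ends before or after `σ i`. Given the height, the crossing number
therefore determines the nesting number, and one label is enough. -/
theorem ucross_add_unest (σ : Perm (Fin n)) {i : Fin n} (h : i < σ i) :
    ucross σ i + unest σ i = lev σ i := by
  rw [ucross, unest, lev, ← Finset.card_union_of_disjoint]
  · congr 1
    ext j
    simp only [Finset.mem_filter, Finset.mem_univ, true_and, Finset.mem_union, h]
    constructor
    · rintro (⟨h1, h2, -⟩ | ⟨h1, h2⟩)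
      · exact ⟨h1, h2⟩
      · exact ⟨h1, h.trans h2⟩
    · rintro ⟨h1, h2⟩
      rcases lt_trichotomy (σ j) (σ i) with h3 | h3 | h3
      · exact Or.inl ⟨h1, h2, h3⟩
      · exact absurd (σ.injective h3) h1.ne
      · exact Or.inr ⟨h1, h3⟩
  · rw [Finset.disjoint_left]
    intro j hj hj'
    simp only [Finset.mem_filter, Finset.mem_univ, true_and] at hj hj'
    exact absurd hj.2.2 hj'.2.2.not_gt

theorem lcross_add_lnest (σ : Perm (Fin n)) {k : Fin n} (h : σ k < k) :
    lcross σ k + lnest σ k = lev σ⁻¹ k := by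
  rw [lcross, lnest, lev, card_filter_perm σ (fun v => v < k ∧ k < σ⁻¹ v),
    ← Finset.card_union_of_disjoint]
  · congr 1
    ext j
    simp only [Finset.mem_filter, Finset.mem_univ, true_and, Finset.mem_union, h,
      inv_apply]
    constructor
    · rintro (⟨h1, h2, h3⟩ | ⟨h1, h2⟩)
      · exact ⟨h2, h3⟩
      · exact ⟨h1.trans h, h2⟩
    · rintro ⟨h1, h2⟩
      rcases lt_trichotomy (σ j) (σ k) with h3 | h3 | h3
      · exact Or.inr ⟨h3, h2⟩
      · exact absurd (σ.injective h3) h2.ne'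
      · exact Or.inl ⟨h3, h1, h2⟩
  · rw [Finset.disjoint_left]
    intro j hj hj'
    simp only [Finset.mem_filter, Finset.mem_univ, true_and] at hj hj'
    exact absurd hj.1 hj'.1.not_gt

/-- Indexed by values instead of positions, the crossing number appears as a rank among the values
that are still free at `k`; this is the form used in `lower_unique`. -/
theorem lcross_eq (σ : Perm (Fin n)) (k : Fin n) :
    lcross σ k = #{v | σ k < v ∧ v < k ∧ k < σ⁻¹ v} := by
  rw [lcross, card_filter_perm σ (fun v => σ k < v ∧ v < k ∧ k < σ⁻¹ v)]
  simp only [inv_apply]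

theorem ucross_eq (σ : Perm (Fin n)) (k : Fin n) :
    ucross σ k = #{v | v < σ k ∧ k < v ∧ σ⁻¹ v < k} := by
  rw [ucross, card_filter_perm σ (fun v => v < σ k ∧ k < v ∧ σ⁻¹ v < k)]
  simp only [inv_apply]
  congr 1
  ext
  simp only [Finset.mem_filter, Finset.mem_univ, true_and]
  tauto

/-- The values below `k` that are not taken before position `k` by a lower arc agree for both
permutations. Each side counts the free values above the chosen one, so a larger choice gives a
smaller count; the value `τ k` is counted for `σ` only. -/
theorem card_lower_lt [LinearOrder α] [Fintype α] {σ τ : Perm α}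
    (h2 : ∀ i, i < σ⁻¹ i ↔ i < τ⁻¹ i) {k : α} (ih : ∀ m < k, σ m < m → τ m = σ m)
    (hτ : τ k < k) (hlt : σ k < τ k) :
    #{v | τ k < v ∧ v < k ∧ k < τ⁻¹ v} < #{v | σ k < v ∧ v < k ∧ k < σ⁻¹ v} := by
  -- If `σ` took the value `v` before position `k`, it would do so by a lower arc, which `ih` would
  -- make an arc of `τ` too.
  have key : ∀ v, v < k → k ≤ τ⁻¹ v → σ k ≠ v → k < σ⁻¹ v := by
    intro v hv hτv hne
    have hv' : v < σ⁻¹ v := (h2 v).mpr (hv.trans_le hτv)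
    rcases lt_trichotomy (σ⁻¹ v) k with h | h | h
    · have := ih _ h (by rwa [apply_inv])
      rw [apply_inv, ← Perm.eq_inv_iff_eq] at this
      exact absurd h (by rw [this]; exact hτv.not_gt)
    · exact absurd (by rw [← h, apply_inv]) hne
    · exact h
  apply Finset.card_lt_card
  rw [Finset.ssubset_iff_of_subset]
  · refine ⟨τ k, ?_, by simp⟩
    simp only [Finset.mem_filter, Finset.mem_univ, true_and]
    exact ⟨hlt, hτ, key _ hτ (inv_apply τ k).ge hlt.ne⟩
  · intro v
    simp only [Finset.mem_filter, Finset.mem_univ, true_and]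
    rintro ⟨h3, h4, h5⟩
    exact ⟨hlt.trans h3, h4, key v h4 h5.le (hlt.trans h3).ne⟩

/-- The lower arcs of a permutation are determined by their end points and the lower crossing
numbers. -/
theorem lower_unique [LinearOrder α] [Fintype α] {σ τ : Perm α}
    (h1 : ∀ i, σ i < i ↔ τ i < i) (h2 : ∀ i, i < σ⁻¹ i ↔ i < τ⁻¹ i)
    (h3 : ∀ k, σ k < k →
      #{v | σ k < v ∧ v < k ∧ k < σ⁻¹ v} = #{v | τ k < v ∧ v < k ∧ k < τ⁻¹ v}) (k : α) :
    σ k < k → τ k = σ k := by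
  induction k using WellFoundedLT.induction with
  | _ k ih =>
  intro hk
  have hτ := (h1 k).mp hk
  rcases lt_trichotomy (σ k) (τ k) with h | h | h
  · exact absurd (card_lower_lt h2 ih hτ h) (by rw [h3 k hk]; exact lt_irrefl _)
  · exact h.symm
  · refine absurd (card_lower_lt (fun i => (h2 i).symm) ?_ hk h)
      (by rw [h3 k hk]; exact lt_irrefl _)
    exact fun m hm hm' => (ih m hm ((h1 m).mpr hm')).symm

/-- Reversing the order turns upper arcs into lower ones. -/
theorem upper_unique [LinearOrder α] [Fintype α] {σ τ : Perm α}
    (h1 : ∀ i, i < σ i ↔ i < τ i) (h2 : ∀ i, σ⁻¹ i < i ↔ τ⁻¹ i < i)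
    (h3 : ∀ k, k < σ k →
      #{v | v < σ k ∧ k < v ∧ σ⁻¹ v < k} = #{v | v < τ k ∧ k < v ∧ τ⁻¹ v < k}) (k : α) :
    k < σ k → τ k = σ k :=
  lower_unique (α := αᵒᵈ) (σ := σ) (τ := τ) h1 h2 h3 k

/-- The number `i` is the largest element of its cycle. -/
def IsCycMax (σ : Perm (Fin n)) (i : Fin n) : Prop := ∀ m : ℕ, (σ ^ m) i ≤ i

variable {R : Type*} [CommRing R]

open Classical in
/-- The contribution of `i` to the general weight. -/
noncomputable def locWeight (a b c : ℕ → ℕ → R) (d : ℕ → ℕ → ℕ → R) (e : ℕ → R) (lam mu : R)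
    (σ : Perm (Fin n)) (i : Fin n) : R :=
  if i < σ i then
    if σ⁻¹ i < i then d (ucross σ i) (unest σ i) (unest σ (σ⁻¹ i))
    else a (ucross σ i) (unest σ i)
  else if σ i < i then
    if i < σ⁻¹ i then c (lcross σ i) (lnest σ i)
    else b (lcross σ i) (lnest σ i) * if IsCycMax σ i then lam else mu
  else lam * e (lev σ i)

/-- A weight on permutations that generalizes those of the two master polynomials. -/
noncomputable def genWeight (a b c : ℕ → ℕ → R) (d : ℕ → ℕ → ℕ → R) (e : ℕ → R) (lam mu : R)
    (n : ℕ) (σ : Perm (Fin n)) : R :=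
  ∏ i, locWeight a b c d e lam mu σ i

theorem lt_inv_or_of_ne (σ : Perm (Fin n)) {i : Fin n} (h : σ i ≠ i) :
    σ⁻¹ i < i ∨ i < σ⁻¹ i := by
  rcases lt_trichotomy (σ⁻¹ i) i with h1 | h1 | h1
  · exact Or.inl h1
  · rw [Perm.inv_eq_iff_eq] at h1
    exact absurd h1.symm h
  · exact Or.inr h1

/-- The letters of the word in which openers and lower closers carry labels. -/
def crossCode (σ : Perm (Fin n)) (i : Fin n) : Letter ℕ (Option (ℕ ⊕ ℕ)) ℕ :=
  if i < σ i then
    if σ⁻¹ i < i then .inr (.inl (some (.inr (ucross σ i)))) else .inl (ucross σ i)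
  else if σ i < i then
    if i < σ⁻¹ i then .inr (.inl (some (.inl (lcross σ i)))) else .inr (.inr (lcross σ i))
  else .inr (.inl none)

/-- The letters show at which points upper and lower arcs begin and end; the crossing numbers then
determine how these points are joined. -/
theorem crossCode_injective : Function.Injective (crossCode (n := n)) := by
  intro σ τ h
  have key : ∀ i, (i < σ i ↔ i < τ i) ∧ (σ i < i ↔ τ i < i) ∧ (σ⁻¹ i < i ↔ τ⁻¹ i < i)
      ∧ (i < σ⁻¹ i ↔ i < τ⁻¹ i) ∧ (i < σ i → ucross σ i = ucross τ i)
      ∧ (σ i < i → lcross σ i = lcross τ i) := by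
    intro i
    have hi := congrFun h i
    have e1 := lt_inv_or_of_ne σ (i := i)
    have e2 := lt_inv_or_of_ne τ (i := i)
    have f1 : ∀ ρ : Perm (Fin n), ρ⁻¹ i = i ↔ ρ i = i := fun ρ => by
      rw [Perm.inv_eq_iff_eq, eq_comm]
    have f2 := f1 σ
    have f3 := f1 τ
    simp only [crossCode] at hi
    split_ifs at hi <;> simp_all <;> grind
  have hup := upper_unique (fun i => (key i).1) (fun i => (key i).2.2.1) fun k hk => by
    rw [← ucross_eq, ← ucross_eq]
    exact (key k).2.2.2.2.1 hk
  have hlo := lower_unique (fun i => (key i).2.1) (fun i => (key i).2.2.2.1) fun k hk => by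
    rw [← lcross_eq, ← lcross_eq]
    exact (key k).2.2.2.2.2 hk
  ext1 k
  rcases lt_trichotomy (σ k) k with hk | hk | hk
  · exact (hlo k hk).symm
  · have h1 := (key k).1
    have h2 := (key k).2.1
    have : τ k = k := le_antisymm (not_lt.mp fun h => by simp [hk, h] at h1)
      (not_lt.mp fun h => by simp [hk, h] at h2)
    rw [hk, this]
  · exact (hup k hk).symm

theorem jFrac_congr {γ γ' β β' : ℕ → R} (hγ : ∀ n, γ n = γ' n)
    (hβ : ∀ n, β (n + 1) = β' (n + 1)) : jFrac γ β = jFrac γ' β' :=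
  jTail_congr (fun n _ => hγ n) fun n hn => by
    obtain ⟨m, rfl⟩ := Nat.exists_eq_succ_of_ne_zero hn.ne'
    exact hβ m

theorem inv_eq_self_iff (σ : Perm (Fin n)) (i : Fin n) : σ⁻¹ i = i ↔ σ i = i := by
  rw [Perm.inv_eq_iff_eq, eq_comm]

/-- At height `h` the letters are: up with labels `0, …, h` (valleys), down with labels `0, …, h -
1` (peaks), and level letters for the double falls and the double rises, each with labels `0, …, h -
1`, together with one for fixed points. -/
theorem gfCC_genWeight_of_cross (a b c d : ℕ → ℕ → R) (e : ℕ → R) :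
    gfCC cc (genWeight a b c (fun j k _ => d j k) e 1 1) 1
      = jFrac (fun n => starSum c n + starSum d n + e n) (fun n => starSum a n * starSum b n) := by
  ext n
  rw [gfCC, PowerSeries.coeff_mk]
  have := sum_eq_coeff_jFrac (fun h => range (h + 1))
    (fun h => insertNone ((range h).disjSum (range h))) range (crossCode (n := n)) hgt hgt_zero
    hgt_self ?_ ?_ crossCode_injective (by simp) ?_
    -- The label is a crossing number. The nesting number is the rest of the height at a valley, and
    -- the rest of the height minus one at a peak, double fall or double rise, because there an arc
    -- ends in `i` from the left or goes out of `i` to the left.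
    (fun h k => match k with
      | .inl l => a l (h - l)
      | .inr (.inl none) => e h
      | .inr (.inl (some (.inl l))) => c l (h - 1 - l)
      | .inr (.inl (some (.inr l))) => d l (h - 1 - l)
      | .inr (.inr l) => b l (h - 1 - l))
  · simp only [one_pow, one_mul]
    refine Eq.trans ?_ (this.trans (congrArg _ (jFrac_congr (fun n => ?_) fun n => ?_)))
    · refine Finset.sum_congr rfl fun σ _ => Finset.prod_congr rfl fun i _ => ?_
      have h1 := hgt_eq σ i
      have h2 := hgt_eq' σ i
      have h3 := ucross_add_unest σ (i := i)
      have h4 := lcross_add_lnest σ (k := i)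
      simp only [locWeight, crossCode, ite_self, mul_one, one_mul]
      split_ifs with c1 c2 c2 c3
      · have := h3 c1
        simp only [c2, if_true] at h1
        simp only [h1]
        congr 1; omega
      · have := h3 c1
        simp only [c2, if_false] at h1
        simp only [h1]
        congr 1; omega
      · have := h4 c2
        simp only [c2, if_true] at h2
        simp only [h2]
        congr 1; omega
      · have := h4 c2
        simp only [c2, if_true] at h2
        simp only [h2]
        congr 1; omega
      · have h5 : σ i = i := le_antisymm (not_lt.mp c1) (not_lt.mp c2)
        have h6 := (inv_eq_self_iff σ i).mpr h5
        simp only [h6, lt_irrefl, if_false] at h1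
        simp only [h1]
        rfl
    · simp only [Finset.sum_insertNone, Finset.sum_disjSum, starSum]
      ring
    · simp [starSum]
  · intro σ i
    have h1 := hgt_eq σ i
    have h2 := hgt_eq' σ i
    have h3 := ucross_add_unest σ (i := i)
    have h4 := lcross_add_lnest σ (k := i)
    simp only [allowed, crossCode]
    split_ifs with c1 c2 c2 c3
    · have := h3 c1
      simp only [c2, if_true] at h1
      simp
      omega
    · have := h3 c1
      simp only [c2, if_false] at h1
      simp
      omega
    · have := h4 c2
      simp only [c2, if_true] at h2
      simp
      omega
    · have := h4 c2
      simp only [c2, if_true] at h2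
      simp
      omega
    · simp
  · intro σ i
    have h1 := hgt_eq σ i
    have h2 := hgt_succ σ i
    have h3 := lt_inv_or_of_ne σ (i := i)
    have h4 := inv_eq_self_iff σ i
    simp only [crossCode]
    split_ifs with c1 c2 c2 c3 <;> simp only [nextHeight] <;> grind
  -- There are `2h + 1` level letters at height `h`, and `h` up letters at `h - 1` meet `h` down
  -- letters at `h`: the coefficients of Euler's fraction.
  · rw [Fintype.card_perm, Fintype.card_fin, ← coeff_jFrac_factorial]
    refine le_of_eq (congrArg _ (jFrac_congr (fun n => ?_) fun n => ?_))
    · simp; ring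
    · simp; ring

end PermStat

/-! ### Permutations as labelled words: labels that detect the closing of cycles -/

namespace PermStat
open Equiv CFrac MotzkinWord

variable {n : ℕ}

/-- The positions `j < k` of the arcs that pass over or end at `k`. -/
def loose (σ : Perm (Fin n)) (k : Fin n) : Finset (Fin n) := {j | j < k ∧ k ≤ σ j}

theorem card_loose (σ : Perm (Fin n)) (k : Fin n) : #(loose σ k) = hgt σ k := rfl

theorem mem_loose {σ : Perm (Fin n)} {k j : Fin n} : j ∈ loose σ k ↔ j < k ∧ k ≤ σ j := by
  simp [loose]

/-- The step relation of the path `k, σ k, σ² k, …` as long as it stays below `k`. -/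
def Reach (σ : Perm (Fin n)) (k : Fin n) : Fin n → Fin n → Prop :=
  Relation.ReflTransGen fun x y => σ x = y ∧ y < k

/-- `j` is the last element below `k` on the path `k, σ k, σ² k, …`, before it leaves the elements
below `k` for the first time. -/
def IsEnd (σ : Perm (Fin n)) (k j : Fin n) : Prop := j ∈ loose σ k ∧ Reach σ k k j

theorem Reach.exists_pow {σ : Perm (Fin n)} {k j : Fin n} (h : Reach σ k k j) :
    ∃ m : ℕ, j = (σ ^ m) k := by
  induction h with
  | refl => exact ⟨0, rfl⟩
  | tail _ h ih =>
    obtain ⟨m, rfl⟩ := ih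
    exact ⟨m + 1, by rw [pow_succ', Perm.mul_apply, h.1]⟩

/-- The path is deterministic, and it stops at a loose position, whose image is not below `k`. -/
theorem isEnd_unique {σ : Perm (Fin n)} {k i j : Fin n} (hi : IsEnd σ k i) (hj : IsEnd σ k j) :
    i = j := by
  have hU : Relator.RightUnique fun x y => σ x = y ∧ y < k :=
    fun x y z hy hz => hy.1.symm.trans hz.1
  have aux : ∀ x y, x ∈ loose σ k → Reach σ k x y → x = y := by
    intro x y hx h
    rcases Relation.ReflTransGen.cases_head h with rfl | ⟨z, hz, -⟩
    · rfl
    · exact absurd (mem_loose.mp hx).2 (by rw [hz.1]; exact not_le.mpr hz.2)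
  rcases Relation.ReflTransGen.total_of_right_unique hU hi.2 hj.2 with h | h
  · exact aux _ _ hi.1 h
  · exact (aux _ _ hj.1 h).symm

theorem exists_isEnd {σ : Perm (Fin n)} {k : Fin n} (hk : σ k < k) : ∃ j, IsEnd σ k j := by
  -- The path returns to `k` after `orderOf σ` steps, so there is a first step to an element that is
  -- not below `k`.
  have hex : ∃ m : ℕ, k ≤ (σ ^ (m + 1)) k := by
    refine ⟨orderOf σ - 1, ?_⟩
    rw [Nat.sub_add_cancel (orderOf_pos σ), pow_orderOf_eq_one]
    exact le_rfl
  classical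
  obtain ⟨m, hm, hlt⟩ : ∃ m : ℕ, k ≤ (σ ^ (m + 1)) k ∧ ∀ i < m, (σ ^ (i + 1)) k < k :=
    ⟨Nat.find hex, Nat.find_spec hex, fun i hi => not_le.mp (Nat.find_min hex hi)⟩
  have hreach : ∀ i ≤ m, Reach σ k k ((σ ^ i) k) := by
    intro i
    induction i with
    | zero => exact fun _ => Relation.ReflTransGen.refl
    | succ i ih =>
      intro hi
      refine Relation.ReflTransGen.tail (ih (by omega)) ⟨?_, hlt i hi⟩
      rw [pow_succ', Perm.mul_apply]
  refine ⟨(σ ^ m) k, mem_loose.mpr ⟨?_, by rwa [pow_succ', Perm.mul_apply] at hm⟩, hreach m le_rfl⟩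
  rcases m with _ | m
  · exact absurd hm (by simpa using hk)
  · exact hlt m (by omega)

/-- If `k` is the maximum of its cycle, the path stays below `k` until it returns to `k`, so its end
is the preimage of `k`. Conversely, a path whose end is sent to `k` runs through the whole cycle
without exceeding `k`. -/
theorem isCycMax_iff {σ : Perm (Fin n)} {k : Fin n} (hk : σ k < k) :
    IsCycMax σ k ↔ IsEnd σ k (σ⁻¹ k) := by
  constructor
  · intro h
    obtain ⟨j, hj⟩ := exists_isEnd hk
    obtain ⟨m, hm⟩ := hj.2.exists_pow
    have h1 := h (m + 1)
    rw [pow_succ', Perm.mul_apply, ← hm] at h1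
    have h2 := le_antisymm h1 (mem_loose.mp hj.1).2
    rwa [show σ⁻¹ k = j by rw [← h2, inv_apply]]
  · intro h m
    have : (σ ^ m) k ≤ k ∧ Reach σ k k ((σ ^ m) k) := by
      induction m with
      | zero => exact ⟨le_rfl, Relation.ReflTransGen.refl⟩
      | succ m ih =>
        rw [pow_succ', Perm.mul_apply]
        set x := (σ ^ m) k
        rcases lt_or_ge (σ x) k with hx | hx
        · exact ⟨hx.le, ih.2.tail ⟨rfl, hx⟩⟩
        · have hxk : x ≠ k := fun e => absurd hk (by rw [e] at hx; exact hx.not_gt)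
          have := isEnd_unique ⟨mem_loose.mpr ⟨lt_of_le_of_ne ih.1 hxk, hx⟩, ih.2⟩ h
          rw [this, apply_inv]
          exact ⟨le_rfl, Relation.ReflTransGen.refl⟩
    exact this.1

/-- The path uses only the arc out of `k` and the arcs between elements below `k`, all of which are
known when the preimage of `k` is reconstructed. -/
theorem Reach.mono {σ τ : Perm (Fin n)} {k j : Fin n} (hk : τ k = σ k)
    (h : ∀ x < k, σ x < k → τ x = σ x) (hj : Reach σ k k j) : Reach τ k k j := by
  have : Reach τ k k j ∧ j ≤ k := by
    induction hj with
    | refl => exact ⟨Relation.ReflTransGen.refl, le_rfl⟩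
    | @tail x y _ hxy ih =>
      refine ⟨ih.1.tail ⟨?_, hxy.2⟩, hxy.2.le⟩
      rcases ih.2.lt_or_eq with hx | rfl
      · rw [h x hx (by rw [hxy.1]; exact hxy.2), hxy.1]
      · rw [hk, hxy.1]
  exact this.1

theorem eq_of_card_filter_lt_eq {α : Type*} [LinearOrder α] {s : Finset α} {p q : α} (hp : p ∈ s)
    (hq : q ∈ s) (h : #{l ∈ s | l < p} = #{l ∈ s | l < q}) : p = q := by
  have aux : ∀ x y, x ∈ s → x < y → #{l ∈ s | l < x} < #{l ∈ s | l < y} := by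
    intro x y hx hxy
    apply Finset.card_lt_card
    rw [Finset.ssubset_iff_of_subset]
    · exact ⟨x, by simp [hx, hxy], by simp⟩
    · intro l
      simp only [Finset.mem_filter]
      exact fun hl => ⟨hl.1, hl.2.trans hxy⟩
  rcases lt_trichotomy p q with hlt | hlt | hlt
  · exact absurd h (aux p q hp hlt).ne
  · exact hlt
  · exact absurd h (aux q p hq hlt).ne'

open Classical in
/-- A label of the cycle peak `k`: zero if `k` closes a cycle; otherwise it is determined by the
rank of `σ⁻¹ k` among the loose positions that would not close a cycle. -/
noncomputable def closeLabel (σ : Perm (Fin n)) (k : Fin n) : ℕ :=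
  if IsCycMax σ k then 0 else 1 + #{j ∈ (loose σ k).filter fun j => ¬ IsEnd σ k j | j < σ⁻¹ k}

theorem inv_mem_loose {σ : Perm (Fin n)} {k : Fin n} (h : σ⁻¹ k < k) : σ⁻¹ k ∈ loose σ k :=
  mem_loose.mpr ⟨h, (apply_inv σ k).ge⟩

/-- One of the loose positions is the end of the chain and closes a cycle; label `0` is reserved for
it, and the ranks among the others are shifted by one. -/
theorem closeLabel_lt {σ : Perm (Fin n)} {k : Fin n} (h1 : σ⁻¹ k < k) (h2 : σ k < k) :
    closeLabel σ k < hgt σ k := by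
  classical
  rw [closeLabel]
  split_ifs with hc
  · rw [hgt_eq, if_pos h1]; omega
  · obtain ⟨j, hj⟩ := exists_isEnd h2
    rw [isCycMax_iff h2] at hc
    rw [← card_loose]
    set T := (loose σ k).filter fun j => ¬ IsEnd σ k j
    have hj' : j ∉ T := fun h => (Finset.mem_filter.mp h).2 hj
    have hp : σ⁻¹ k ∈ T := Finset.mem_filter.mpr ⟨inv_mem_loose h1, hc⟩
    have c1 : #{j ∈ T | j < σ⁻¹ k} < #T := by
      apply Finset.card_lt_card
      rw [Finset.ssubset_iff_of_subset (Finset.filter_subset _ _)]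
      exact ⟨_, hp, by simp⟩
    have c2 : #T < #(loose σ k) := by
      apply Finset.card_lt_card
      rw [Finset.ssubset_iff_of_subset (Finset.filter_subset _ _)]
      exact ⟨j, hj.1, hj'⟩
    omega

/-- The upper arcs around the arc into `k` are the loose ones that begin before it, so this nesting
number is the rank of `σ⁻¹ k` among the loose positions. -/
theorem unest_inv_eq {σ : Perm (Fin n)} {k : Fin n} (h : σ⁻¹ k < k) :
    unest σ (σ⁻¹ k) = #{j ∈ loose σ k | j < σ⁻¹ k} := by
  rw [unest, apply_inv]
  congr 1
  ext l
  simp only [Finset.mem_filter, Finset.mem_univ, true_and, mem_loose]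
  constructor
  · rintro ⟨h1, -, h3⟩
    exact ⟨⟨h1.trans h, h3.le⟩, h1⟩
  · rintro ⟨⟨-, h2⟩, h3⟩
    refine ⟨h3, h, lt_of_le_of_ne h2 fun e => ?_⟩
    rw [e, inv_apply] at h3
    exact lt_irrefl _ h3

theorem unest_inv_lt {σ : Perm (Fin n)} {k : Fin n} (h : σ⁻¹ k < k) :
    unest σ (σ⁻¹ k) < hgt σ k := by
  rw [unest_inv_eq h, ← card_loose]
  apply Finset.card_lt_card
  rw [Finset.ssubset_iff_of_subset (Finset.filter_subset _ _)]
  exact ⟨_, inv_mem_loose h, by simp⟩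

/-- The letters of the word in which upper closers and lower closers carry labels. -/
noncomputable def chainCode (σ : Perm (Fin n)) (i : Fin n) :
    Letter Unit (Option (ℕ ⊕ ℕ)) (ℕ × ℕ) :=
  if i < σ i then
    if σ⁻¹ i < i then .inr (.inl (some (.inr (unest σ (σ⁻¹ i))))) else .inl ()
  else if σ i < i then
    if i < σ⁻¹ i then .inr (.inl (some (.inl (lcross σ i))))
    else .inr (.inr (lcross σ i, closeLabel σ i))
  else .inr (.inl none)

/-- The lower arcs are determined as for `crossCode`. The upper arcs are then found by induction on
their right ends `k`: the arcs below `k` determine the loose positions and, at a peak, the one that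
closes a cycle; the label selects one of them. -/
theorem chainCode_injective : Function.Injective (chainCode (n := n)) := by
  classical
  intro σ τ h
  have key : ∀ i, (i < σ i ↔ i < τ i) ∧ (σ i < i ↔ τ i < i) ∧ (σ⁻¹ i < i ↔ τ⁻¹ i < i)
      ∧ (i < σ⁻¹ i ↔ i < τ⁻¹ i)
      ∧ (i < σ i → σ⁻¹ i < i → unest σ (σ⁻¹ i) = unest τ (τ⁻¹ i))
      ∧ (σ i < i → lcross σ i = lcross τ i)
      ∧ (σ i < i → σ⁻¹ i < i → closeLabel σ i = closeLabel τ i) := by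
    intro i
    have hi := congrFun h i
    have e1 := lt_inv_or_of_ne σ (i := i)
    have e2 := lt_inv_or_of_ne τ (i := i)
    have f2 := inv_eq_self_iff σ i
    have f3 := inv_eq_self_iff τ i
    simp only [chainCode] at hi
    split_ifs at hi <;> simp_all <;> grind
  have hlo := lower_unique (fun i => (key i).2.1) (fun i => (key i).2.2.2.1) fun k hk => by
    rw [← lcross_eq, ← lcross_eq]
    exact (key k).2.2.2.2.2.1 hk
  have hfix : ∀ k, σ k = k → τ k = k := by
    intro k hk
    have h1 := (key k).1
    have h2 := (key k).2.1
    exact le_antisymm (not_lt.mp fun h => by simp [hk, h] at h1)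
      (not_lt.mp fun h => by simp [hk, h] at h2)
  have hup : ∀ k, σ⁻¹ k < k → τ⁻¹ k = σ⁻¹ k := by
    intro k
    induction k using WellFoundedLT.induction with
    | _ k ih =>
    intro hk
    have hk' := (key k).2.2.1.mp hk
    -- Arcs with both ends below `k` are known already: lower arcs from `hlo`, upper arcs from `ih`
    -- at their right ends.
    have agree : ∀ x < k, σ x < k → τ x = σ x := by
      intro x _ hx
      rcases lt_trichotomy (σ x) x with h1 | h1 | h1
      · exact hlo x h1
      · rw [h1, hfix x h1]
      · have := ih _ hx (by rwa [inv_apply])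
        rw [inv_apply, Perm.inv_eq_iff_eq] at this
        exact this.symm
    have agree' : ∀ x < k, τ x < k → σ x = τ x := by
      intro x _ hx
      rcases lt_trichotomy (σ x) x with h1 | h1 | h1
      · exact (hlo x h1).symm
      · rw [h1, hfix x h1]
      · have h2 := (key x).1.mp h1
        have := ih _ hx ((key _).2.2.1.mpr (by rwa [inv_apply]))
        rw [inv_apply, Perm.eq_inv_iff_eq] at this
        exact this
    have hloose : loose σ k = loose τ k := by
      ext x
      rw [mem_loose, mem_loose]
      refine and_congr_right fun hx => ?_
      rw [← not_lt, ← not_lt, not_iff_not]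
      exact ⟨fun h1 => by rwa [agree x hx h1], fun h1 => by rwa [agree' x hx h1]⟩
    have hp := inv_mem_loose hk
    have hq := inv_mem_loose hk'
    rcases lt_trichotomy (σ k) k with h1 | h1 | h1
    · have hks := hlo k h1
      have h1' := (key k).2.1.mp h1
      have hend : ∀ j, IsEnd σ k j ↔ IsEnd τ k j := fun j => by
        rw [IsEnd, IsEnd, hloose]
        exact and_congr_right fun _ =>
          ⟨Reach.mono hks agree, Reach.mono hks.symm agree'⟩
      have hlab := (key k).2.2.2.2.2.2 h1 hk
      rw [closeLabel, closeLabel] at hlab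
      split_ifs at hlab with m1 m2 m2
      · rw [isCycMax_iff h1] at m1
        rw [isCycMax_iff h1', ← hend] at m2
        exact isEnd_unique m2 m1
      · omega
      · omega
      · rw [isCycMax_iff h1] at m1
        rw [isCycMax_iff h1'] at m2
        simp only [hend, hloose] at hlab m1 hp
        refine (eq_of_card_filter_lt_eq ?_ ?_ (Nat.add_left_cancel hlab)).symm
        · exact Finset.mem_filter.mpr ⟨hp, m1⟩
        · exact Finset.mem_filter.mpr ⟨hq, m2⟩
    · exact absurd hk (by rw [(inv_eq_self_iff σ k).mpr h1]; exact lt_irrefl _)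
    · have hlab := (key k).2.2.2.2.1 h1 hk
      rw [unest_inv_eq hk, unest_inv_eq hk', hloose] at hlab
      rw [hloose] at hp
      exact (eq_of_card_filter_lt_eq hp hq hlab).symm
  ext1 k
  rcases lt_trichotomy (σ k) k with hk | hk | hk
  · exact (hlo k hk).symm
  · rw [hk, hfix k hk]
  · have := hup _ (show σ⁻¹ (σ k) < σ k by rwa [inv_apply])
    rw [inv_apply, Perm.inv_eq_iff_eq] at this
    exact this

variable {R : Type*} [CommRing R]

/-- An up step carries no label, so the weight of a valley sees only the height, which is `ucross +
unest`. A peak carries a crossing number and a closing label. A double rise carries the nesting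
number of its preimage, and the sum of its own two numbers is the height minus one; this explains
the form of `d`. -/
theorem gfCC_genWeight_of_chain (a : ℕ → R) (b c d : ℕ → ℕ → R) (e : ℕ → R) (lam mu : R) :
    gfCC cc (genWeight (fun j k => a (j + k)) b c (fun j k l => d (j + k) l) e lam mu) 1
      = jFrac (fun n => starSum c n + naturalSum d n + lam * e n)
          (fun n => (lam + ((n : R) - 1) * mu) * a (n - 1) * starSum b n) := by
  ext n
  rw [gfCC, PowerSeries.coeff_mk]
  have := sum_eq_coeff_jFrac (fun _ => {()})
    (fun h => insertNone ((range h).disjSum (range h))) (fun h => range h ×ˢ range h)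
    (chainCode (n := n)) hgt hgt_zero hgt_self ?_ ?_ chainCode_injective (by simp) ?_
    (fun h k => match k with
      | .inl _ => a h
      | .inr (.inl none) => lam * e h
      | .inr (.inl (some (.inl l))) => c l (h - 1 - l)
      | .inr (.inl (some (.inr l))) => d (h - 1) l
      | .inr (.inr (l, m)) => b l (h - 1 - l) * if m = 0 then lam else mu)
  · simp only [one_pow, one_mul]
    refine Eq.trans ?_ (this.trans (congrArg _ (jFrac_congr (fun n => ?_) fun n => ?_)))
    · refine Finset.sum_congr rfl fun σ _ => Finset.prod_congr rfl fun i _ => ?_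
      have h1 := hgt_eq σ i
      have h2 := hgt_eq' σ i
      have h3 := ucross_add_unest σ (i := i)
      have h4 := lcross_add_lnest σ (k := i)
      simp only [locWeight, chainCode]
      split_ifs with c1 c2 c2 c3 c4
      · have := h3 c1
        simp only [c2, if_true] at h1
        simp only [h1]
        congr 1
      · have := h3 c1
        simp only [c2, if_false] at h1
        simp only [h1]
        congr 1
      · have := h4 c2
        simp only [c2, if_true] at h2
        simp only [h2]
        congr 1; omega
      · have := h4 c2
        simp only [c2, if_true] at h2
        simp only [h2, closeLabel, c4, if_true]
        congr 2; omega
      · have := h4 c2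
        simp only [c2, if_true] at h2
        simp only [h2, closeLabel, c4, if_false]
        rw [if_neg (by omega)]
        congr 2; omega
      · have h5 : σ i = i := le_antisymm (not_lt.mp c1) (not_lt.mp c2)
        have h6 := (inv_eq_self_iff σ i).mpr h5
        simp only [h6, lt_irrefl, if_false] at h1
        simp only [h1]
        rfl
    · simp only [Finset.sum_insertNone, Finset.sum_disjSum, starSum, naturalSum]
      ring
    · simp only [Finset.sum_product, starSum, ← Finset.mul_sum, Finset.sum_const]
      -- Of the `n + 1` closing labels, label `0` contributes `lam` and each of the others `mu`.
      refine Eq.trans (congrArg (_ * ·) (Finset.sum_congr rfl fun x _ =>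
        congrArg (b x (n + 1 - 1 - x) * ·) (?_ : _ = lam + n * mu))) ?_
      · rw [Finset.sum_range_succ']
        simp
        ring
      · rw [← Finset.sum_mul, Finset.card_singleton, one_smul, Nat.cast_succ]
        ring
  · intro σ i
    have h1 := hgt_eq σ i
    have h2 := hgt_eq' σ i
    have h4 := lcross_add_lnest σ (k := i)
    have h5 := lt_inv_or_of_ne σ (i := i)
    simp only [allowed, chainCode]
    split_ifs with c1 c2 c2 c3
    · simpa using unest_inv_lt c2
    · simp
    · have := h4 c2
      simp only [c2, if_true] at h2
      simp
      omega
    · have := h4 c2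
      simp only [c2, if_true] at h2
      have := closeLabel_lt ((h5 c2.ne).resolve_right c3) c2
      simp
      omega
    · simp
  · intro σ i
    have h1 := hgt_eq σ i
    have h2 := hgt_succ σ i
    have h3 := lt_inv_or_of_ne σ (i := i)
    have h4 := inv_eq_self_iff σ i
    simp only [chainCode]
    split_ifs with c1 c2 c2 c3 <;> simp only [nextHeight] <;> grind
  · rw [Fintype.card_perm, Fintype.card_fin, ← coeff_jFrac_factorial]
    refine le_of_eq (congrArg _ (jFrac_congr (fun n => ?_) fun n => ?_))
    · simp; ring
    · simp; ring

end PermStat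

/-! ### Direct sums of permutations and the factorization over connected components -/

namespace PermStat
open Equiv CFrac

variable {k m n : ℕ}

/-- The direct sum of two permutations. -/
def dsum (σ : Perm (Fin k)) (τ : Perm (Fin m)) : Perm (Fin (k + m)) :=
  finSumFinEquiv.permCongr (Perm.sumCongr σ τ)

theorem dsum_castAdd (σ : Perm (Fin k)) (τ : Perm (Fin m)) (i : Fin k) :
    dsum σ τ (Fin.castAdd m i) = Fin.castAdd m (σ i) := by
  simp [dsum, permCongr_apply]

theorem dsum_natAdd (σ : Perm (Fin k)) (τ : Perm (Fin m)) (i : Fin m) :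
    dsum σ τ (Fin.natAdd k i) = Fin.natAdd k (τ i) := by
  simp [dsum, permCongr_apply]

theorem dsum_inv (σ : Perm (Fin k)) (τ : Perm (Fin m)) : (dsum σ τ)⁻¹ = dsum σ⁻¹ τ⁻¹ := rfl

theorem dsum_pow_castAdd (σ : Perm (Fin k)) (τ : Perm (Fin m)) (j : ℕ) (i : Fin k) :
    (dsum σ τ ^ j) (Fin.castAdd m i) = Fin.castAdd m ((σ ^ j) i) := by
  induction j with
  | zero => rfl
  | succ j ih => rw [pow_succ', pow_succ', Perm.mul_apply, ih, dsum_castAdd, Perm.mul_apply]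

theorem dsum_pow_natAdd (σ : Perm (Fin k)) (τ : Perm (Fin m)) (j : ℕ) (i : Fin m) :
    (dsum σ τ ^ j) (Fin.natAdd k i) = Fin.natAdd k ((τ ^ j) i) := by
  induction j with
  | zero => rfl
  | succ j ih => rw [pow_succ', pow_succ', Perm.mul_apply, ih, dsum_natAdd, Perm.mul_apply]

theorem card_filter_fin_add (p : Fin (k + m) → Prop) [DecidablePred p] :
    #{i | p i} = #{i | p (Fin.castAdd m i)} + #{i | p (Fin.natAdd k i)} := by
  simp only [Finset.card_filter, Fin.sum_univ_add]

theorem card_filter_castAdd {p : Fin (k + m) → Prop} [DecidablePred p] {q : Fin k → Prop}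
    [DecidablePred q] (h1 : ∀ i, p (Fin.castAdd m i) ↔ q i) (h2 : ∀ i, ¬ p (Fin.natAdd k i)) :
    #{i | p i} = #{i | q i} := by
  rw [card_filter_fin_add]
  simp only [h1, h2, Finset.filter_false, Finset.card_empty, add_zero]

theorem card_filter_natAdd {p : Fin (k + m) → Prop} [DecidablePred p] {q : Fin m → Prop}
    [DecidablePred q] (h1 : ∀ i, p (Fin.natAdd k i) ↔ q i) (h2 : ∀ i, ¬ p (Fin.castAdd m i)) :
    #{i | p i} = #{i | q i} := by
  rw [card_filter_fin_add]
  simp only [h1, h2, Finset.filter_false, Finset.card_empty, zero_add]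

theorem castAdd_lt_castAdd (i j : Fin k) : Fin.castAdd m i < Fin.castAdd m j ↔ i < j := Iff.rfl

theorem natAdd_lt_natAdd (i j : Fin m) : Fin.natAdd k i < Fin.natAdd k j ↔ i < j := by
  rw [Fin.lt_def, Fin.lt_def, Fin.val_natAdd, Fin.val_natAdd, Nat.add_lt_add_iff_left]

theorem castAdd_lt_natAdd (i : Fin k) (j : Fin m) : Fin.castAdd m i < Fin.natAdd k j := by
  have := i.2
  simp only [Fin.lt_def, Fin.val_castAdd, Fin.val_natAdd]
  omega

theorem not_natAdd_lt_castAdd (i : Fin k) (j : Fin m) : ¬ Fin.natAdd k j < Fin.castAdd m i :=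
  (castAdd_lt_natAdd i j).not_gt

variable (σ : Perm (Fin k)) (τ : Perm (Fin m))

theorem ucross_dsum_castAdd (j : Fin k) : ucross (dsum σ τ) (Fin.castAdd m j) = ucross σ j := by
  refine card_filter_castAdd (fun i => ?_) fun i => ?_ <;>
  simp only [dsum_castAdd, dsum_natAdd, castAdd_lt_castAdd, castAdd_lt_natAdd,
    not_natAdd_lt_castAdd, false_and, and_false, not_false_eq_true]

theorem unest_dsum_castAdd (j : Fin k) : unest (dsum σ τ) (Fin.castAdd m j) = unest σ j := by
  refine card_filter_castAdd (fun i => ?_) fun i => ?_ <;>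
  simp only [dsum_castAdd, dsum_natAdd, castAdd_lt_castAdd, castAdd_lt_natAdd,
    not_natAdd_lt_castAdd, false_and, and_false, not_false_eq_true]

theorem lcross_dsum_castAdd (j : Fin k) : lcross (dsum σ τ) (Fin.castAdd m j) = lcross σ j := by
  refine card_filter_castAdd (fun i => ?_) fun i => ?_ <;>
  simp only [dsum_castAdd, dsum_natAdd, castAdd_lt_castAdd, castAdd_lt_natAdd,
    not_natAdd_lt_castAdd, false_and, and_false, not_false_eq_true]

theorem lnest_dsum_castAdd (j : Fin k) : lnest (dsum σ τ) (Fin.castAdd m j) = lnest σ j := by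
  refine card_filter_castAdd (fun i => ?_) fun i => ?_ <;>
  simp only [dsum_castAdd, dsum_natAdd, castAdd_lt_castAdd, castAdd_lt_natAdd,
    not_natAdd_lt_castAdd, false_and, and_false, not_false_eq_true]

theorem lev_dsum_castAdd (j : Fin k) : lev (dsum σ τ) (Fin.castAdd m j) = lev σ j := by
  refine card_filter_castAdd (fun i => ?_) fun i => ?_ <;>
  simp only [dsum_castAdd, dsum_natAdd, castAdd_lt_castAdd, castAdd_lt_natAdd,
    not_natAdd_lt_castAdd, false_and, and_false, not_false_eq_true]

theorem ucross_dsum_natAdd (j : Fin m) : ucross (dsum σ τ) (Fin.natAdd k j) = ucross τ j := by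
  refine card_filter_natAdd (fun i => ?_) fun i => ?_ <;>
  simp only [dsum_castAdd, dsum_natAdd, natAdd_lt_natAdd, castAdd_lt_natAdd,
    not_natAdd_lt_castAdd, false_and, and_false, not_false_eq_true]

theorem unest_dsum_natAdd (j : Fin m) : unest (dsum σ τ) (Fin.natAdd k j) = unest τ j := by
  refine card_filter_natAdd (fun i => ?_) fun i => ?_ <;>
  simp only [dsum_castAdd, dsum_natAdd, natAdd_lt_natAdd, castAdd_lt_natAdd,
    not_natAdd_lt_castAdd, false_and, and_false, not_false_eq_true]

theorem lcross_dsum_natAdd (j : Fin m) : lcross (dsum σ τ) (Fin.natAdd k j) = lcross τ j := by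
  refine card_filter_natAdd (fun i => ?_) fun i => ?_ <;>
  simp only [dsum_castAdd, dsum_natAdd, natAdd_lt_natAdd, castAdd_lt_natAdd,
    not_natAdd_lt_castAdd, false_and, and_false, not_false_eq_true]

theorem lnest_dsum_natAdd (j : Fin m) : lnest (dsum σ τ) (Fin.natAdd k j) = lnest τ j := by
  refine card_filter_natAdd (fun i => ?_) fun i => ?_ <;>
  simp only [dsum_castAdd, dsum_natAdd, natAdd_lt_natAdd, castAdd_lt_natAdd,
    not_natAdd_lt_castAdd, false_and, and_false, not_false_eq_true]

theorem lev_dsum_natAdd (j : Fin m) : lev (dsum σ τ) (Fin.natAdd k j) = lev τ j := by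
  refine card_filter_natAdd (fun i => ?_) fun i => ?_ <;>
  simp only [dsum_castAdd, dsum_natAdd, natAdd_lt_natAdd, castAdd_lt_natAdd,
    not_natAdd_lt_castAdd, false_and, and_false, not_false_eq_true]

theorem isCycMax_dsum_castAdd (j : Fin k) :
    IsCycMax (dsum σ τ) (Fin.castAdd m j) ↔ IsCycMax σ j :=
  forall_congr' fun _ => by rw [dsum_pow_castAdd]; rfl

theorem isCycMax_dsum_natAdd (j : Fin m) :
    IsCycMax (dsum σ τ) (Fin.natAdd k j) ↔ IsCycMax τ j :=
  forall_congr' fun _ => by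
    rw [dsum_pow_natAdd, ← not_lt, natAdd_lt_natAdd, not_lt]

variable {R : Type*} [CommRing R]

/-- No arc leads from one summand to the other, and no arc of one summand passes over a point of the
other, so each local factor is computed within its own summand. -/
theorem genWeight_dsum (a b c : ℕ → ℕ → R) (d : ℕ → ℕ → ℕ → R) (e : ℕ → R) (lam mu : R) :
    genWeight a b c d e lam mu (k + m) (dsum σ τ)
      = genWeight a b c d e lam mu k σ * genWeight a b c d e lam mu m τ := by
  classical
  rw [genWeight, Fin.prod_univ_add]
  congr 1 <;> refine Finset.prod_congr rfl fun i _ => ?_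
  · simp only [locWeight, dsum_inv, dsum_castAdd, castAdd_lt_castAdd, ucross_dsum_castAdd,
      unest_dsum_castAdd, lcross_dsum_castAdd, lnest_dsum_castAdd, lev_dsum_castAdd,
      if_congr (isCycMax_dsum_castAdd σ τ i) rfl rfl]
  · simp only [locWeight, dsum_inv, dsum_natAdd, natAdd_lt_natAdd, ucross_dsum_natAdd,
      unest_dsum_natAdd, lcross_dsum_natAdd, lnest_dsum_natAdd, lev_dsum_natAdd,
      if_congr (isCycMax_dsum_natAdd σ τ i) rfl rfl]

theorem cc_dsum : cc (k + m) (dsum σ τ) = cc k σ + cc m τ := by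
  rw [cc, card_filter_fin_add]
  congr 1 <;> refine congrArg Finset.card (Finset.filter_congr fun i _ => ?_)
  · constructor
    · intro h j hj
      have := h (Fin.castAdd m j) hj
      rwa [dsum_castAdd] at this
    · intro h
      refine Fin.addCases (fun j hj => ?_) fun j hj => ?_
      · rw [dsum_castAdd]
        exact h j hj
      · exact absurd (castAdd_lt_natAdd i j) hj.not_gt
  · constructor
    · intro h j hj
      have := h (Fin.natAdd k j) (not_lt.mp fun h => hj.not_gt ((natAdd_lt_natAdd _ _).mp h))
      rw [dsum_natAdd] at this
      exact not_lt.mp fun h => this.not_gt ((natAdd_lt_natAdd _ _).mpr h)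
    · intro h
      refine Fin.addCases (fun j _ => ?_) fun j hj => ?_
      · rw [dsum_castAdd]
        exact (castAdd_lt_natAdd _ _).le
      · rw [dsum_natAdd]
        refine not_lt.mp fun h' => (h j ?_).not_gt ((natAdd_lt_natAdd _ _).mp h')
        exact not_lt.mp fun h => hj.not_gt ((natAdd_lt_natAdd _ _).mpr h)

/-- The prefix of length `k` is the first connected component of `σ`. -/
def FirstComponent (σ : Perm (Fin n)) (k : ℕ) : Prop :=
  (0 < k ∧ ∀ j : Fin n, (j : ℕ) < k → (σ j : ℕ) < k) ∧
    ∀ k', 0 < k' → k' < k → ∃ j : Fin n, (j : ℕ) < k' ∧ k' ≤ (σ j : ℕ)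

/-- The last index of a nonempty permutation is always a divider, so it must be the only one. A
divider with index `i` in `Fin k` belongs to the prefix of length `i + 1`. -/
theorem cc_eq_one_iff (σ : Perm (Fin k)) : cc k σ = 1 ↔
    0 < k ∧ ∀ k', 0 < k' → k' < k → ∃ j : Fin k, (j : ℕ) < k' ∧ k' ≤ (σ j : ℕ) := by
  rcases Nat.eq_zero_or_pos k with rfl | hk
  · simp [cc]
  let l : Fin k := ⟨k - 1, by omega⟩
  have hl : l ∈ ({i | ∀ j ≤ i, σ j ≤ i} : Finset (Fin k)) := by
    simp only [Finset.mem_filter, Finset.mem_univ, true_and, l, Fin.le_def]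
    intro j _
    have := (σ j).2
    omega
  constructor
  · intro h
    refine ⟨hk, fun k' h0 hk' => ?_⟩
    obtain ⟨a, ha⟩ := Finset.card_eq_one.mp h
    by_contra! hcon
    have : (⟨k' - 1, by omega⟩ : Fin k) ∈ ({i | ∀ j ≤ i, σ j ≤ i} : Finset (Fin k)) := by
      simp only [Finset.mem_filter, Finset.mem_univ, true_and, Fin.le_def]
      intro j hj
      have := hcon j (by omega)
      omega
    rw [ha, Finset.mem_singleton] at this hl
    have := congrArg Fin.val (this.trans hl.symm)
    simp only [l] at this
    omega
  · rintro ⟨-, h⟩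
    refine Finset.card_eq_one.mpr ⟨l, Finset.eq_singleton_iff_unique_mem.mpr ⟨hl, fun i hi => ?_⟩⟩
    simp only [Finset.mem_filter, Finset.mem_univ, true_and, Fin.le_def] at hi
    by_contra hne
    have hi' : (i : ℕ) + 1 < k := by
      have := i.2
      have : (i : ℕ) ≠ k - 1 := fun h => hne (Fin.ext h)
      omega
    obtain ⟨j, hj, hj'⟩ := h (i + 1) (by omega) hi'
    have := hi j (by omega)
    omega

theorem firstComponent_dsum : FirstComponent (dsum σ τ) k ↔ cc k σ = 1 := by
  rw [cc_eq_one_iff, FirstComponent]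
  have h1 : ∀ j : Fin (k + m), (j : ℕ) < k → (dsum σ τ j : ℕ) < k := by
    refine Fin.addCases (fun j _ => ?_) fun j hj => ?_
    · rw [dsum_castAdd]
      exact (σ j).2
    · rw [Fin.val_natAdd] at hj
      omega
  rw [and_iff_left h1]
  refine and_congr_right fun _ => forall₃_congr fun k' _ hk' => ?_
  constructor
  · rintro ⟨j, hj, hj'⟩
    induction j using Fin.addCases with
    | left j =>
      rw [dsum_castAdd] at hj'
      exact ⟨j, hj, hj'⟩
    | right j =>
      rw [Fin.val_natAdd] at hj
      omega
  · rintro ⟨j, hj, hj'⟩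
    exact ⟨Fin.castAdd m j, hj, by rwa [dsum_castAdd]⟩

theorem dsum_injective {σ σ' : Perm (Fin k)} {τ τ' : Perm (Fin m)}
    (h : dsum σ τ = dsum σ' τ') : σ = σ' ∧ τ = τ' := by
  have := Perm.sumCongrHom_injective (finSumFinEquiv.permCongr.injective h : Perm.sumCongrHom _ _
    (σ, τ) = Perm.sumCongrHom _ _ (σ', τ'))
  exact Prod.mk.inj this

theorem exists_dsum (σ : Perm (Fin (k + m)))
    (h : ∀ j : Fin (k + m), (j : ℕ) < k → (σ j : ℕ) < k) : ∃ σ₁ τ, dsum σ₁ τ = σ := by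
  have := Perm.mem_sumCongrHom_range_of_perm_mapsTo_inl
    (σ := finSumFinEquiv.symm.permCongr σ) ?_
  · obtain ⟨⟨σ₁, τ⟩, hστ⟩ := this
    refine ⟨σ₁, τ, ?_⟩
    rw [dsum, show Perm.sumCongr σ₁ τ = _ from hστ]
    ext
    simp [permCongr_apply]
  · rintro _ ⟨i, rfl⟩
    have h1 := h (Fin.castAdd m i) i.2
    refine ⟨⟨σ (Fin.castAdd m i), h1⟩, ?_⟩
    rw [permCongr_apply, Equiv.eq_symm_apply]
    rfl

/-- The first component is the shortest nonempty prefix mapped to itself; the antidiagonal is used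
because the sum is to become a coefficient of a product of series. -/
theorem existsUnique_firstComponent (σ : Perm (Fin n)) (hn : n ≠ 0) :
    ∃ p ∈ antidiagonal n, FirstComponent σ p.1 ∧
      ∀ q ∈ antidiagonal n, FirstComponent σ q.1 → q = p := by
  classical
  have hex : ∃ k, 0 < k ∧ ∀ j : Fin n, (j : ℕ) < k → (σ j : ℕ) < k :=
    ⟨n, Nat.pos_of_ne_zero hn, fun j _ => (σ j).2⟩
  have hle : Nat.find hex ≤ n :=
    Nat.find_min' hex ⟨Nat.pos_of_ne_zero hn, fun j _ => (σ j).2⟩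
  have hfc : FirstComponent σ (Nat.find hex) := by
    refine ⟨Nat.find_spec hex, fun k' h0 hk' => ?_⟩
    have := Nat.find_min hex hk'
    push Not at this
    exact this h0
  refine ⟨(Nat.find hex, n - Nat.find hex), by simpa using by omega, hfc, ?_⟩
  intro q hq h
  have h1 : q.1 = Nat.find hex := by
    rcases lt_trichotomy q.1 (Nat.find hex) with hlt | heq | hgt
    · exact absurd h.1 (Nat.find_min hex hlt)
    · exact heq
    · obtain ⟨j, hj, hj'⟩ := h.2 _ (Nat.find_spec hex).1 hgt
      exact absurd ((Nat.find_spec hex).2 j hj) hj'.not_gt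
  rw [HasAntidiagonal.mem_antidiagonal] at hq
  ext
  · exact h1
  · simp; omega

/-- A weight that is multiplicative under direct sums factors over the connected components. -/
theorem decomposes_of_dsum {w : ∀ n, Perm (Fin n) → R} (h0 : ∀ σ, w 0 σ = 1)
    (hw : ∀ (k m : ℕ) (σ : Perm (Fin k)) (τ : Perm (Fin m)),
      w (k + m) (dsum σ τ) = w k σ * w m τ) : Decomposes cc w := by
  classical
  intro ζ
  suffices h : gfCC cc w ζ = 1 + PowerSeries.C ζ * (gfIndec cc w * gfCC cc w ζ) by
    linear_combination h
  ext n
  rw [map_add, PowerSeries.coeff_C_mul, PowerSeries.coeff_mul]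
  rcases eq_or_ne n 0 with rfl | hn
  · simp [gfCC, gfIndec, h0, cc, PowerSeries.coeff_mk, -PowerSeries.coeff_zero_eq_constantCoeff]
  rw [PowerSeries.coeff_one, if_neg hn, zero_add]
  simp only [gfCC, gfIndec, PowerSeries.coeff_mk]
  -- The sum over permutations is split by the length of the first component, which contributes one
  -- factor `ζ`; what follows it is an arbitrary permutation.
  have hfib : ∀ σ : Perm (Fin n), ζ ^ cc n σ * w n σ
      = ∑ p ∈ antidiagonal n, if FirstComponent σ p.1 then ζ ^ cc n σ * w n σ else 0 := by
    intro σ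
    obtain ⟨p, hp, hσ, huniq⟩ := existsUnique_firstComponent σ hn
    rw [Finset.sum_eq_single p, if_pos hσ]
    · exact fun q hq hqp => if_neg fun h => hqp (huniq q hq h)
    · exact fun h => absurd hp h
  rw [Finset.sum_congr rfl fun σ _ => hfib σ, Finset.sum_comm, Finset.mul_sum]
  refine Finset.sum_congr rfl fun p hp => ?_
  obtain ⟨k, m⟩ := p
  obtain rfl := HasAntidiagonal.mem_antidiagonal.mp hp
  simp only
  rw [← Finset.sum_filter, Finset.sum_mul_sum, ← Finset.sum_product', Finset.mul_sum]
  symm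
  refine Finset.sum_bij (fun q _ => dsum q.1 q.2) ?_ ?_ ?_ ?_
  · intro q hq
    simpa [firstComponent_dsum] using hq
  · intro q _ q' _ h
    exact Prod.ext (dsum_injective h).1 (dsum_injective h).2
  · intro σ hσ
    simp only [Finset.mem_filter, Finset.mem_univ, true_and] at hσ
    obtain ⟨σ₁, τ, rfl⟩ := exists_dsum σ hσ.1.2
    rw [firstComponent_dsum] at hσ
    exact ⟨(σ₁, τ), by simpa using hσ, rfl⟩
  · intro q hq
    simp only [Finset.mem_product, Finset.mem_filter, Finset.mem_univ, true_and, and_true] at hq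
    rw [cc_dsum, hw, hq]
    ring

theorem decomposes_genWeight (a b c : ℕ → ℕ → R) (d : ℕ → ℕ → ℕ → R) (e : ℕ → R) (lam mu : R) :
    Decomposes cc (genWeight a b c d e lam mu) :=
  decomposes_of_dsum (fun σ => by simp [genWeight])
    fun _ _ σ τ => genWeight_dsum σ τ a b c d e lam mu

end PermStat

/-! ### Permutation statistics as products of local weights -/

namespace PermStat
open Equiv CFrac

variable {n : ℕ}

/-- For `σ i ≤ i`, a later position with a smaller value is an arc that nests around the one at `i`.
An excedance is never an antirecord. -/
theorem isArec_iff (σ : Perm (Fin n)) (i : Fin n) :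
    IsArec σ i ↔ (σ i < i ∧ lnest σ i = 0) ∨ (σ i = i ∧ lev σ i = 0) := by
  rcases lt_trichotomy (σ i) i with h | h | h
  · simp only [h, h.ne, true_and, false_and, or_false, lnest, Finset.card_eq_zero,
      Finset.filter_eq_empty_iff, Finset.mem_univ, forall_const]
    refine forall_congr' fun j => ?_
    constructor
    · exact fun h' hj => (h' hj.2).not_gt hj.1
    · intro h' hj
      refine lt_of_le_of_ne (not_lt.mp fun h1 => h' ⟨h1, hj⟩) fun e => ?_
      exact hj.ne (σ.injective e)
  · have e : lev σ i = lev σ⁻¹ i := by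
      have h1 := hgt_eq σ i
      have h2 := hgt_eq' σ i
      rw [(inv_eq_self_iff σ i).mpr h] at h1
      simp only [h, lt_irrefl, if_false, add_zero] at h1 h2
      exact h1.symm.trans h2
    simp only [h, lt_irrefl, false_and, true_and, false_or, e]
    rw [lev, card_filter_perm σ (fun v => v < i ∧ i < σ⁻¹ v), Finset.card_eq_zero,
      Finset.filter_eq_empty_iff]
    simp only [inv_apply, Finset.mem_univ, forall_const]
    refine forall_congr' fun j => ?_
    constructor
    · exact fun h' hj => (h' hj.2).not_gt (by rw [h]; exact hj.1)
    · intro h' hj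
      refine lt_of_le_of_ne (not_lt.mp fun h1 => h' ⟨by rwa [h] at h1, hj⟩) fun e => ?_
      exact hj.ne (σ.injective e)
  · simp only [h.not_gt, h.ne', false_and, or_false, iff_false]
    intro h'
    -- The excedance `i` crosses the gap after `i`, so some arc crosses it downwards; its starting
    -- position is later and its value smaller.
    have h1 := hgt_succ σ i
    rw [if_pos h, ← hgt_inv, hgt] at h1
    have h2 : 0 < #{j : Fin n | (j : ℕ) < i + 1 ∧ (i : ℕ) + 1 ≤ (σ⁻¹ j : ℕ)} := by omega
    obtain ⟨v, hv⟩ := Finset.card_pos.mp h2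
    simp only [Finset.mem_filter, Finset.mem_univ, true_and] at hv
    have := h' (σ⁻¹ v) (Fin.lt_def.mpr (by omega))
    rw [apply_inv] at this
    rw [Fin.lt_def] at this h
    omega

theorem isRec_iff (σ : Perm (Fin n)) (i : Fin n) :
    IsRec σ i ↔ (i < σ i ∧ unest σ i = 0) ∨ (σ i = i ∧ lev σ i = 0) := by
  rcases lt_trichotomy (σ i) i with h | h | h
  · simp only [h.not_gt, h.ne, false_and, or_false, iff_false]
    intro h'
    have h1 := hgt_eq' σ i
    rw [if_pos h, hgt] at h1
    have h2 : 0 < #{j : Fin n | (j : ℕ) < i ∧ (i : ℕ) ≤ (σ j : ℕ)} := by omega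
    obtain ⟨v, hv⟩ := Finset.card_pos.mp h2
    simp only [Finset.mem_filter, Finset.mem_univ, true_and] at hv
    have := h' v (Fin.lt_def.mpr (by omega))
    rw [Fin.lt_def] at this h
    omega
  · simp only [h, lt_irrefl, false_and, true_and, false_or, lev, Finset.card_eq_zero,
      Finset.filter_eq_empty_iff, Finset.mem_univ, forall_const]
    refine forall_congr' fun j => ?_
    constructor
    · exact fun h' hj => (h' hj.1).not_gt (by rw [h]; exact hj.2)
    · intro h' hj
      refine lt_of_le_of_ne (not_lt.mp fun h1 => h' ⟨hj, by rwa [h] at h1⟩) fun e => ?_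
      exact hj.ne (σ.injective e)
  · simp only [h, h.ne', true_and, false_and, or_false, unest, Finset.card_eq_zero,
      Finset.filter_eq_empty_iff, Finset.mem_univ, forall_const]
    refine forall_congr' fun j => ?_
    constructor
    · exact fun h' hj => (h' hj.1).not_gt hj.2
    · intro h' hj
      refine lt_of_le_of_ne (not_lt.mp fun h1 => h' ⟨hj, h1⟩) fun e => ?_
      exact hj.ne (σ.injective e)

theorem isErec_iff (σ : Perm (Fin n)) (i : Fin n) : IsErec σ i ↔ i < σ i ∧ unest σ i = 0 := by
  rw [IsErec, isRec_iff, isArec_iff]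
  grind

theorem isEarec_iff (σ : Perm (Fin n)) (i : Fin n) : IsEarec σ i ↔ σ i < i ∧ lnest σ i = 0 := by
  rw [IsEarec, isRec_iff, isArec_iff]
  grind

theorem isNrar_iff (σ : Perm (Fin n)) (i : Fin n) :
    IsNrar σ i ↔ (i < σ i ∧ unest σ i ≠ 0) ∨ (σ i < i ∧ lnest σ i ≠ 0)
      ∨ (σ i = i ∧ lev σ i ≠ 0) := by
  rw [IsNrar, isRec_iff, isArec_iff]
  grind

theorem IsCycMax.of_fixed {σ : Perm (Fin n)} {i : Fin n} (h : σ i = i) : IsCycMax σ i :=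
  fun m => (Perm.pow_apply_eq_self_of_apply_eq_self h m).le

theorem IsCycMax.apply_le {σ : Perm (Fin n)} {i : Fin n} (h : IsCycMax σ i) : σ i ≤ i := by
  simpa using h 1

theorem IsCycMax.inv_le {σ : Perm (Fin n)} {i : Fin n} (h : IsCycMax σ i) : σ⁻¹ i ≤ i := by
  -- The inverse is a nonnegative power of `σ`.
  have := h (orderOf σ - 1)
  rwa [show σ ^ (orderOf σ - 1) = σ⁻¹ from
    eq_inv_of_mul_eq_one_left (by
      rw [← pow_succ, Nat.sub_add_cancel (orderOf_pos σ), pow_orderOf_eq_one])] at this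

theorem isCycMax_iff_sameCycle {σ : Perm (Fin n)} {i : Fin n} :
    IsCycMax σ i ↔ ∀ j, σ.SameCycle i j → j ≤ i := by
  constructor
  · intro h j hj
    obtain ⟨m, -, -, rfl⟩ := hj.exists_pow_eq'
    exact h m
  · exact fun h m => h _ ⟨m, by simp⟩

open Classical in
-- Each cycle is represented by its largest element, which makes the number of cycles a sum of
-- contributions of indices.
theorem cyc_eq (σ : Perm (Fin n)) : cyc σ = #{i | IsCycMax σ i} := by
  have h1 : Multiset.card σ.cycleType = #{i | IsCycMax σ i ∧ σ i ≠ i} := by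
    rw [Perm.cycleType_def, Multiset.card_map]
    symm
    refine Finset.card_bij (fun i _ => σ.cycleOf i) ?_ ?_ ?_
    · intro i hi
      simp only [Finset.mem_filter, Finset.mem_univ, true_and] at hi
      exact Perm.cycleOf_mem_cycleFactorsFinset_iff.mpr (Perm.mem_support.mpr hi.2)
    · intro i hi j hj hij
      simp only [Finset.mem_filter, Finset.mem_univ, true_and, isCycMax_iff_sameCycle] at hi hj
      have hs : σ.SameCycle i j := by
        by_contra hns
        have h1 := Perm.cycleOf_apply_self σ i
        rw [hij, Perm.cycleOf_apply_of_not_sameCycle fun h => hns h.symm] at h1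
        exact hi.2 h1.symm
      exact le_antisymm (hj.1 _ hs.symm) (hi.1 _ hs)
    · intro c hc
      have hcyc := (Perm.mem_cycleFactorsFinset_iff.mp hc).1
      have hne := hcyc.nonempty_support
      have hmem := Finset.max'_mem _ hne
      have hco := Perm.cycle_is_cycleOf hmem hc
      refine ⟨c.support.max' hne, ?_, hco.symm⟩
      simp only [Finset.mem_filter, Finset.mem_univ, true_and, isCycMax_iff_sameCycle]
      constructor
      · intro j hj
        refine Finset.le_max' _ _ ?_
        rw [hco, Perm.mem_support_cycleOf_iff]
        refine ⟨hj, Perm.mem_cycleFactorsFinset_support_le hc hmem⟩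
      · exact Perm.mem_support.mp (Perm.mem_cycleFactorsFinset_support_le hc hmem)
  have h2 : #{i | σ i = i} = #{i | IsCycMax σ i ∧ ¬ σ i ≠ i} := by
    congr 1
    ext i
    simp only [Finset.mem_filter, Finset.mem_univ, true_and, not_not]
    exact ⟨fun h => ⟨.of_fixed h, h⟩, fun h => h.2⟩
  rw [cyc, h1, h2, ← Finset.filter_filter, ← Finset.filter_filter,
    Finset.card_filter_add_card_filter_not]

section weights

variable {R : Type*} [CommRing R]

theorem pow_card_filter {ι : Type*} [Fintype ι] (x : R) (p : ι → Prop) [DecidablePred p] :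
    x ^ #{i | p i} = ∏ i, if p i then x else 1 := by
  rw [← Finset.prod_const, Finset.prod_filter]

theorem pow_sum_filter {ι : Type*} [Fintype ι] (x : R) (p : ι → Prop) [DecidablePred p]
    (f : ι → ℕ) : x ^ (∑ i with p i, f i) = ∏ i, if p i then x ^ f i else 1 := by
  rw [← Finset.prod_pow_eq_pow_sum, Finset.prod_filter]

/-- The comparison of a product of powers with `genWeight` is reduced to the six kinds of indices.
-/
theorem locWeight_cases (a b c : ℕ → ℕ → R) (d : ℕ → ℕ → ℕ → R) (e : ℕ → R) (lam mu : R)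
    (σ : Perm (Fin n)) (i : Fin n) (v : R)
    (ha : i < σ i → i < σ⁻¹ i → v = a (ucross σ i) (unest σ i))
    (hb : σ i < i → σ⁻¹ i < i → IsCycMax σ i → v = b (lcross σ i) (lnest σ i) * lam)
    (hb' : σ i < i → σ⁻¹ i < i → ¬ IsCycMax σ i → v = b (lcross σ i) (lnest σ i) * mu)
    (hc : σ i < i → i < σ⁻¹ i → v = c (lcross σ i) (lnest σ i))
    (hd : i < σ i → σ⁻¹ i < i → v = d (ucross σ i) (unest σ i) (unest σ (σ⁻¹ i)))
    (he : σ i = i → σ⁻¹ i = i → v = lam * e (lev σ i)) :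
    v = locWeight a b c d e lam mu σ i := by
  have h := lt_inv_or_of_ne σ (i := i)
  rw [locWeight]
  split_ifs with h1 h2 h2 h3 h4
  · exact hd h1 h2
  · exact ha h1 ((h h1.ne').resolve_left h2)
  · exact hc h2 h3
  · exact hb h2 ((h h2.ne).resolve_right h3) h4
  · exact hb' h2 ((h h2.ne).resolve_right h3) h4
  · have := le_antisymm (not_lt.mp h1) (not_lt.mp h2)
    exact he this ((inv_eq_self_iff σ i).mpr this)

theorem prod_filter_eq_genWeight (a b c : ℕ → ℕ → R) (d : ℕ → ℕ → ℕ → R) (e : ℕ → R)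
    (σ : Perm (Fin n)) :
    (∏ i with IsCval σ i, a (ucross σ i) (unest σ i))
    * (∏ i with IsCpeak σ i, b (lcross σ i) (lnest σ i))
    * (∏ i with IsCdfall σ i, c (lcross σ i) (lnest σ i))
    * (∏ i with IsCdrise σ i, d (ucross σ i) (unest σ i) (unest σ (σ⁻¹ i)))
    * (∏ i with σ i = i, e (lev σ i)) = genWeight a b c d e 1 1 n σ := by
  simp only [Finset.prod_filter, ← Finset.prod_mul_distrib, genWeight]
  refine Finset.prod_congr rfl fun i _ => ?_
  apply locWeight_cases <;> intro h1 h2 <;>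
  first
  | simp [-Perm.coe_inv, IsCval, IsCpeak, IsCdfall, IsCdrise, h1, h2, h1.not_gt, h2.not_gt, h1.ne,
      h1.ne']
  | simp [-Perm.coe_inv, IsCval, IsCpeak, IsCdfall, IsCdrise, h1, h2]

/-- A cycle maximum is a peak or a fixed point, and the factor `lam` is attached there. -/
theorem genWeight_mul_pow_cyc (a b c : ℕ → ℕ → R) (d : ℕ → ℕ → ℕ → R) (e : ℕ → R) (lam : R)
    (σ : Perm (Fin n)) :
    genWeight a b c d e 1 1 n σ * lam ^ cyc σ = genWeight a b c d e lam 1 n σ := by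
  classical
  rw [cyc_eq, pow_card_filter, genWeight, ← Finset.prod_mul_distrib, genWeight]
  refine Finset.prod_congr rfl fun i _ => ?_
  have hm := fun h : IsCycMax σ i => h.apply_le
  have hm' := fun h : IsCycMax σ i => h.inv_le
  apply locWeight_cases
  · intro h1 h2
    rw [if_neg fun h => (hm h).not_gt h1]
    simp [-Perm.coe_inv, locWeight, h1, h2.not_gt]
  · intro h1 h2 h3
    simp [-Perm.coe_inv, locWeight, h1, h1.not_gt, h2.not_gt, h3]
  · intro h1 h2 h3
    simp [-Perm.coe_inv, locWeight, h1, h1.not_gt, h2.not_gt, h3]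
  · intro h1 h2
    rw [if_neg fun h => (hm' h).not_gt h2]
    simp [-Perm.coe_inv, locWeight, h1, h1.not_gt, h2]
  · intro h1 h2
    rw [if_neg fun h => (hm h).not_gt h1]
    simp [-Perm.coe_inv, locWeight, h1, h2]
  · intro h1 h2
    simp [-Perm.coe_inv, locWeight, h1, IsCycMax.of_fixed h1, mul_comm]

theorem wMaster1_eq (a b c d : ℕ → ℕ → R) (e : ℕ → R) :
    wMaster1 a b c d e = genWeight a b c (fun j k _ => d j k) e 1 1 := by
  ext n σ
  exact prod_filter_eq_genWeight a b c (fun j k _ => d j k) e σ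

theorem wMaster2_eq (a : ℕ → R) (b c d : ℕ → ℕ → R) (e : ℕ → R) (lam : R) :
    wMaster2 a b c d e lam
      = genWeight (fun j k => a (j + k)) b c (fun j k l => d (j + k) l) e lam 1 := by
  ext n σ
  rw [← genWeight_mul_pow_cyc, ← prod_filter_eq_genWeight, wMaster2]
  ring

/-- Whether an index that is not fixed is an exclusive record or antirecord depends only on whether
its nesting number vanishes; hence the tests `k = 0`. -/
theorem wBig_eq (x₁ x₂ y₁ y₂ u₁ u₂ v₁ v₂ : R) (w : ℕ → R)
    (pp1 pp2 pm1 pm2 qp1 qp2 qm1 qm2 s : R) :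
    wBig x₁ x₂ y₁ y₂ u₁ u₂ v₁ v₂ w pp1 pp2 pm1 pm2 qp1 qp2 qm1 qm2 s
      = genWeight (fun j k => pp1 ^ j * qp1 ^ k * if k = 0 then y₁ else v₁)
          (fun j k => pm1 ^ j * qm1 ^ k * if k = 0 then x₁ else u₁)
          (fun j k => pm2 ^ j * qm2 ^ k * if k = 0 then x₂ else u₂)
          (fun j k _ => pp2 ^ j * qp2 ^ k * if k = 0 then y₂ else v₂)
          (fun l => s ^ l * w l) 1 1 := by
  ext n σ
  simp only [wBig, wRecCyc, wCrossNest, eareccpeak, eareccdfall, ereccval, ereccdrise, nrcpeak,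
    nrcdfall, nrcval, nrcdrise, ucrosscval, ucrosscdrise, lcrosscpeak, lcrosscdfall, unestcval,
    unestcdrise, lnestcpeak, lnestcdfall, psnest, pow_card_filter, pow_sum_filter,
    Finset.prod_filter, ← Finset.prod_mul_distrib, genWeight]
  refine Finset.prod_congr rfl fun i _ => ?_
  simp only [isErec_iff, isEarec_iff, isNrar_iff, IsCval, IsCpeak, IsCdfall, IsCdrise]
  apply locWeight_cases
  all_goals
    intro h1 h2
    first
    | simp [-Perm.coe_inv, h1, h2, h1.not_gt, h2.not_gt, h1.ne, h1.ne']
    | simp [-Perm.coe_inv, h1, h2]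
  · by_cases h : unest σ i = 0 <;> simp [h] <;> ring
  · intro _; by_cases h : lnest σ i = 0 <;> simp [h] <;> ring
  · intro _; by_cases h : lnest σ i = 0 <;> simp [h] <;> ring
  · by_cases h : lnest σ i = 0 <;> simp [h] <;> ring
  · by_cases h : unest σ i = 0 <;> simp [h] <;> ring
  · ring

theorem wBigHat_eq (x₁ x₂ y₁ y₂ u₁ u₂ v₁ v₂ : R) (w : ℕ → R)
    (pp1 pp2 pm1 pm2 qp1 qp2 qm1 qm2 s lam : R) :
    wBigHat x₁ x₂ y₁ y₂ u₁ u₂ v₁ v₂ w pp1 pp2 pm1 pm2 qp1 qp2 qm1 qm2 s lam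
      = genWeight (fun j k => pp1 ^ j * qp1 ^ k * if k = 0 then y₁ else v₁)
          (fun j k => pm1 ^ j * qm1 ^ k * if k = 0 then x₁ else u₁)
          (fun j k => pm2 ^ j * qm2 ^ k * if k = 0 then x₂ else u₂)
          (fun j k _ => pp2 ^ j * qp2 ^ k * if k = 0 then y₂ else v₂)
          (fun l => s ^ l * w l) lam 1 := by
  ext n σ
  rw [← genWeight_mul_pow_cyc, ← wBig_eq, wBigHat]

theorem wRecCyc_eq (x₁ x₂ y₁ y₂ u₁ u₂ v₁ v₂ : R) (w : ℕ → R) :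
    wRecCyc x₁ x₂ y₁ y₂ u₁ u₂ v₁ v₂ w = wBig x₁ x₂ y₁ y₂ u₁ u₂ v₁ v₂ w 1 1 1 1 1 1 1 1 1 := by
  ext n σ
  simp [wBig, wCrossNest]

theorem wRecCycHat_eq (x₁ x₂ y₁ y₂ u₁ u₂ v₁ v₂ : R) (w : ℕ → R) (lam : R) :
    wRecCycHat x₁ x₂ y₁ y₂ u₁ u₂ v₁ v₂ w lam
      = wBigHat x₁ x₂ y₁ y₂ u₁ u₂ v₁ v₂ w 1 1 1 1 1 1 1 1 1 lam := by
  ext n σ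
  rw [wRecCycHat, wBigHat, wRecCyc_eq]

/-- A joining is determined by its middle point. -/
theorem ujoin_eq (σ : Perm (Fin n)) : ujoin σ = #{i | IsCdrise σ i} := by
  rw [card_filter_perm σ (fun i => IsCdrise σ i)]
  simp only [IsCdrise, inv_apply]
  rfl

theorem ljoin_eq (σ : Perm (Fin n)) : ljoin σ = #{i | IsCdfall σ i} := by
  rw [card_filter_perm σ (fun i => IsCdfall σ i)]
  simp only [IsCdfall, inv_apply]
  rw [ljoin]
  simp only [and_comm]

theorem wPQ_eq (pp1 pp2 pm1 pm2 qp1 qp2 qm1 qm2 rp rm s : R) :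
    wPQ pp1 pp2 pm1 pm2 qp1 qp2 qm1 qm2 rp rm s
      = genWeight (fun j k => pp1 ^ j * qp1 ^ k) (fun j k => pm1 ^ j * qm1 ^ k)
          (fun j k => pm2 ^ j * qm2 ^ k * rm) (fun j k _ => pp2 ^ j * qp2 ^ k * rp)
          (fun l => s ^ l) 1 1 := by
  ext n σ
  simp only [wPQ, wCrossNest, ucrosscval, ucrosscdrise, lcrosscpeak, lcrosscdfall, unestcval,
    unestcdrise, lnestcpeak, lnestcdfall, psnest, ujoin_eq, ljoin_eq, pow_card_filter,
    pow_sum_filter, ← Finset.prod_mul_distrib, genWeight]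
  refine Finset.prod_congr rfl fun i _ => ?_
  simp only [IsCval, IsCpeak, IsCdfall, IsCdrise]
  apply locWeight_cases <;> intro h1 h2 <;>
  first
  | simp [-Perm.coe_inv, h1, h2, h1.not_gt, h2.not_gt, h1.ne, h1.ne']
  | simp [-Perm.coe_inv, h1, h2]

theorem ucross_eq_zero {σ : Perm (Fin n)} {i : Fin n} (h : ¬ i < σ i) : ucross σ i = 0 := by
  rw [ucross, Finset.card_eq_zero, Finset.filter_eq_empty_iff]
  exact fun j _ hj => h (hj.2.1.trans hj.2.2)

theorem unest_eq_zero {σ : Perm (Fin n)} {i : Fin n} (h : ¬ i < σ i) : unest σ i = 0 := by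
  rw [unest, Finset.card_eq_zero, Finset.filter_eq_empty_iff]
  exact fun j _ hj => h hj.2.1

theorem lcross_eq_zero {σ : Perm (Fin n)} {i : Fin n} (h : ¬ σ i < i) : lcross σ i = 0 := by
  rw [lcross, Finset.card_eq_zero, Finset.filter_eq_empty_iff]
  exact fun j _ hj => h (hj.1.trans hj.2.1)

theorem lnest_eq_zero {σ : Perm (Fin n)} {i : Fin n} (h : ¬ σ i < i) : lnest σ i = 0 := by
  rw [lnest, Finset.card_eq_zero, Finset.filter_eq_empty_iff]
  exact fun j _ hj => h hj.2.1

/-- Turns the exponents that are truncated differences into cardinalities, hence into products over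
indices. -/
theorem card_filter_sub {ι : Type*} [Fintype ι] {p q : ι → Prop} [DecidablePred p]
    [DecidablePred q] (h : ∀ i, q i → p i) : #{i | p i} - #{i | q i} = #{i | p i ∧ ¬ q i} := by
  have h1 := Finset.card_filter_add_card_filter_not (s := ({i | p i} : Finset ι)) q
  rw [Finset.filter_filter, Finset.filter_filter] at h1
  have h2 : #{i | p i ∧ q i} = #{i | q i} := by
    congr 1
    ext i
    simp only [Finset.mem_filter, Finset.mem_univ, true_and]
    exact ⟨fun h => h.2, fun hi => ⟨h i hi, hi⟩⟩
  omega

theorem exc_sub_erec (σ : Perm (Fin n)) :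
    exc σ - erec σ = #{i | i < σ i ∧ ¬ IsErec σ i} := by
  rw [exc, erec]
  exact card_filter_sub fun i hi => ((isErec_iff σ i).mp hi).1

theorem sub_exc_sub_arec (σ : Perm (Fin n)) :
    n - exc σ - arec σ = #{i | ¬ i < σ i ∧ ¬ IsArec σ i} := by
  have h := card_filter_sub (p := fun _ : Fin n => True) (q := fun i => i < σ i) fun _ _ => trivial
  simp only [Finset.filter_true, Finset.card_univ, Fintype.card_fin, true_and] at h
  rw [exc, h, arec]
  refine card_filter_sub fun i hi => ?_
  rcases (isArec_iff σ i).mp hi with h | h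
  · exact h.1.not_gt
  · exact h.1.le.not_gt

/-- The extra factor `pm` in the weight of a double fall comes from the lower joinings. A fixed
point is an antirecord exactly at level `0`, which gives its weight `x` or `u`. -/
theorem wArecPQ_eq (x y u v pp pm qp qm : R) :
    wArecPQ x y u v pp pm qp qm
      = genWeight (fun j k => pp ^ j * qp ^ k * if k = 0 then y else v)
          (fun j k => pm ^ j * qm ^ k * if k = 0 then x else u)
          (fun j k => pm * (pm ^ j * qm ^ k * if k = 0 then x else u))
          (fun j k _ => pp ^ j * qp ^ k * if k = 0 then y else v)
          (fun l => qm ^ l * if l = 0 then x else u) 1 1 := by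
  ext n σ
  have e : ∀ (z : R) (f : Fin n → ℕ), z ^ (∑ i, f i) = ∏ i, z ^ f i :=
    fun z f => (Finset.prod_pow_eq_pow_sum _ _ _).symm
  rw [wArecPQ, wArec, exc_sub_erec, sub_exc_sub_arec]
  simp only [pow_add, ljoin_eq, psnest, arec, erec,
    ucrossT, lcrossT, unestT, lnestT, e, pow_card_filter, pow_sum_filter,
    ← Finset.prod_mul_distrib, genWeight]
  refine Finset.prod_congr rfl fun i _ => ?_
  simp only [isErec_iff, isArec_iff, IsCdfall]
  apply locWeight_cases
  all_goals
    intro h1 h2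
    first
    | simp [-Perm.coe_inv, h1, h2, h1.not_gt, h2.not_gt, h1.ne, h1.ne', ucross_eq_zero,
        unest_eq_zero, lcross_eq_zero, lnest_eq_zero]
    | simp [-Perm.coe_inv, h1, h2, ucross_eq_zero, unest_eq_zero, lcross_eq_zero, lnest_eq_zero]
  · by_cases h : unest σ i = 0 <;> simp [h] <;> ring
  · intro _; by_cases h : lnest σ i = 0 <;> simp [h] <;> ring
  · intro _; by_cases h : lnest σ i = 0 <;> simp [h] <;> ring
  · by_cases h : lnest σ i = 0 <;> simp [h] <;> ring
  · by_cases h : unest σ i = 0 <;> simp [h] <;> ring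
  · by_cases h : lev σ i = 0 <;> simp [h]
    all_goals ring

theorem wArec_eq (x y u v : R) : wArec x y u v = wArecPQ x y u v 1 1 1 1 := by
  ext n σ
  simp [wArecPQ]

end weights

end PermStat

/-! ### Identities for `pq`, `lin` and `starSum` -/

namespace CFrac
variable {R : Type*} [CommRing R]

theorem pq_succ (p q : R) (n : ℕ) : pq p q (n + 1) = p * pq p q n + q ^ n := by
  rw [pq, Finset.sum_range_succ', pq, Finset.mul_sum]
  congr 1
  · refine Finset.sum_congr rfl fun j _ => ?_
    rw [show n + 1 - 1 - (j + 1) = n - 1 - j by omega]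
    ring
  · simp

theorem pq_zero (p q : R) : pq p q 0 = 0 := by simp [pq]

theorem pq_one_one (n : ℕ) : pq (1 : R) 1 n = n := by simp [pq]

theorem lin_one (p q x u : R) : lin p q x u 1 = x := by simp [lin, pq]

/-- This recursion is what splits `γ` into two neighbouring S-coefficients in the contractions. -/
theorem lin_succ (p q x u : R) (n : ℕ) :
    lin p q x u (n + 2) = p * lin p q x u (n + 1) + q ^ (n + 1) * u := by
  simp only [lin, Nat.add_sub_cancel, show n + 2 - 1 = n + 1 by omega, pq_succ]
  ring

theorem lin_one_one (x u : R) (n : ℕ) : lin 1 1 x u (n + 1) = x + (((n + 1 : ℕ) : R) - 1) * u := by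
  simp [lin, pq_one_one]

theorem starSum_zero (a : ℕ → ℕ → R) : starSum a 0 = 0 := by simp [starSum]

theorem starSum_pow (p q : R) (n : ℕ) : starSum (fun j k => p ^ j * q ^ k) n = pq p q n := rfl

/-- Only the last term of the sum has second index `0`; the others share a factor `q * u`. -/
theorem starSum_lin (p q x u : R) (n : ℕ) :
    starSum (fun j k => p ^ j * q ^ k * if k = 0 then x else u) (n + 1) = lin p q x u (n + 1) := by
  rw [starSum, Finset.sum_range_succ, lin, pq, Finset.mul_sum, Finset.sum_mul, add_comm]
  congr 1
  · simp
  · refine Finset.sum_congr rfl fun j hj => ?_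
    rw [Finset.mem_range] at hj
    rw [if_neg (by omega), show n + 1 - 1 - j = n - 1 - j + 1 by omega]
    simp only [Nat.add_sub_cancel]
    ring

theorem starSum_mul_right (a : ℕ → ℕ → R) (r : R) (n : ℕ) :
    starSum (fun j k => a j k * r) n = starSum a n * r := by
  simp only [starSum, Finset.sum_mul]

theorem starSum_mul_left (a : ℕ → ℕ → R) (r : R) (n : ℕ) :
    starSum (fun j k => r * a j k) n = r * starSum a n := by
  simp only [starSum, Finset.mul_sum]

theorem naturalSum_const (f : ℕ → R) (n : ℕ) :
    naturalSum (fun j _ => f j) n = n * f (n - 1) := by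
  simp [naturalSum]

end CFrac

/-! ### The continued fractions for permutations -/

namespace PermStat
open Equiv CFrac

variable {R : Type*} [CommRing R]

theorem countsJ_cross (a b c d : ℕ → ℕ → R) (e : ℕ → R) :
    CountsJ cc (genWeight a b c (fun j k _ => d j k) e 1 1)
      (fun n => starSum c n + starSum d n + e n) (fun n => starSum a n * starSum b n) :=
  (decomposes_genWeight _ _ _ _ _ _ _).countsJ (gfCC_genWeight_of_cross a b c d e)

theorem countsS_cross {a b c d : ℕ → ℕ → R} {e : ℕ → R}
    (h : ∀ n, starSum c n + starSum d n + e n = starSum a n + starSum b (n + 1)) :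
    CountsS cc (genWeight a b c (fun j k _ => d j k) e 1 1) (oddEven (starSum b) (starSum a)) :=
  (countsJ_cross a b c d e).toOddEven (by rw [h, starSum_zero, zero_add]) (fun n => h (n + 1))
    fun n => mul_comm _ _

theorem countsS_cross' {a b c d : ℕ → ℕ → R} {e : ℕ → R}
    (h : ∀ n, starSum c n + starSum d n + e n = starSum b n + starSum a (n + 1)) :
    CountsS cc (genWeight a b c (fun j k _ => d j k) e 1 1) (oddEven (starSum a) (starSum b)) :=
  (countsJ_cross a b c d e).toOddEven (by rw [h, starSum_zero, zero_add]) (fun n => h (n + 1))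
    fun n => rfl

theorem countsJ_chain (a : ℕ → R) (b c d : ℕ → ℕ → R) (e : ℕ → R) (lam mu : R) :
    CountsJ cc (genWeight (fun j k => a (j + k)) b c (fun j k l => d (j + k) l) e lam mu)
      (fun n => starSum c n + naturalSum d n + lam * e n)
      (fun n => (lam + ((n : R) - 1) * mu) * a (n - 1) * starSum b n) :=
  (decomposes_genWeight _ _ _ _ _ _ _).countsJ (gfCC_genWeight_of_chain a b c d e lam mu)

theorem wMaster1_counts (a b c d : ℕ → ℕ → R) (e : ℕ → R) :
    Modifies cc (wMaster1 a b c d e) ∧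
    CountsJ cc (wMaster1 a b c d e)
      (fun n => starSum c n + starSum d n + e n) (fun n => starSum a n * starSum b n) ∧
    ((∀ n, starSum c n + starSum d n + e n = starSum a n + starSum b (n + 1)) →
      CountsS cc (wMaster1 a b c d e) (oddEven (starSum b) (starSum a))) ∧
    ((∀ n, starSum c n + starSum d n + e n = starSum b n + starSum a (n + 1)) →
      CountsS cc (wMaster1 a b c d e) (oddEven (starSum a) (starSum b))) := by
  rw [wMaster1_eq]
  exact ⟨(countsJ_cross a b c d e).decomposes.modifies, countsJ_cross a b c d e, countsS_cross,
    countsS_cross'⟩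

theorem wMaster2_counts (a : ℕ → R) (b c d : ℕ → ℕ → R) (e : ℕ → R) (lam : R) :
    Modifies cc (wMaster2 a b c d e lam) ∧
    CountsJ cc (wMaster2 a b c d e lam)
      (fun n => starSum c n + naturalSum d n + lam * e n)
      (fun n => (lam + (n : R) - 1) * a (n - 1) * starSum b n) ∧
    ((∀ n, e n = a n) →
      (∀ n, starSum c n + naturalSum d n = starSum b n + (n : R) * a n) →
      CountsS cc (wMaster2 a b c d e lam)
        (oddEven (fun k => (lam + (k : R) - 1) * a (k - 1)) (starSum b))) := by
  rw [wMaster2_eq]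
  have h := (countsJ_chain a b c d e lam 1).congr (fun _ => rfl)
    (β' := fun n => (lam + (n : R) - 1) * a (n - 1) * starSum b n) fun n => by ring
  refine ⟨h.decomposes.modifies, h, fun he hc => h.toOddEven ?_ (fun n => ?_) fun n => rfl⟩
  · rw [hc, he, starSum_zero]
    simp
  · rw [hc, he]
    push_cast
    ring

theorem wBig_counts (x₁ x₂ y₁ y₂ u₁ u₂ v₁ v₂ : R) (w : ℕ → R)
    (pp1 pp2 pm1 pm2 qp1 qp2 qm1 qm2 s : R) :
    Modifies cc (wBig x₁ x₂ y₁ y₂ u₁ u₂ v₁ v₂ w pp1 pp2 pm1 pm2 qp1 qp2 qm1 qm2 s) ∧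
    CountsJ cc (wBig x₁ x₂ y₁ y₂ u₁ u₂ v₁ v₂ w pp1 pp2 pm1 pm2 qp1 qp2 qm1 qm2 s)
      (fun n => if n = 0 then w 0 else
        lin pm2 qm2 x₂ u₂ n + lin pp2 qp2 y₂ v₂ n + s ^ n * w n)
      (fun n => lin pm1 qm1 x₁ u₁ n * lin pp1 qp1 y₁ v₁ n) := by
  rw [wBig_eq]
  refine ⟨(decomposes_genWeight _ _ _ _ _ _ _).modifies,
    (countsJ_cross _ _ _ (fun j k => pp2 ^ j * qp2 ^ k * if k = 0 then y₂ else v₂) _).congr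
      (fun n => ?_) fun n => ?_⟩
  · rcases n with _ | n
    · simp [starSum_zero]
    · simp only [starSum_lin, Nat.succ_ne_zero, if_false]
  · simp only [starSum_lin, mul_comm]

/-- With these parameters the double rises and fixed points at height `n ≥ 1` contribute `pp * lin
pp qp y v n + qp ^ n * v`, which is `lin pp qp y v (n + 1)`. -/
theorem wBig_countsS (x y u v pp pm qp qm : R) :
    CountsS cc
      (wBig x x y (pp * y) u u v (pp * v) (fun l => if l = 0 then y else v)
        pp pp pm pm qp qp qm qm qp)
      (oddEven (lin pp qp y v) (lin pm qm x u)) := by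
  refine (wBig_counts _ _ _ _ _ _ _ _ _ _ _ _ _ _ _ _ _ _).2.toOddEven ?_ (fun n => ?_)
    fun n => mul_comm _ _
  · simp [lin_one]
  · simp only [Nat.succ_ne_zero, if_false, lin_succ]
    simp only [lin]
    ring

theorem wBigHat_modifies (x₁ x₂ y₁ y₂ u₁ u₂ v₁ v₂ : R) (w : ℕ → R)
    (pp1 pp2 pm1 pm2 qp1 qp2 qm1 qm2 s lam : R) :
    Modifies cc (wBigHat x₁ x₂ y₁ y₂ u₁ u₂ v₁ v₂ w pp1 pp2 pm1 pm2 qp1 qp2 qm1 qm2 s lam) := by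
  rw [wBigHat_eq]
  exact (decomposes_genWeight _ _ _ _ _ _ _).modifies

/-- After the specialization, valleys and double rises see only the sum `ucross + unest`, as
`countsJ_chain` requires. -/
theorem wBigHat_countsJ (x₁ x₂ y₁ y₂ u₁ u₂ : R) (w : ℕ → R)
    (pp1 pp2 pm1 pm2 qm1 qm2 s lam : R) :
    CountsJ cc (wBigHat x₁ x₂ y₁ y₂ u₁ u₂ y₁ y₂ w pp1 pp2 pm1 pm2 pp1 pp2 qm1 qm2 s lam)
      (fun n => if n = 0 then lam * w 0 else
        lin pm2 qm2 x₂ u₂ n + (n : R) * pp2 ^ (n - 1) * y₂ + lam * s ^ n * w n)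
      (fun n => (lam + (n : R) - 1) * lin pm1 qm1 x₁ u₁ n * (pp1 ^ (n - 1) * y₁)) := by
  have h := countsJ_chain (fun n => pp1 ^ n * y₁)
    (fun j k => pm1 ^ j * qm1 ^ k * if k = 0 then x₁ else u₁)
    (fun j k => pm2 ^ j * qm2 ^ k * if k = 0 then x₂ else u₂) (fun j _ => pp2 ^ j * y₂)
    (fun l => s ^ l * w l) lam 1
  simp only [wBigHat_eq, ite_self, ← pow_add]
  refine h.congr (fun n => ?_) fun n => ?_
  · rcases n with _ | n
    · simp [starSum_zero, naturalSum]
    · simp only [starSum_lin, naturalSum_const, Nat.succ_ne_zero, if_false]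
      ring
  · simp only [starSum_lin]
    ring

theorem wBigHat_countsS (x y u pp pm qm lam : R) :
    CountsS cc
      (wBigHat x x y (pp * y) u u y (pp * y) (fun _ => y) pp pp pm pm pp pp qm qm pp lam)
      (oddEven (fun k => (lam + (k : R) - 1) * pp ^ (k - 1) * y) (lin pm qm x u)) := by
  refine (wBigHat_countsJ _ _ _ _ _ _ _ _ _ _ _ _ _ _ _).toOddEven ?_ (fun n => ?_) fun n => ?_
  · simp
  · simp only [Nat.succ_ne_zero, if_false, Nat.add_sub_cancel, show n + 2 - 1 = n + 1 by omega]
    push_cast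
    ring
  · ring

theorem wRecCyc_counts (x₁ x₂ y₁ y₂ u₁ u₂ v₁ v₂ : R) (w : ℕ → R) :
    Modifies cc (wRecCyc x₁ x₂ y₁ y₂ u₁ u₂ v₁ v₂ w) ∧
    CountsJ cc (wRecCyc x₁ x₂ y₁ y₂ u₁ u₂ v₁ v₂ w)
      (fun n => if n = 0 then w 0 else
        (x₂ + ((n : R) - 1) * u₂) + (y₂ + ((n : R) - 1) * v₂) + w n)
      (fun n => (x₁ + ((n : R) - 1) * u₁) * (y₁ + ((n : R) - 1) * v₁)) := by
  rw [wRecCyc_eq]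
  have h := wBig_counts x₁ x₂ y₁ y₂ u₁ u₂ v₁ v₂ w 1 1 1 1 1 1 1 1 1
  refine ⟨h.1, h.2.congr (fun n => ?_) fun n => ?_⟩
  · rcases n with _ | n
    · rfl
    · simp only [Nat.succ_ne_zero, if_false, lin_one_one, one_pow, one_mul]
  · simp only [lin_one_one]

theorem wRecCycHat_counts (x₁ x₂ y₁ y₂ u₁ u₂ v₁ v₂ : R) (w : ℕ → R) (lam : R) :
    Modifies cc (wRecCycHat x₁ x₂ y₁ y₂ u₁ u₂ v₁ v₂ w lam) ∧
    CountsJ cc (wRecCycHat x₁ x₂ y₁ y₂ u₁ u₂ y₁ y₂ w lam)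
      (fun n => if n = 0 then lam * w 0 else
        (x₂ + ((n : R) - 1) * u₂) + (n : R) * y₂ + lam * w n)
      (fun n => (lam + (n : R) - 1) * (x₁ + ((n : R) - 1) * u₁) * y₁) := by
  rw [wRecCycHat_eq, wRecCycHat_eq]
  refine ⟨wBigHat_modifies _ _ _ _ _ _ _ _ _ _ _ _ _ _ _ _ _ _ _,
    (wBigHat_countsJ _ _ _ _ _ _ _ _ _ _ _ _ _ _ _).congr (fun n => ?_) fun n => ?_⟩
  · rcases n with _ | n
    · rfl
    · simp only [Nat.succ_ne_zero, if_false, lin_one_one, one_pow, mul_one]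
  · simp only [lin_one_one, one_pow, one_mul]

theorem wPQ_counts (pp1 pp2 pm1 pm2 qp1 qp2 qm1 qm2 rp rm s : R) :
    Modifies cc (wPQ pp1 pp2 pm1 pm2 qp1 qp2 qm1 qm2 rp rm s) ∧
    CountsJ cc (wPQ pp1 pp2 pm1 pm2 qp1 qp2 qm1 qm2 rp rm s)
      (fun n => pq pp2 qp2 n * rp + pq pm2 qm2 n * rm + s ^ n)
      (fun n => pq pp1 qp1 n * pq pm1 qm1 n) := by
  rw [wPQ_eq]
  refine ⟨(decomposes_genWeight _ _ _ _ _ _ _).modifies,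
    (countsJ_cross _ _ _ (fun j k => pp2 ^ j * qp2 ^ k * rp) _).congr (fun n => ?_) fun n => rfl⟩
  simp only [starSum_mul_right, starSum_pow]
  ring

theorem wPQ_countsS (pp pm qp qm : R) :
    CountsS cc (wPQ pp pp pm pm qp qp qm qm 1 pm qm) (oddEven (pq pm qm) (pq pp qp)) ∧
    CountsS cc (wPQ pp pp pm pm qp qp qm qm pp 1 qp) (oddEven (pq pp qp) (pq pm qm)) := by
  constructor
  · refine (wPQ_counts _ _ _ _ _ _ _ _ _ _ _).2.toOddEven ?_ (fun n => ?_) fun n => ?_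
    · simp [pq_zero, pq_succ]
    · rw [pq_succ pm qm (n + 1)]; ring
    · ring
  · refine (wPQ_counts _ _ _ _ _ _ _ _ _ _ _).2.toOddEven ?_ (fun n => ?_) fun n => ?_
    · simp [pq_zero, pq_succ]
    · rw [pq_succ pp qp (n + 1)]; ring
    · ring

theorem wArecPQ_counts (x y u v pp pm qp qm : R) :
    Modifies cc (wArecPQ x y u v pp pm qp qm) ∧
    CountsS cc (wArecPQ x y u v pp pm qp qm) (oddEven (lin pm qm x u) (lin pp qp y v)) := by
  rw [wArecPQ_eq]
  refine ⟨(decomposes_genWeight _ _ _ _ _ _ _).modifies,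
    (countsS_cross (d := fun j k => pp ^ j * qp ^ k * if k = 0 then y else v) fun n => ?_).congr
      (fun n => starSum_lin _ _ _ _ _) fun n => starSum_lin _ _ _ _ _⟩
  rcases n with _ | n
  · simp [starSum]
  · simp only [starSum_mul_left, starSum_lin, lin_succ, Nat.succ_ne_zero, if_false]
    ring

theorem wArec_counts (x y u v : R) :
    Modifies cc (wArec x y u v) ∧
    CountsS cc (wArec x y u v)
      (oddEven (fun k => x + ((k : R) - 1) * u) (fun k => y + ((k : R) - 1) * v)) := by
  rw [wArec_eq]
  have h := wArecPQ_counts x y u v 1 1 1 1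
  exact ⟨h.1, h.2.congr (fun n => lin_one_one _ _ _) fun n => lin_one_one _ _ _⟩

/-- An index is a divider when no arc crosses the gap after it, and heights are invariant under
inversion. -/
theorem cc_inv {n : ℕ} (σ : Perm (Fin n)) : cc n σ⁻¹ = cc n σ := by
  have key : ∀ (ρ : Perm (Fin n)) (i : Fin n), (∀ j ≤ i, ρ j ≤ i) ↔ hgt ρ (i + 1) = 0 := by
    intro ρ i
    rw [hgt, Finset.card_eq_zero, Finset.filter_eq_empty_iff]
    simp only [Finset.mem_univ, forall_const, not_and, Nat.lt_succ_iff, Nat.succ_le_iff, not_lt]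
    rfl
  simp only [cc, key, hgt_inv]

theorem isRec_inv_iff {n : ℕ} (σ : Perm (Fin n)) (k : Fin n) : IsRec σ⁻¹ (σ k) ↔ IsArec σ k := by
  constructor
  · intro h l hl
    refine lt_of_le_of_ne (not_lt.mp fun h' => ?_) fun e => hl.ne (σ.injective e)
    have := h _ h'
    rw [inv_apply, inv_apply] at this
    exact hl.not_gt this
  · intro h l hl
    rw [inv_apply]
    refine lt_of_le_of_ne (not_lt.mp fun h' => ?_) fun e => hl.ne (by rw [← e, apply_inv])
    have := h _ h'
    rw [apply_inv] at this
    exact hl.not_gt this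

theorem erec_inv {n : ℕ} (σ : Perm (Fin n)) : erec σ⁻¹ = #{i | IsEarec σ i} := by
  rw [erec, card_filter_perm σ]
  congr 1
  ext k
  have h1 := isRec_inv_iff σ⁻¹ (σ k)
  rw [inv_inv, inv_apply] at h1
  simp only [Finset.mem_filter, Finset.mem_univ, true_and, IsErec, IsEarec, isRec_inv_iff, ← h1]

theorem exc_inv {n : ℕ} (σ : Perm (Fin n)) : exc σ⁻¹ = #{i | σ i < i} := by
  rw [exc, card_filter_perm σ]
  simp only [inv_apply]

theorem cyc_inv {n : ℕ} (σ : Perm (Fin n)) : cyc σ⁻¹ = cyc σ := by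
  rw [cyc, cyc, Perm.cycleType_inv]
  simp only [inv_eq_self_iff]

open Classical in
theorem sub_exc_inv_sub_cyc {n : ℕ} (σ : Perm (Fin n)) :
    n - #{i | σ i < i} - cyc σ
      = #{i | IsCdrise σ i} + #{i | IsCpeak σ i ∧ ¬ IsCycMax σ i} := by
  have h1 : (∑ i : Fin n, 1) = n := by simp
  have h2 : #{i | i < σ i} = #{i | σ⁻¹ i < i} := by
    rw [card_filter_perm σ fun i => σ⁻¹ i < i]
    simp only [inv_apply]
  -- This identity holds index by index, cycles being counted at their maxima; the two terms without
  -- counterpart in the claim are equal by `h2`.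
  have key : (∑ i : Fin n, 1) + #{i | σ⁻¹ i < i} = #{i | σ i < i} + cyc σ + #{i | IsCdrise σ i}
      + #{i | IsCpeak σ i ∧ ¬ IsCycMax σ i} + #{i | i < σ i} := by
    rw [cyc_eq]
    simp only [Finset.card_filter, ← Finset.sum_add_distrib]
    refine Finset.sum_congr rfl fun i _ => ?_
    have hm := fun h : IsCycMax σ i => h.apply_le
    have hm' := fun h : IsCycMax σ i => h.inv_le
    have hf := fun h : σ i = i => IsCycMax.of_fixed h
    have hi := lt_inv_or_of_ne σ (i := i)
    have he := inv_eq_self_iff σ i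
    simp only [IsCdrise, IsCpeak]
    grind
  omega

/-- In the weights treated by `chainCode` valleys have lost their nesting numbers, so exclusive
records are not visible there. Inversion turns them into exclusive antirecords, which the lower
nesting numbers show. The exponent of `u` then counts double rises and peaks that close no cycle,
whence `mu = u`. -/
theorem wCyc_inv (x y u v : R) {n : ℕ} (σ : Perm (Fin n)) :
    wCyc x y u v n σ⁻¹ = genWeight (fun _ _ => 1) (fun _ k => if k = 0 then y else v)
      (fun _ k => if k = 0 then y else v) (fun _ _ _ => u) (fun _ => 1) x u n σ := by
  classical
  have h1 : #{i | σ i < i} - #{i | IsEarec σ i} = #{i | σ i < i ∧ ¬ IsEarec σ i} :=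
    card_filter_sub fun i hi => ((isEarec_iff σ i).mp hi).1
  rw [wCyc, cyc_inv, erec_inv, exc_inv, h1, sub_exc_inv_sub_cyc, cyc_eq]
  simp only [pow_add, pow_card_filter, ← Finset.prod_mul_distrib, genWeight]
  refine Finset.prod_congr rfl fun i _ => ?_
  have hm := fun h : IsCycMax σ i => h.apply_le
  have hm' := fun h : IsCycMax σ i => h.inv_le
  simp only [isEarec_iff, IsCdrise, IsCpeak]
  apply locWeight_cases
  · intro h1 h2
    rw [if_neg fun h => (hm h).not_gt h1]
    simp [-Perm.coe_inv, h1.not_gt, h2.not_gt]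
  · intro h1 h2 h3
    by_cases h : lnest σ i = 0 <;> simp [-Perm.coe_inv, h1, h1.not_gt, h2, h3, h, mul_comm]
  · intro h1 h2 h3
    by_cases h : lnest σ i = 0 <;> simp [-Perm.coe_inv, h1, h1.not_gt, h2, h3, h, mul_comm]
  · intro h1 h2
    rw [if_neg fun h => (hm' h).not_gt h2]
    by_cases h : lnest σ i = 0 <;> simp [-Perm.coe_inv, h1, h1.not_gt, h2.not_gt, h]
  · intro h1 h2
    rw [if_neg fun h => (hm h).not_gt h1]
    simp [-Perm.coe_inv, h1, h1.not_gt, h2]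
  · intro h1 h2
    simp [-Perm.coe_inv, h1, h2, IsCycMax.of_fixed h1]

theorem wCyc_counts (x y u v : R) :
    Modifies cc (wCyc x y u v) ∧
    CountsS cc (wCyc x y u v)
      (oddEven (fun k => x + ((k : R) - 1) * u) (fun k => y + ((k : R) - 1) * v)) := by
  have h := countsJ_chain (fun _ => (1 : R)) (fun _ k => if k = 0 then y else v)
    (fun _ k => if k = 0 then y else v) (fun _ _ => u) (fun _ => 1) x u
  have hs : ∀ n, starSum (fun _ k => if k = 0 then y else v) (n + 1)
      = y + (((n + 1 : ℕ) : R) - 1) * v := by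
    intro n
    rw [← lin_one_one, ← starSum_lin]
    simp
  have h' : CountsJ cc (wCyc x y u v) _ _ :=
    ⟨fun ζ => (gfCC_congr (fun n => Equiv.inv (Perm (Fin n))) (fun n σ => cc_inv σ)
      (fun n σ => wCyc_inv x y u v σ) ζ).symm.trans (h.1 ζ),
    (gfIndec_congr (fun n => Equiv.inv (Perm (Fin n))) (fun n σ => cc_inv σ)
      (fun n σ => wCyc_inv x y u v σ)).symm.trans h.2⟩
  refine ⟨h'.decomposes.modifies, h'.toOddEven ?_ (fun n => ?_) fun n => ?_⟩
  · simp [starSum, naturalSum]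
  · simp only [hs, naturalSum_const]
    push_cast
    ring
  · simp only [hs]
    ring

end PermStat

/-! ## Set partitions -/

/-! ### Counting set partitions by adding the largest element -/

namespace PartStat
open CFrac

variable {n : ℕ}

theorem mem_part_iff (π : SetPart n) {i j : Fin n} : j ∈ π.part i ↔ π.part j = π.part i :=
  π.mem_part_iff_part_eq_part (mem_univ _) (mem_univ _)

theorem self_mem_part (π : SetPart n) (i : Fin n) : i ∈ π.part i :=
  π.mem_part_self.mpr (mem_univ _)

theorem parts_eq_image (π : SetPart n) : π.parts = univ.image π.part := by
  ext B
  rw [mem_image]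
  constructor
  · intro hB
    obtain ⟨i, hi⟩ := π.nonempty_of_mem_parts hB
    exact ⟨i, mem_univ _, π.part_eq_of_mem hB hi⟩
  · rintro ⟨i, _, rfl⟩
    exact π.part_mem.mpr (mem_univ _)

theorem ext_part {π ρ : SetPart n} (h : ∀ i j, j ∈ π.part i ↔ j ∈ ρ.part i) : π = ρ := by
  have : π.part = ρ.part := funext fun i => Finset.ext fun j => h i j
  exact Finpartition.ext (by rw [parts_eq_image, parts_eq_image, this])

/-- The partition into the fibres of a function. -/
def kerPart {β : Type*} [DecidableEq β] (f : Fin n → β) : SetPart n :=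
  haveI : DecidableRel (Setoid.ker f).r := fun i j => inferInstanceAs (Decidable (f i = f j))
  Finpartition.ofSetoid (Setoid.ker f)

theorem mem_part_kerPart {β : Type*} [DecidableEq β] (f : Fin n → β) {i j : Fin n} :
    j ∈ (kerPart f).part i ↔ f i = f j := by
  rw [kerPart]
  exact Finpartition.mem_part_ofSetoid_iff_rel

theorem card_parts_kerPart {β : Type*} [DecidableEq β] (f : Fin n → β) :
    #(kerPart f).parts = #(univ.image f) := by
  have : (univ.image f).image (fun b => univ.filter fun j => f j = b) = (kerPart f).parts := by
    rw [parts_eq_image, image_image]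
    refine image_congr fun i _ => ?_
    ext j
    rw [mem_part_kerPart, eq_comm]
    simp
  rw [← this, card_image_of_injOn]
  intro b hb b' _ h
  obtain ⟨i, _, rfl⟩ := mem_image.mp (mem_coe.mp hb)
  simpa using (Finset.ext_iff.mp h i).mp (by simp)

/-- The partition obtained by adding the largest element, to a given block or on its own. -/
def insertLast (s : Σ π : SetPart n, Option π.parts) : SetPart (n + 1) :=
  kerPart (Fin.snoc (α := fun _ => Option (Finset (Fin n))) (fun i => some (s.1.part i))
    (s.2.map Subtype.val))

/-- The restriction to the first `n` elements gives back `π`, and the block of the last element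
gives back the choice. -/
theorem insertLast_injective : Function.Injective (insertLast (n := n)) := by
  rintro ⟨π, o⟩ ⟨ρ, o'⟩ h
  have key : ∀ i j, (i ∈ (insertLast ⟨π, o⟩).part j) ↔ (i ∈ (insertLast ⟨ρ, o'⟩).part j) := by
    rw [h]; simp
  simp only [insertLast, mem_part_kerPart] at key
  have hπ : π = ρ := ext_part fun i j => by
    have := key j.castSucc i.castSucc
    simp only [Fin.snoc_castSucc, Option.some.injEq] at this
    rw [mem_part_iff, mem_part_iff, eq_comm, this, eq_comm]
  subst hπ
  refine Sigma.ext rfl (heq_of_eq ?_)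
  have hl : ∀ i, some (π.part i) = o.map Subtype.val ↔ some (π.part i) = o'.map Subtype.val := by
    intro i
    have := key (Fin.last n) i.castSucc
    simpa only [Fin.snoc_castSucc, Fin.snoc_last] using this
  have hmem : ∀ B : π.parts, ∃ i, π.part i = B.1 := fun B => by
    obtain ⟨i, hi⟩ := π.nonempty_of_mem_parts B.2
    exact ⟨i, π.part_eq_of_mem B.2 hi⟩
  refine Option.ext fun B => ?_
  obtain ⟨i, hi⟩ := hmem B
  have := hl i
  rw [hi] at this
  simp only [eq_comm (a := some B.1), Option.map_eq_some_iff] at this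
  constructor
  · intro hB
    obtain ⟨b, hb, hb'⟩ := this.mp ⟨B, hB, rfl⟩
    rwa [Subtype.ext hb'] at hb
  · intro hB
    obtain ⟨b, hb, hb'⟩ := this.mpr ⟨B, hB, rfl⟩
    rwa [Subtype.ext hb'] at hb

theorem card_insertLast (π : SetPart n) (o : Option π.parts) :
    #(insertLast ⟨π, o⟩).parts = if o = none then #π.parts + 1 else #π.parts := by
  rw [insertLast, card_parts_kerPart]
  have : (univ : Finset (Fin (n + 1))) = insert (Fin.last n) (univ.image Fin.castSucc) := by
    rw [← Finset.coe_inj]; simp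
  rw [this, image_insert, image_image]
  have h2 : univ.image ((Fin.snoc (α := fun _ => Option (Finset (Fin n)))
      (fun i => some (π.part i)) (o.map Subtype.val)) ∘ Fin.castSucc) = π.parts.image some := by
    have : univ.image (fun i => some (π.part i)) = π.parts.image some := by
      rw [parts_eq_image, image_image]
      rfl
    rw [← this]
    exact image_congr fun i _ => by simp
  rw [h2, Fin.snoc_last]
  have h3 : #(π.parts.image some) = #π.parts := card_image_of_injective _ (Option.some_injective _)
  rcases o with _ | B
  · rw [card_insert_of_notMem (by simp), h3, if_pos rfl]
  · rw [Option.map_some, insert_eq_of_mem (mem_image_of_mem _ B.2), h3, if_neg (by simp)]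

/-- The functional `F ↦ ∑ F |π|`, the sum being over the partitions of a set with `n` elements. -/
def blockSum : ℕ → (ℕ → ℕ) → ℕ
  | 0, F => F 0
  | n + 1, F => blockSum n fun k => F (k + 1) + k * F k

theorem blockSum_add (n : ℕ) (F G : ℕ → ℕ) :
    blockSum n (fun k => F k + G k) = blockSum n F + blockSum n G := by
  induction n generalizing F G with
  | zero => rfl
  | succ n ih =>
    rw [blockSum, blockSum, blockSum, ← ih]
    congr 1
    ext k
    ring

theorem blockSum_mul (n c : ℕ) (F : ℕ → ℕ) :
    blockSum n (fun k => c * F k) = c * blockSum n F := by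
  induction n generalizing F with
  | zero => rfl
  | succ n ih =>
    rw [blockSum, blockSum, ← ih]
    congr 1
    ext k
    ring

/-- An inequality suffices, because the code needs only at least as many partitions as words; so
`insertLast` need not be shown surjective. -/
theorem blockSum_le (n : ℕ) (F : ℕ → ℕ) : blockSum n F ≤ ∑ π : SetPart n, F #π.parts := by
  induction n generalizing F with
  | zero =>
    have h : #(kerPart id : SetPart 0).parts = 0 := by rw [card_parts_kerPart]; rfl
    have := single_le_sum (f := fun π : SetPart 0 => F #π.parts) (s := univ)
      (fun _ _ => Nat.zero_le _) (mem_univ (kerPart id))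
    rwa [h] at this
  | succ n ih =>
    calc blockSum (n + 1) F ≤ ∑ π : SetPart n, (F (#π.parts + 1) + #π.parts * F #π.parts) := ih _
      _ = ∑ s : Σ π : SetPart n, Option π.parts, F #(insertLast s).parts := by
        rw [Fintype.sum_sigma]
        refine sum_congr rfl fun π _ => ?_
        simp only [card_insertLast]
        rw [Fintype.sum_option]
        simp
      _ = ∑ π ∈ univ.image (insertLast (n := n)), F #π.parts :=
        (sum_image (f := fun π : SetPart (n + 1) => F #π.parts)
          (insertLast_injective (n := n)).injOn).symm
      _ ≤ _ := sum_le_sum_of_subset (subset_univ _)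

/-- The numbers obtained by choosing `h` blocks of a partition, `blockSum n (choose · h)`, satisfy
the path recurrence with weights `h + 1`, `h + 1`, `1`. -/
theorem coeff_jFrac_bell_le (n : ℕ) :
    PowerSeries.coeff n (jFrac (fun h => (h : ℤ) + 1) fun h => (h : ℤ))
      ≤ Fintype.card (SetPart n) := by
  have := MotzkinWord.motzkin_eq_jFrac (fun h => (h : ℤ) + 1) (fun h => (h : ℤ) + 1) (fun _ => 1)
    (fun n h => (blockSum n (fun k => k.choose h) : ℤ)) ?_ ?_ ?_ n
  · rw [show (jFrac (fun h => (h : ℤ) + 1) fun h => (h : ℤ))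
      = jFrac (fun h => (h : ℤ) + 1) fun h => ((h - 1 : ℕ) + 1 : ℤ) * 1 from
        PermStat.jFrac_congr (fun _ => rfl) fun n => by push_cast; simp]
    rw [← this]
    have := blockSum_le n fun k => k.choose 0
    simp only [Nat.choose_zero_right, sum_const, card_univ, smul_eq_mul, mul_one] at this
    simp only [Nat.choose_zero_right]
    exact_mod_cast this
  · rintro (_ | h) <;> simp [blockSum]
  · intro n
    rw [blockSum]
    have h2 : (fun k : ℕ => (k + 1).choose 0 + k * k.choose 0)
        = fun k => k.choose 1 + k.choose 0 := by
      ext k; simp; ring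
    rw [h2, blockSum_add]
    push_cast
    ring
  · intro n h
    rw [blockSum]
    have h2 : (fun k : ℕ => (k + 1).choose (h + 1) + k * k.choose (h + 1))
        = fun k => ((h + 2) * k.choose (h + 2) + (h + 2) * k.choose (h + 1)) + k.choose h := by
      ext k
      have e1 := Nat.choose_succ_right_eq k (h + 1)
      rw [Nat.choose_succ_succ]
      rcases le_or_gt (h + 1) k with hk | hk
      · obtain ⟨m, rfl⟩ := Nat.exists_eq_add_of_le hk
        rw [Nat.add_sub_cancel_left] at e1
        nlinarith
      · have z1 : k.choose (h + 1) = 0 := Nat.choose_eq_zero_of_lt hk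
        have z2 : k.choose (h + 2) = 0 := Nat.choose_eq_zero_of_lt (by omega)
        simp [z1, z2]
    rw [h2, blockSum_add, blockSum_add, blockSum_mul, blockSum_mul]
    push_cast
    ring

end PartStat

/-! ### Edges, blocks and heights of a set partition -/

namespace PartStat
open CFrac

variable {n : ℕ}

/-- `i` is not the smallest element of its block. -/
abbrev HasLeft (π : SetPart n) (i : Fin n) : Prop := ∃ j ∈ π.part i, j < i
/-- `i` is not the largest element of its block. -/
abbrev HasRight (π : SetPart n) (i : Fin n) : Prop := ∃ j ∈ π.part i, i < j

theorem mem_part_comm (π : SetPart n) {i j : Fin n} : j ∈ π.part i ↔ i ∈ π.part j := by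
  rw [mem_part_iff, mem_part_iff, eq_comm]

theorem mem_part_trans {π : SetPart n} {i j k : Fin n} (h : j ∈ π.part i) (h' : k ∈ π.part j) :
    k ∈ π.part i := by
  rw [mem_part_iff] at *
  exact h'.trans h

theorem two_le_card_part (π : SetPart n) (i : Fin n) :
    2 ≤ #(π.part i) ↔ HasLeft π i ∨ HasRight π i := by
  have hi := self_mem_part π i
  rw [Nat.succ_le_iff, Finset.one_lt_card]
  constructor
  · rintro ⟨a, ha, b, hb, hab⟩
    by_cases h : a = i
    · rcases lt_or_gt_of_ne (h ▸ hab) with h' | h'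
      · exact Or.inr ⟨b, hb, h'⟩
      · exact Or.inl ⟨b, hb, h'⟩
    · rcases lt_or_gt_of_ne h with h' | h'
      · exact Or.inl ⟨a, ha, h'⟩
      · exact Or.inr ⟨a, ha, h'⟩
  · rintro (⟨j, hj, h⟩ | ⟨j, hj, h⟩)
    · exact ⟨j, hj, i, hi, h.ne⟩
    · exact ⟨i, hi, j, hj, h.ne⟩

theorem isOpener_iff (π : SetPart n) (i : Fin n) :
    IsOpener π i ↔ HasRight π i ∧ ¬ HasLeft π i := by
  rw [IsOpener, two_le_card_part]
  simp only [HasLeft, HasRight, not_exists, not_and, not_lt]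
  grind

theorem isCloser_iff (π : SetPart n) (i : Fin n) :
    IsCloser π i ↔ ¬ HasRight π i ∧ HasLeft π i := by
  rw [IsCloser, two_le_card_part]
  simp only [HasLeft, HasRight, not_exists, not_and, not_lt]
  grind

theorem isInsider_iff (π : SetPart n) (i : Fin n) :
    IsInsider π i ↔ HasRight π i ∧ HasLeft π i := by
  rw [IsInsider, isOpener_iff, isCloser_iff]
  constructor
  · rintro ⟨h, h1, h2⟩
    rcases (two_le_card_part π i).mp (by omega) with h3 | h3
    · exact ⟨by_contra fun h4 => h2 ⟨h4, h3⟩, h3⟩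
    · exact ⟨h3, by_contra fun h4 => h1 ⟨h3, h4⟩⟩
  · rintro ⟨⟨a, ha, ha'⟩, b, hb, hb'⟩
    refine ⟨?_, fun h => h.2 ⟨b, hb, hb'⟩, fun h => h.1 ⟨a, ha, ha'⟩⟩
    rw [Nat.succ_le_iff, Finset.two_lt_card]
    exact ⟨a, ha, b, hb, i, self_mem_part π i, (hb'.trans ha').ne', ha'.ne', hb'.ne⟩

theorem isSingleton_iff (π : SetPart n) (i : Fin n) :
    IsSingleton π i ↔ ¬ HasRight π i ∧ ¬ HasLeft π i := by
  have := two_le_card_part π i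
  have h1 : 0 < #(π.part i) := card_pos.mpr ⟨i, self_mem_part π i⟩
  rw [IsSingleton, ← not_or, or_comm, ← this]
  omega

theorem Edge.hasRight {π : SetPart n} {i l : Fin n} (h : Edge π i l) : HasRight π i :=
  ⟨l, h.2.1, h.1⟩

theorem Edge.hasLeft {π : SetPart n} {i l : Fin n} (h : Edge π i l) : HasLeft π l :=
  ⟨i, (mem_part_comm π).mp h.2.1, h.1⟩

theorem Edge.eq_right {π : SetPart n} {i l l' : Fin n} (h : Edge π i l) (h' : Edge π i l') :
    l = l' :=
  le_antisymm (not_lt.mp fun hl => h.2.2 _ h'.2.1 ⟨h'.1, hl⟩)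
    (not_lt.mp fun hl => h'.2.2 _ h.2.1 ⟨h.1, hl⟩)

theorem Edge.eq_left {π : SetPart n} {i i' l : Fin n} (h : Edge π i l) (h' : Edge π i' l) :
    i = i' := by
  have h1 : i' ∈ π.part i := mem_part_trans h.2.1 ((mem_part_comm π).mp h'.2.1)
  have h2 : i ∈ π.part i' := (mem_part_comm π).mp h1
  exact le_antisymm (not_lt.mp fun hl => h'.2.2 _ h2 ⟨hl, h.1⟩)
    (not_lt.mp fun hl => h.2.2 _ h1 ⟨hl, h'.1⟩)

/-- A block with elements on both sides of a gap has an edge across it. -/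
theorem exists_edge (π : SetPart n) {a b j : Fin n} (hb : b ∈ π.part a) (haj : a ≤ j)
    (hjb : j < b) : ∃ a' l, a' ≤ j ∧ j < l ∧ Edge π a' l ∧ l ∈ π.part a := by
  obtain ⟨l, hl, hmin⟩ := exists_minimal (s := {k ∈ π.part a | j < k})
    ⟨b, by simp [hb, hjb]⟩
  obtain ⟨a', ha', hmax⟩ := exists_maximal (s := {k ∈ π.part a | k ≤ j})
    ⟨a, by simp [haj]⟩
  rw [mem_filter] at hl ha'
  refine ⟨a', l, ha'.2, hl.2, ⟨ha'.2.trans_lt hl.2,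
    mem_part_trans ((mem_part_comm π).mp ha'.1) hl.1, fun k hk hkk => ?_⟩, hl.1⟩
  have hka := mem_part_trans ha'.1 hk
  rcases le_or_gt k j with h | h
  · exact absurd (hmax (by simp [hka, h]) hkk.1.le) (not_le.mpr hkk.1)
  · exact absurd (hmin (by simp [hka, h]) hkk.2.le) (not_le.mpr hkk.2)

theorem HasRight.exists_edge {π : SetPart n} {i : Fin n} (h : HasRight π i) :
    ∃ l, Edge π i l := by
  obtain ⟨j, hj, hij⟩ := h
  obtain ⟨a, l, ha, hl, he, hla⟩ := PartStat.exists_edge π hj le_rfl hij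
  rcases ha.eq_or_lt with rfl | ha
  · exact ⟨l, he⟩
  · exact absurd ⟨ha, hl⟩ (he.2.2 i (mem_part_trans he.2.1 ((mem_part_comm π).mp hla)))

theorem HasLeft.exists_edge {π : SetPart n} {i : Fin n} (h : HasLeft π i) :
    ∃ j, Edge π j i := by
  obtain ⟨j, hj, hij⟩ := h
  obtain ⟨a, ha, hmax⟩ := exists_maximal (s := {k ∈ π.part i | k < i}) ⟨j, by simp [hj, hij]⟩
  rw [mem_filter] at ha
  refine ⟨a, ha.2, (mem_part_comm π).mp ha.1, fun k hk hkk => ?_⟩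
  exact absurd (hmax (by simp [mem_part_trans ha.1 hk, hkk.2]) hkk.1.le) (not_le.mpr hkk.1)

/-- The right ends of the edges above `i`. -/
def above (π : SetPart n) (i : Fin n) : Finset (Fin n) := {l | i < l ∧ ∃ j < i, Edge π j l}

theorem mem_above {π : SetPart n} {i l : Fin n} : l ∈ above π i ↔ i < l ∧ ∃ j < i, Edge π j l := by
  simp [above]

/-- A block has at most one edge above `i`, so edges above `i` may stand for blocks. -/
theorem eq_of_mem_above {π : SetPart n} {i l l' : Fin n} (h : l ∈ above π i)
    (h' : l' ∈ above π i) (hl : l' ∈ π.part l) : l = l' := by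
  obtain ⟨hil, a, hai, ha⟩ := mem_above.mp h
  obtain ⟨hil', b, hbi, hb⟩ := mem_above.mp h'
  have h1 := mem_part_trans ha.2.1 hl
  have h2 := mem_part_trans hb.2.1 ((mem_part_comm π).mp hl)
  exact le_antisymm (not_lt.mp fun h => ha.2.2 _ h1 ⟨hai.trans hil', h⟩)
    (not_lt.mp fun h => hb.2.2 _ h2 ⟨hbi.trans hil, h⟩)

theorem notMem_part_of_mem_above {π : SetPart n} {i l : Fin n} (h : l ∈ above π i) :
    l ∉ π.part i := by
  obtain ⟨hil, a, hai, ha⟩ := mem_above.mp h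
  exact fun hl => ha.2.2 i (mem_part_trans ha.2.1 ((mem_part_comm π).mp hl)) ⟨hai, hil⟩

theorem qne_eq (π : SetPart n) (i : Fin n) : qne π i = #(above π i) := by
  refine card_bij (fun t _ => t.2) ?_ ?_ ?_
  · rintro ⟨a, l⟩ h
    simp only [mem_filter, mem_univ, true_and] at h
    exact mem_above.mpr ⟨h.2.1, a, h.1, h.2.2⟩
  · rintro ⟨a, l⟩ h ⟨b, m⟩ h' rfl
    simp only [mem_filter, mem_univ, true_and] at h h'
    rw [h.2.2.eq_left h'.2.2]
  · intro l h
    obtain ⟨hil, a, hai, ha⟩ := mem_above.mp h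
    exact ⟨(a, l), by simp only [mem_filter, mem_univ, true_and]; exact ⟨hai, hil, ha⟩, rfl⟩

theorem cr_eq {π : SetPart n} {i m : Fin n} (hm : Edge π i m) :
    cr π i = #{l ∈ above π i | l < m} := by
  refine card_bij (fun t _ => t.2.1) ?_ ?_ ?_
  · rintro ⟨a, l, m'⟩ h
    simp only [mem_filter, mem_univ, true_and, mem_above] at h ⊢
    obtain rfl := hm.eq_right h.2.2.2.2
    exact ⟨⟨h.2.1, a, h.1, h.2.2.2.1⟩, h.2.2.1⟩
  · rintro ⟨a, l, m'⟩ h ⟨b, l', m''⟩ h' rfl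
    simp only [mem_filter, mem_univ, true_and] at h h'
    rw [h.2.2.2.1.eq_left h'.2.2.2.1, h.2.2.2.2.eq_right h'.2.2.2.2]
  · intro l h
    simp only [mem_filter, mem_above] at h
    obtain ⟨⟨hil, a, hai, ha⟩, hlm⟩ := h
    exact ⟨(a, l, m), by
      simp only [mem_filter, mem_univ, true_and]; exact ⟨hai, hil, hlm, ha, hm⟩, rfl⟩

theorem ne_eq {π : SetPart n} {i m : Fin n} (hm : Edge π i m) :
    ne π i = #{l ∈ above π i | m < l} := by
  refine card_bij (fun t _ => t.2.2) ?_ ?_ ?_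
  · rintro ⟨a, m', l⟩ h
    simp only [mem_filter, mem_univ, true_and, mem_above] at h ⊢
    obtain rfl := hm.eq_right h.2.2.2.2
    exact ⟨⟨h.2.1.trans h.2.2.1, a, h.1, h.2.2.2.1⟩, h.2.2.1⟩
  · rintro ⟨a, m', l⟩ h ⟨b, m'', l'⟩ h' rfl
    simp only [mem_filter, mem_univ, true_and] at h h'
    rw [h.2.2.2.1.eq_left h'.2.2.2.1, h.2.2.2.2.eq_right h'.2.2.2.2]
  · intro l h
    simp only [mem_filter, mem_above] at h
    obtain ⟨⟨hil, a, hai, ha⟩, hlm⟩ := h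
    exact ⟨(a, m, l), by
      simp only [mem_filter, mem_univ, true_and]; exact ⟨hai, hm.1, hlm, ha, hm⟩, rfl⟩

theorem cr_add_ne {π : SetPart n} {i : Fin n} (h : HasRight π i) :
    cr π i + ne π i = qne π i := by
  obtain ⟨m, hm⟩ := h.exists_edge
  rw [cr_eq hm, ne_eq hm, qne_eq, ← card_filter_add_card_filter_not (s := above π i) (· < m)]
  congr 2
  refine filter_congr fun l hl => ?_
  have : l ≠ m := by
    rintro rfl
    exact notMem_part_of_mem_above hl hm.2.1
  rw [not_lt]
  exact ⟨le_of_lt, fun h => lt_of_le_of_ne h this.symm⟩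

/-- The largest element of the block of `i`. -/
def top (π : SetPart n) (i : Fin n) : Fin n := (π.part i).max' ⟨i, self_mem_part π i⟩

theorem top_mem (π : SetPart n) (i : Fin n) : top π i ∈ π.part i := max'_mem _ _

theorem le_top {π : SetPart n} {i j : Fin n} (h : j ∈ π.part i) : j ≤ top π i := le_max' _ _ h

theorem top_eq {π : SetPart n} {i j : Fin n} (h : j ∈ π.part i) : top π j = top π i := by
  rw [mem_part_iff] at h
  simp only [top, h]

theorem top_eq_top_iff {π : SetPart n} {i j : Fin n} : top π j = top π i ↔ j ∈ π.part i := by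
  refine ⟨fun h => ?_, top_eq⟩
  have := top_mem π j
  rw [h] at this
  exact mem_part_trans (top_mem π i) ((mem_part_comm π).mp this)

theorem maxLT_part {π : SetPart n} {i j : Fin n} :
    MaxLT (π.part i) (π.part j) ↔ top π i < top π j := by
  constructor
  · rintro ⟨c, hc, h⟩
    exact (h _ (top_mem π i)).trans_le (le_top hc)
  · intro h
    exact ⟨_, top_mem π j, fun b hb => (le_top hb).trans_lt h⟩

/-- A block with elements on both sides of `i` but not containing `i` has exactly one edge above
`i`. The block of `i` has none, and `hp` removes it from the left side. -/
theorem card_straddling (π : SetPart n) (i : Fin n) (p : Finset (Fin n) → Prop)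
    [DecidablePred p] (hp : ¬ p (π.part i)) :
    #{B ∈ π.parts | MinBelow B i ∧ MaxAbove B i ∧ p B} = #{l ∈ above π i | p (π.part l)} := by
  symm
  refine card_bij (fun l _ => π.part l) ?_ ?_ ?_
  · intro l h
    simp only [mem_filter] at h ⊢
    obtain ⟨hil, a, hai, ha⟩ := mem_above.mp h.1
    exact ⟨π.part_mem.mpr (mem_univ _), ⟨a, (mem_part_comm π).mp ha.2.1, hai⟩,
      ⟨l, self_mem_part π l, hil⟩, h.2⟩
  · intro l h l' h' e
    simp only [mem_filter] at h h'
    exact eq_of_mem_above h.1 h'.1 ((mem_part_iff π).mpr e.symm)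
  · intro B h
    simp only [mem_filter] at h
    obtain ⟨hB, ⟨a, ha, hai⟩, ⟨b, hb, hib⟩, hpB⟩ := h
    obtain rfl := π.part_eq_of_mem hB ha
    obtain ⟨a', l, ha', hl, he, hla⟩ := exists_edge π hb hai.le hib
    have hpl : π.part l = π.part a := (mem_part_iff π).mp hla
    refine ⟨l, ?_, hpl⟩
    rw [mem_filter, mem_above, hpl]
    refine ⟨⟨hl, a', lt_of_le_of_ne ha' ?_, he⟩, hpB⟩
    rintro rfl
    exact hp (by rwa [← (mem_part_iff π).mp he.2.1, hpl])

theorem ovAt_eq (π : SetPart n) (i : Fin n) :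
    ovAt π i = #{l ∈ above π i | top π l < top π i} := by
  rw [ovAt, card_straddling π i (fun B => MaxLT B (π.part i)) (by rw [maxLT_part]; simp)]
  simp only [maxLT_part]

theorem covAt_eq {π : SetPart n} {i : Fin n} (h : HasRight π i) :
    covAt π i = #{l ∈ above π i | top π i < top π l} := by
  have h1 : covAt π i
      = #{B ∈ π.parts | MinBelow B i ∧ MaxAbove B i ∧ MaxLT (π.part i) B} := by
    refine congrArg card (filter_congr fun B hB => and_congr_right fun _ => ?_)
    constructor
    · rintro ⟨⟨b, hb, hib⟩, c, hc, h⟩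
      exact ⟨⟨c, hc, hib.trans (h b hb)⟩, c, hc, h⟩
    · exact fun h' => ⟨h, h'.2⟩
  rw [h1, card_straddling π i (fun B => MaxLT (π.part i) B) (by rw [maxLT_part]; simp)]
  simp only [maxLT_part]

theorem ovAt_add_covAt {π : SetPart n} {i : Fin n} (h : HasRight π i) :
    ovAt π i + covAt π i = qne π i := by
  rw [ovAt_eq, covAt_eq h, qne_eq,
    ← card_filter_add_card_filter_not (s := above π i) (top π · < top π i)]
  congr 2
  refine filter_congr fun l hl => ?_
  have : top π l ≠ top π i := fun h => notMem_part_of_mem_above hl (top_eq_top_iff.mp h)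
  rw [not_lt]
  exact ⟨le_of_lt, fun h => lt_of_le_of_ne h this.symm⟩

/-- The number of edges that cross the gap below the element with index `m`. -/
def hgt (π : SetPart n) (m : ℕ) : ℕ := #{l : Fin n | m ≤ l ∧ ∃ j : Fin n, (j : ℕ) < m ∧ Edge π j l}

theorem hgt_zero (π : SetPart n) : hgt π 0 = 0 := by simp [hgt]

theorem hgt_self (π : SetPart n) : hgt π n = 0 := by
  rw [hgt, card_eq_zero, filter_eq_empty_iff]
  intro l _ h
  exact absurd l.2 (not_lt.mpr h.1)

theorem hgt_eq (π : SetPart n) (i : Fin n) :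
    hgt π i = qne π i + if HasLeft π i then 1 else 0 := by
  rw [qne_eq]
  by_cases h : HasLeft π i
  · obtain ⟨j, hj⟩ := h.exists_edge
    rw [if_pos h, ← card_insert_of_notMem (s := above π i) (a := i) (by simp [mem_above])]
    refine congrArg card (Finset.ext fun l => ?_)
    simp only [mem_filter, mem_univ, true_and, mem_insert, mem_above, Fin.val_fin_lt,
      Fin.val_fin_le]
    constructor
    · rintro ⟨h1, h2⟩
      rcases h1.eq_or_lt with rfl | h1
      · exact Or.inl rfl
      · exact Or.inr ⟨h1, h2⟩
    · rintro (rfl | h')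
      · exact ⟨le_rfl, j, hj.1, hj⟩
      · exact ⟨h'.1.le, h'.2⟩
  · rw [if_neg h, add_zero]
    refine congrArg card (Finset.ext fun l => ?_)
    simp only [mem_filter, mem_univ, true_and, mem_above, Fin.val_fin_lt, Fin.val_fin_le]
    refine and_congr_left fun ⟨j, hj, he⟩ => ⟨fun h1 => lt_of_le_of_ne h1 ?_, le_of_lt⟩
    rintro rfl
    exact h he.hasLeft

theorem hgt_succ (π : SetPart n) (i : Fin n) :
    hgt π (i + 1) = qne π i + if HasRight π i then 1 else 0 := by
  rw [qne_eq]
  have hs : ∀ j : Fin n, (j : ℕ) < i + 1 ↔ j ≤ i := fun j => Nat.lt_succ_iff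
  have hs' : ∀ j : Fin n, (i : ℕ) + 1 ≤ j ↔ i < j := fun j => Nat.succ_le_iff
  by_cases h : HasRight π i
  · obtain ⟨m, hm⟩ := h.exists_edge
    rw [if_pos h, ← card_insert_of_notMem (s := above π i) (a := m)
      fun h => notMem_part_of_mem_above h hm.2.1]
    refine congrArg card (Finset.ext fun l => ?_)
    simp only [mem_filter, mem_univ, true_and, mem_insert, mem_above, hs, hs']
    constructor
    · rintro ⟨h1, j, hj, he⟩
      rcases hj.eq_or_lt with rfl | hj
      · exact Or.inl (he.eq_right hm)
      · exact Or.inr ⟨h1, j, hj, he⟩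
    · rintro (rfl | ⟨h1, j, hj, he⟩)
      · exact ⟨hm.1, i, le_rfl, hm⟩
      · exact ⟨h1, j, hj.le, he⟩
  · rw [if_neg h, add_zero]
    refine congrArg card (Finset.ext fun l => ?_)
    simp only [mem_filter, mem_univ, true_and, mem_above, hs, hs']
    refine and_congr_right fun _ => exists_congr fun j => and_congr_left fun he =>
      ⟨fun h1 => lt_of_le_of_ne h1 ?_, le_of_lt⟩
    rintro rfl
    exact h he.hasRight

/-- A divider has no edge across the gap after it, neither from itself nor from an earlier element.
Being a divider is thus visible in the local data of a closer or singleton. -/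
theorem cc_eq (π : SetPart n) : cc n π = #{i | ¬ HasRight π i ∧ qne π i = 0} := by
  refine congrArg card (filter_congr fun i _ => ?_)
  rw [qne_eq, card_eq_zero, eq_empty_iff_forall_notMem]
  constructor
  · intro h
    refine ⟨fun ⟨j, hj, hij⟩ => absurd (h i le_rfl j hj) (not_le.mpr hij), fun l hl => ?_⟩
    obtain ⟨hil, a, hai, ha⟩ := mem_above.mp hl
    exact absurd (h a hai.le l ha.2.1) (not_le.mpr hil)
  · rintro ⟨h1, h2⟩ j hj k hk
    by_contra hik
    obtain ⟨a, l, ha, hl, he, -⟩ := exists_edge π hk hj (not_le.mp hik)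
    rcases ha.eq_or_lt with rfl | ha
    · exact h1 he.hasRight
    · exact h2 l (mem_above.mpr ⟨hl, a, ha, he⟩)

end PartStat

/-! ### Extracting the indecomposable objects with dual numbers -/

namespace CFrac

variable {R R' : Type*} [CommRing R] [CommRing R']

theorem map_jTail (φ : R →+* R') (γ β : ℕ → R) (k : ℕ) :
    PowerSeries.map φ (jTail γ β k) = jTail (fun n => φ (γ n)) (fun n => φ (β n)) k := by
  refine eq_jTail _ _ (fun k => PowerSeries.map φ (jTail γ β k)) (fun k => ?_) k
  have := congrArg (PowerSeries.map φ) (jTail_spec γ β k)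
  simpa using this

variable {S : ℕ → Type} [∀ n, Fintype (S n)] {cc : ∀ n, S n → ℕ} {w : ∀ n, S n → R}

open DualNumber in
/-- The indecomposable objects are obtained by setting `ζ` to an element of square zero. -/
theorem CountsJ.of_dualNumber {γ β : ℕ → R}
    (h : ∀ ζ : R, gfCC cc w ζ
      = jFrac (Function.update γ 0 (ζ * γ 0)) (Function.update β 1 (ζ * β 1)))
    (hε : gfCC cc (fun n s => algebraMap R R[ε] (w n s)) ε
      = jFrac (Function.update (fun n => algebraMap R R[ε] (γ n)) 0 (ε * algebraMap R R[ε] (γ 0)))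
        (Function.update (fun n => algebraMap R R[ε] (β n)) 1 (ε * algebraMap R R[ε] (β 1)))) :
    CountsJ cc w γ β := by
  refine ⟨h, ?_⟩
  set φ := algebraMap R R[ε]
  set F := PowerSeries.C (γ 0) * PowerSeries.X
    + PowerSeries.C (β 1) * PowerSeries.X ^ 2 * jTail γ β 1 with hF
  -- The fraction with first level multiplied by `ε` is `1 / (1 - ε F)`, and this is `1 + ε F`
  -- because `ε² = 0`.
  have h1 : gfCC cc (fun n s => φ (w n s)) ε = 1 + PowerSeries.C ε * PowerSeries.map φ F := by
    rw [hε]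
    have h2 := jTail_spec (Function.update (fun n => φ (γ n)) 0 (ε * φ (γ 0)))
      (Function.update (fun n => φ (β n)) 1 (ε * φ (β 1))) 0
    rw [jTail_congr (k := 0 + 1) (γ' := fun n => φ (γ n)) (β' := fun n => φ (β n))
      (fun n hn => Function.update_of_ne (by omega) _ _)
      (fun n hn => Function.update_of_ne (by omega) _ _)] at h2
    have h3 : PowerSeries.C (ε : R[ε]) * PowerSeries.C ε = 0 := by
      rw [← map_mul, eps_mul_eps, map_zero]
    refine eq_of_left_inv (a := 1 - PowerSeries.C ε * PowerSeries.map φ F) ?_ ?_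
    · rw [← jFrac] at h2
      simp only [zero_add, Function.update_self, map_mul] at h2
      simp only [hF, map_add, map_mul, map_pow, PowerSeries.map_C, PowerSeries.map_X, map_jTail]
      linear_combination h2
    · linear_combination - PowerSeries.map φ F * PowerSeries.map φ F * h3
  ext n
  have h4 := congrArg (fun G => TrivSqZeroExt.snd (PowerSeries.coeff n G)) h1
  -- The `ε`-component of `ε^cc` times a weight from `R` selects exactly the objects with one
  -- component.
  have h5 : ∀ (k : ℕ) (r : R), TrivSqZeroExt.snd ((ε : R[ε]) ^ k * φ r) = if k = 1 then r else 0 := by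
    intro k r
    match k with
    | 0 => simp [φ, TrivSqZeroExt.algebraMap_eq_inl]
    | 1 => simp [φ, TrivSqZeroExt.algebraMap_eq_inl]
    | k + 2 => rw [pow_add, pow_two, eps_mul_eps]; simp
  have h6 := h5 1
  simp only [pow_one, if_true] at h6
  simp only [gfCC, PowerSeries.coeff_mk, TrivSqZeroExt.snd_sum, h5, map_add,
    PowerSeries.coeff_C_mul, PowerSeries.coeff_map, TrivSqZeroExt.snd_add, h6] at h4
  rw [gfIndec, PowerSeries.coeff_mk, sum_filter, h4, PowerSeries.coeff_one]
  split_ifs <;> simp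

end CFrac

/-! ### Set partitions as labelled words -/

namespace PartStat
open CFrac
open MotzkinWord

variable {n : ℕ}

/-- The first index of an opener or insider: overlaps if `b` holds, crossings otherwise. -/
def lab (b : Bool) (π : SetPart n) (i : Fin n) : ℕ := if b then ovAt π i else cr π i
/-- The second index of an opener or insider: coverings if `b` holds, nestings otherwise. -/
def colab (b : Bool) (π : SetPart n) (i : Fin n) : ℕ := if b then covAt π i else ne π i

theorem lab_add_colab (b : Bool) {π : SetPart n} {i : Fin n} (h : HasRight π i) :
    lab b π i + colab b π i = qne π i := by
  cases b
  · exact cr_add_ne h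
  · exact ovAt_add_covAt h

/-- The right ends of the edges above the gap that follows `i`. -/
def openEnds (π : SetPart n) (i : Fin n) : Finset (Fin n) :=
  {l | i < l ∧ HasLeft π l ∧ ∀ k ∈ π.part l, ¬ (i < k ∧ k < l)}

/-- The definition of `openEnds` refers only to elements beyond `i` and to `HasLeft`, so this set is
known before the block of `i` is reconstructed. -/
theorem openEnds_eq {π : SetPart n} {i m : Fin n} (hm : Edge π i m) :
    openEnds π i = insert m (above π i) := by
  ext l
  simp only [openEnds, mem_filter, mem_univ, true_and, mem_insert, mem_above]
  constructor
  · rintro ⟨hil, hl, h⟩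
    obtain ⟨j, hj⟩ := hl.exists_edge
    rcases lt_trichotomy j i with hji | rfl | hji
    · exact Or.inr ⟨hil, j, hji, hj⟩
    · exact Or.inl (hj.eq_right hm)
    · exact absurd ⟨hji, hj.1⟩ (h j ((mem_part_comm π).mp hj.2.1))
  · rintro (rfl | ⟨hil, j, hji, hj⟩)
    · exact ⟨hm.1, hm.hasLeft, fun k hk => hm.2.2 k (mem_part_trans hm.2.1 hk)⟩
    · exact ⟨hil, hj.hasLeft, fun k hk hkk =>
        hj.2.2 k (mem_part_trans hj.2.1 hk) ⟨hji.trans hkk.1, hkk.2⟩⟩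

theorem eq_of_mem_openEnds {π : SetPart n} {i l l' : Fin n} (h : l ∈ openEnds π i)
    (h' : l' ∈ openEnds π i) (hl : l' ∈ π.part l) : l = l' := by
  simp only [openEnds, mem_filter, mem_univ, true_and] at h h'
  exact le_antisymm (not_lt.mp fun hlt => h.2.2 _ hl ⟨h'.1, hlt⟩)
    (not_lt.mp fun hlt => h'.2.2 _ ((mem_part_comm π).mp hl) ⟨h.1, hlt⟩)

/-- The key by which the open ends are compared. -/
def key (b : Bool) (π : SetPart n) (l : Fin n) : Fin n := if b then top π l else l

/-- The label is the rank of the right neighbour of `i` among the open ends, ordered by position for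
crossings and by the maxima of their blocks for overlaps. -/
theorem lab_eq (b : Bool) {π : SetPart n} {i m : Fin n} (hm : Edge π i m) :
    lab b π i = #{l ∈ openEnds π i | key b π l < key b π m} := by
  rw [openEnds_eq hm, filter_insert, if_neg (lt_irrefl _)]
  cases b
  · exact cr_eq hm
  · rw [lab, if_pos rfl, ovAt_eq]
    simp only [key, if_true, top_eq hm.2.1]

/-- Both partitions have the same open ends after `i` with the same keys, so equal ranks give `i`
the same right neighbour; the rest of its block beyond `i` is known from `ih`. -/
theorem mem_part_iff_of_lab {b : Bool} {π ρ : SetPart n} {i : Fin n}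
    (hR : HasRight π i ↔ HasRight ρ i) (hL : ∀ k, HasLeft π k ↔ HasLeft ρ k)
    (hlab : HasRight π i → lab b π i = lab b ρ i)
    (ih : ∀ j k, i < j → i < k → (k ∈ π.part j ↔ k ∈ ρ.part j)) {k : Fin n} (hk : i < k) :
    k ∈ π.part i ↔ k ∈ ρ.part i := by
  by_cases h : HasRight π i
  · obtain ⟨m, hm⟩ := h.exists_edge
    obtain ⟨m', hm'⟩ := (hR.mp h).exists_edge
    have hO : openEnds ρ i = openEnds π i := by
      ext l
      simp only [openEnds, mem_filter, mem_univ, true_and]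
      refine and_congr_right fun hl => and_congr (hL l).symm ?_
      refine forall_congr' fun k => ?_
      constructor
      · exact fun h hk hkk => h ((ih l k hl hkk.1).mp hk) hkk
      · exact fun h hk hkk => h ((ih l k hl hkk.1).mpr hk) hkk
    -- The maximum of the block of `l` lies beyond `i`, hence in the range where the partitions
    -- agree.
    have hkey : ∀ l, i < l → key b ρ l = key b π l := by
      intro l hl
      cases b
      · rfl
      · have h1 := hl.trans_le (le_top (self_mem_part π l))
        have h2 := hl.trans_le (le_top (self_mem_part ρ l))
        exact le_antisymm (le_top ((ih l _ hl h2).mpr (top_mem ρ l)))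
          (le_top ((ih l _ hl h1).mp (top_mem π l)))
    have hmO : m ∈ openEnds π i := by rw [openEnds_eq hm]; simp
    have hmO' : m' ∈ openEnds π i := by rw [← hO, openEnds_eq hm']; simp
    have hlt : ∀ l ∈ openEnds π i, i < l := fun l hl => (mem_filter.mp hl).2.1
    have hinj : ∀ l ∈ openEnds π i, ∀ l' ∈ openEnds π i, key b π l = key b π l' → l = l' := by
      intro l hl l' hl' e
      cases b
      · exact e
      · exact eq_of_mem_openEnds hl hl' (top_eq_top_iff.mp (Eq.symm e))
    have hcard : ∀ p, #{x ∈ (openEnds π i).image (key b π) | x < p}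
        = #{l ∈ openEnds π i | key b π l < p} := by
      intro p
      rw [filter_image, card_image_of_injOn]
      intro l hl l' hl' e
      exact hinj l (mem_filter.mp hl).1 l' (mem_filter.mp hl').1 e
    have hmm : m = m' := by
      refine hinj m hmO m' hmO' ?_
      refine PermStat.eq_of_card_filter_lt_eq (mem_image_of_mem _ hmO) (mem_image_of_mem _ hmO') ?_
      rw [hcard, hcard, ← lab_eq b hm, hlab h, lab_eq b hm', hO, hkey m' hm'.1]
      exact congrArg card (filter_congr fun l hl => by rw [hkey l (hlt l hl)])
    subst hmm
    have e1 : π.part m = π.part i := (mem_part_iff π).mp hm.2.1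
    have e2 : ρ.part m = ρ.part i := (mem_part_iff ρ).mp hm'.2.1
    rw [← e1, ← e2]
    exact ih m k hm.1 hk
  · exact iff_of_false (fun hk' => h ⟨k, hk', hk⟩) fun hk' => h (hR.mpr ⟨k, hk', hk⟩)

/-- The labelled Motzkin word of a partition; `bo` and `bi` select the labels of the openers and
of the insiders. -/
def code (bo bi : Bool) (π : SetPart n) (i : Fin n) : Letter ℕ (Option ℕ) Unit :=
  if HasRight π i then
    if HasLeft π i then .inr (.inl (some (lab bi π i))) else .inl (lab bo π i)
  else if HasLeft π i then .inr (.inr ()) else .inr (.inl none)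

/-- The partition is rebuilt from right to left, each element being linked to its right neighbour.
Crossings and overlaps work alike, which allows an independent choice of labels for openers and
insiders. -/
theorem code_injective (bo bi : Bool) : Function.Injective (code (n := n) bo bi) := by
  intro π ρ h
  have hc : ∀ i, (HasRight π i ↔ HasRight ρ i) ∧ (HasLeft π i ↔ HasLeft ρ i) ∧
      (HasRight π i → lab (if HasLeft π i then bi else bo) π i
        = lab (if HasLeft π i then bi else bo) ρ i) := by
    intro i
    have := congrFun h i
    simp only [code] at this
    by_cases h1 : HasRight π i <;> by_cases h2 : HasLeft π i <;> by_cases h3 : HasRight ρ i <;>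
      by_cases h4 : HasLeft ρ i <;> simp only [h1, h2, h3, h4, if_true, if_false] at this ⊢ <;>
      simp_all
  have key : ∀ d : ℕ, ∀ i j : Fin n, n ≤ i + d → n ≤ j + d → (j ∈ π.part i ↔ j ∈ ρ.part i) := by
    intro d
    induction d with
    | zero => intro i j hi; exact absurd i.2 (not_lt.mpr hi)
    | succ d ih =>
      have step : ∀ i j : Fin n, n ≤ i + (d + 1) → i < j → (j ∈ π.part i ↔ j ∈ ρ.part i) := by
        intro i j hi hij
        refine mem_part_iff_of_lab (hc i).1 (fun k => (hc k).2.1) (hc i).2.2 ?_ hij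
        intro j k hj hk
        rw [Fin.lt_def] at hj hk
        exact ih j k (by omega) (by omega)
      intro i j hi hj
      rcases lt_trichotomy i j with hij | rfl | hij
      · exact step i j hi hij
      · simp
      · rw [mem_part_comm π, mem_part_comm ρ]
        exact step j i hj hij
  exact ext_part fun i j => key n i j (by omega) (by omega)

variable {R : Type*} [CommRing R]

/-- The common form of the weights of the master polynomials. -/
def genWeight (bo bi : Bool) (a : ℕ → ℕ → R) (b : ℕ → R) (d : ℕ → ℕ → R) (e : ℕ → R)
    (n : ℕ) (π : SetPart n) : R :=
  ∏ i, if HasRight π i then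
    if HasLeft π i then d (lab bi π i) (colab bi π i) else a (lab bo π i) (colab bo π i)
  else if HasLeft π i then b (qne π i) else e (qne π i)

theorem gfCC_genWeight_one (bo bi : Bool) (a : ℕ → ℕ → R) (b : ℕ → R) (d : ℕ → ℕ → R)
    (e : ℕ → R) :
    gfCC cc (genWeight bo bi a b d e) 1
      = jFrac (fun n => starSum d n + e n) (fun n => starSum a n * b (n - 1)) := by
  ext n
  rw [gfCC, PowerSeries.coeff_mk]
  have := sum_eq_coeff_jFrac (fun h => range (h + 1)) (fun h => insertNone (range h))
    (fun h => if h = 0 then ∅ else univ) (code (n := n) bo bi) hgt hgt_zero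
    hgt_self ?_ ?_ (code_injective bo bi) (by simp) ?_
    (fun h k => match k with
      | .inl l => a l (h - l)
      | .inr (.inl none) => e h
      | .inr (.inl (some l)) => d l (h - 1 - l)
      | .inr (.inr _) => b (h - 1))
  · simp only [one_pow, one_mul]
    refine Eq.trans ?_ (this.trans (congrArg _ (PermStat.jFrac_congr (fun n => ?_) fun n => ?_)))
    · refine Finset.sum_congr rfl fun π _ => Finset.prod_congr rfl fun i _ => ?_
      have h1 := hgt_eq π i
      have h2 := lab_add_colab bo (π := π) (i := i)
      have h3 := lab_add_colab bi (π := π) (i := i)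
      simp only [code]
      by_cases c1 : HasRight π i <;> by_cases c2 : HasLeft π i <;>
        simp only [c1, c2, if_true, if_false] at h1 ⊢ <;> simp only [h1]
      · rw [← h3 c1]; congr 1; omega
      · rw [← h2 c1]; congr 1; omega
      · simp
      · simp
    · simp only [Finset.sum_insertNone, starSum]
      ring
    · simp [starSum]
  · intro π i
    have h1 := hgt_eq π i
    have h2 := lab_add_colab bo (π := π) (i := i)
    have h3 := lab_add_colab bi (π := π) (i := i)
    simp only [code, allowed]
    by_cases c1 : HasRight π i <;> by_cases c2 : HasLeft π i <;>
      simp only [c1, c2, if_true, if_false] at h1 ⊢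
    · have := h3 c1
      simp
      omega
    · have := h2 c1
      simp
      omega
    · simp [h1]
    · simp
  · intro π i
    have h1 := hgt_eq π i
    have h2 := hgt_succ π i
    simp only [code]
    by_cases c1 : HasRight π i <;> by_cases c2 : HasLeft π i <;>
      simp only [c1, c2, if_true, if_false] at h1 h2 ⊢ <;> simp only [nextHeight] <;> omega
  -- There are `h + 1` level letters at height `h`, and `h` up letters at `h - 1` meet the single
  -- down letter at `h`.
  · refine le_trans (le_of_eq (congrArg _ (PermStat.jFrac_congr (fun n => ?_) fun n => ?_)))
      (coeff_jFrac_bell_le n)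
    · simp
    · simp

/-- Dividers are the closers and singletons with `qne = 0`, so the factor `ζ^cc` only changes `b 0`
and `e 0` and stays within the family of weights. -/
theorem pow_cc_mul_genWeight (bo bi : Bool) (a : ℕ → ℕ → R) (b : ℕ → R) (d : ℕ → ℕ → R)
    (e : ℕ → R) (ζ : R) (π : SetPart n) :
    ζ ^ cc n π * genWeight bo bi a b d e n π
      = genWeight bo bi a (Function.update b 0 (ζ * b 0)) d (Function.update e 0 (ζ * e 0)) n π := by
  rw [cc_eq, ← prod_const, prod_filter, genWeight, genWeight, ← prod_mul_distrib]
  refine prod_congr rfl fun i _ => ?_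
  by_cases c1 : HasRight π i <;> by_cases c2 : HasLeft π i <;> by_cases c3 : qne π i = 0 <;>
    simp [c1, c2, c3, -not_exists]

theorem gfCC_genWeight (bo bi : Bool) (a : ℕ → ℕ → R) (b : ℕ → R) (d : ℕ → ℕ → R)
    (e : ℕ → R) (ζ : R) :
    gfCC cc (genWeight bo bi a b d e) ζ
      = jFrac (Function.update (fun n => starSum d n + e n) 0 (ζ * (starSum d 0 + e 0)))
        (Function.update (fun n => starSum a n * b (n - 1)) 1 (ζ * (starSum a 1 * b 0))) := by
  have : gfCC cc (genWeight bo bi a b d e) ζ = gfCC cc (genWeight bo bi a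
      (Function.update b 0 (ζ * b 0)) d (Function.update e 0 (ζ * e 0))) 1 := by
    ext n
    simp only [gfCC, PowerSeries.coeff_mk, one_pow, one_mul, pow_cc_mul_genWeight]
  rw [this, gfCC_genWeight_one]
  refine PermStat.jFrac_congr ?_ ?_
  · rintro (_ | n)
    · simp [starSum_zero]
    · simp
  · rintro (_ | n)
    · simp; ring
    · simp

/-- The fraction is available over every commutative ring, in particular over the dual numbers with
`ζ = ε`. -/
theorem countsJ_genWeight (bo bi : Bool) (a : ℕ → ℕ → R) (b : ℕ → R) (d : ℕ → ℕ → R)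
    (e : ℕ → R) :
    CountsJ cc (genWeight bo bi a b d e)
      (fun n => starSum d n + e n) (fun n => starSum a n * b (n - 1)) := by
  refine CountsJ.of_dualNumber (gfCC_genWeight bo bi a b d e) ?_
  set φ := algebraMap R (DualNumber R)
  have h := gfCC_genWeight bo bi (fun j k => φ (a j k)) (fun k => φ (b k))
    (fun j k => φ (d j k)) (fun k => φ (e k)) DualNumber.eps
  have hs : ∀ (f : ℕ → ℕ → R) (n : ℕ), starSum (fun j k => φ (f j k)) n = φ (starSum f n) :=
    fun f n => by simp only [starSum, map_sum]
  have hw : (fun n s => φ (genWeight bo bi a b d e n s)) = genWeight bo bi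
      (fun j k => φ (a j k)) (fun k => φ (b k)) (fun j k => φ (d j k)) (fun k => φ (e k)) := by
    ext1 n; ext1 π
    simp only [genWeight, map_prod, apply_ite φ]
  simp only [hs, ← map_add, ← map_mul] at h
  rw [hw, h]

end PartStat

namespace CFrac
variable {R : Type*} [CommRing R]

theorem lin_mul_mul (r p q x u : R) (n : ℕ) :
    lin (r * p) (r * q) x u (n + 1) = r ^ n * lin p q x u (n + 1) := by
  induction n with
  | zero => simp [lin_one]
  | succ n ih => rw [lin_succ, ih, lin_succ]; ring

end CFrac

/-! ### Partition statistics as products of local weights, and their continued fractions -/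

namespace PartStat
open CFrac PermStat

variable {n : ℕ}

theorem isErec_iff (π : SetPart n) (i : Fin n) : IsErec π i ↔ HasRight π i ∧ ne π i = 0 := by
  constructor
  · rintro ⟨m, hm, h⟩
    refine ⟨hm.hasRight, ?_⟩
    rw [ne_eq hm, card_eq_zero, filter_eq_empty_iff]
    intro l hl
    obtain ⟨-, j, hj, he⟩ := mem_above.mp hl
    exact (h j hj l he).not_gt
  · rintro ⟨h, h'⟩
    obtain ⟨m, hm⟩ := h.exists_edge
    rw [ne_eq hm, card_eq_zero, filter_eq_empty_iff] at h'
    refine ⟨m, hm, fun j hj l he => ?_⟩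
    rcases le_or_gt l i with hl | hl
    · exact hl.trans_lt hm.1
    · refine lt_of_le_of_ne (not_lt.mp (h' (mem_above.mpr ⟨hl, j, hj, he⟩))) ?_
      rintro rfl
      exact hj.ne (he.eq_left hm)

theorem isBrec_iff (π : SetPart n) (i : Fin n) :
    IsBrec π i ↔ HasRight π i ∧ covAt π i = 0 := by
  rw [IsBrec, isOpener_iff, isInsider_iff, covAt, card_eq_zero, filter_eq_empty_iff]
  by_cases h1 : HasRight π i <;> by_cases h2 : HasLeft π i <;> simp [h1, h2]

theorem sum_parts_eq_sum_last {M : Type*} [AddCommMonoid M] (π : SetPart n)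
    (f : Finset (Fin n) → M) : ∑ B ∈ π.parts, f B = ∑ i with ¬ HasRight π i, f (π.part i) := by
  symm
  refine sum_bij (fun i _ => π.part i) (fun i _ => π.part_mem.mpr (mem_univ _)) ?_ ?_
    fun _ _ => rfl
  · intro i hi j hj h
    simp only [mem_filter, mem_univ, true_and, HasRight, not_exists, not_and, not_lt] at hi hj
    exact le_antisymm (hj i ((mem_part_iff π).mpr h)) (hi j ((mem_part_iff π).mpr h.symm))
  · intro B hB
    obtain ⟨i, hi⟩ := π.nonempty_of_mem_parts hB
    obtain rfl := π.part_eq_of_mem hB hi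
    refine ⟨top π i, ?_, (mem_part_iff π).mp (top_mem π i)⟩
    simp only [mem_filter, mem_univ, true_and, HasRight, not_exists, not_and, not_lt]
    intro j hj
    exact le_top (mem_part_trans (top_mem π i) hj)

theorem sum_parts_eq_sum_first {M : Type*} [AddCommMonoid M] (π : SetPart n)
    (f : Finset (Fin n) → M) : ∑ B ∈ π.parts, f B = ∑ i with ¬ HasLeft π i, f (π.part i) := by
  symm
  refine sum_bij (fun i _ => π.part i) (fun i _ => π.part_mem.mpr (mem_univ _)) ?_ ?_
    fun _ _ => rfl
  · intro i hi j hj h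
    simp only [mem_filter, mem_univ, true_and, HasLeft, not_exists, not_and, not_lt] at hi hj
    exact le_antisymm (hi j ((mem_part_iff π).mpr h.symm)) (hj i ((mem_part_iff π).mpr h))
  · intro B hB
    have hne := π.nonempty_of_mem_parts hB
    have hp := π.part_eq_of_mem hB (B.min'_mem hne)
    refine ⟨B.min' hne, ?_, hp⟩
    simp only [mem_filter, mem_univ, true_and, HasLeft, not_exists, not_and, not_lt, hp]
    exact fun j hj => min'_le _ _ hj

theorem card_parts_eq (π : SetPart n) : #π.parts = #{i | ¬ HasRight π i} := by
  rw [card_eq_sum_ones, sum_parts_eq_sum_last, ← card_eq_sum_ones]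

theorem m1_eq (π : SetPart n) : m1 π = #{i | ¬ HasRight π i ∧ ¬ HasLeft π i} := by
  rw [m1, card_filter, sum_parts_eq_sum_last, ← card_filter, filter_filter]
  refine congrArg card (filter_congr fun i _ => ?_)
  rw [← isSingleton_iff, and_iff_right_iff_imp]
  exact fun h => ((isSingleton_iff π i).mp h).1

theorem m2_eq (π : SetPart n) : m2 π = #{i | ¬ HasRight π i ∧ HasLeft π i} := by
  rw [m2, card_filter, sum_parts_eq_sum_last, ← card_filter, filter_filter]
  refine congrArg card (filter_congr fun i _ => and_congr_right fun h => ?_)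
  rw [two_le_card_part, or_iff_left h]

theorem minLT_part_iff {π : SetPart n} {i : Fin n} (hi : ¬ HasLeft π i) (B : Finset (Fin n)) :
    MinLT B (π.part i) ↔ MinBelow B i := by
  simp only [HasLeft, not_exists, not_and, not_lt] at hi
  exact exists_congr fun c => and_congr_right fun _ =>
    ⟨fun h => h i (self_mem_part π i), fun h b hb => h.trans_le (hi b hb)⟩

theorem card_pairs_eq (π : SetPart n) (p : Finset (Fin n) → Finset (Fin n) → Prop)
    [∀ B B', Decidable (p B B')] :
    #{P ∈ π.parts ×ˢ π.parts | p P.1 P.2}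
      = ∑ i with ¬ HasLeft π i, #{B ∈ π.parts | p B (π.part i)} := by
  rw [card_filter, sum_product_right, sum_parts_eq_sum_first]
  simp only [card_filter]

/-- A pair of blocks is counted at the smallest element of the second block; an overlap forces this
element to be an opener. -/
theorem ov_eq (π : SetPart n) : ov π = ∑ i with HasRight π i ∧ ¬ HasLeft π i, ovAt π i := by
  rw [ov, card_pairs_eq π (fun B B' => MinLT B B' ∧ (∃ a ∈ B', ∃ b ∈ B, a < b) ∧ MaxLT B B')]
  have h : ∀ i ∈ ({i | ¬ HasLeft π i} : Finset (Fin n)),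
      #{B ∈ π.parts | MinLT B (π.part i) ∧ (∃ a ∈ π.part i, ∃ b ∈ B, a < b) ∧ MaxLT B (π.part i)}
        = if HasRight π i then ovAt π i else 0 := by
    intro i hi
    have hi' : ¬ HasLeft π i := (mem_filter.mp hi).2
    have h1 : #{B ∈ π.parts | MinLT B (π.part i) ∧ (∃ a ∈ π.part i, ∃ b ∈ B, a < b) ∧
        MaxLT B (π.part i)} = ovAt π i := by
      refine congrArg card (filter_congr fun B _ => ?_)
      rw [minLT_part_iff hi']
      simp only [HasLeft, not_exists, not_and, not_lt] at hi'
      refine and_congr_right fun _ => and_congr_left fun _ => ?_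
      constructor
      · rintro ⟨a, ha, b, hb, hab⟩
        exact ⟨b, hb, (hi' a ha).trans_lt hab⟩
      · rintro ⟨b, hb, hib⟩
        exact ⟨i, self_mem_part π i, b, hb, hib⟩
    rw [h1]
    split_ifs with h
    · rfl
    · rw [ovAt, card_eq_zero, filter_eq_empty_iff]
      rintro B _ ⟨_, ⟨b, hb, hib⟩, c, hc, hbc⟩
      exact h ⟨c, hc, hib.trans (hbc b hb)⟩
  rw [sum_congr rfl h, ← sum_filter, filter_filter]
  simp only [and_comm]

theorem card_covering (π : SetPart n) (i : Fin n) :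
    #{B ∈ π.parts | MinBelow B i ∧ MaxLT (π.part i) B} = #{l ∈ above π i | top π i < top π l} := by
  have h : #{B ∈ π.parts | MinBelow B i ∧ MaxLT (π.part i) B}
      = #{B ∈ π.parts | MinBelow B i ∧ MaxAbove B i ∧ MaxLT (π.part i) B} := by
    refine congrArg card (filter_congr fun B _ => and_congr_right fun _ => ?_)
    exact ⟨fun h => ⟨h.imp fun c hc => ⟨hc.1, hc.2 i (self_mem_part π i)⟩, h⟩, fun h => h.2⟩
  rw [h, card_straddling π i (fun B => MaxLT (π.part i) B) (by rw [maxLT_part]; simp)]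
  simp only [maxLT_part]

theorem cov_eq (π : SetPart n) : cov π = ∑ i with HasRight π i ∧ ¬ HasLeft π i, covAt π i := by
  rw [cov, card_pairs_eq π (fun B B' => MinLT B B' ∧ 2 ≤ #B' ∧ MaxLT B' B)]
  have h : ∀ i ∈ ({i | ¬ HasLeft π i} : Finset (Fin n)),
      #{B ∈ π.parts | MinLT B (π.part i) ∧ 2 ≤ #(π.part i) ∧ MaxLT (π.part i) B}
        = if HasRight π i then covAt π i else 0 := by
    intro i hi
    have hi' : ¬ HasLeft π i := (mem_filter.mp hi).2
    simp only [minLT_part_iff hi', two_le_card_part, or_iff_right hi']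
    split_ifs with h
    · simp only [h, true_and]
      rw [card_covering, covAt_eq h]
    · simp [h, -not_exists]
  rw [sum_congr rfl h, ← sum_filter, filter_filter]
  simp only [and_comm]

theorem pscov_eq (π : SetPart n) :
    pscov π = ∑ i with ¬ HasRight π i ∧ ¬ HasLeft π i, qne π i := by
  rw [pscov, card_pairs_eq π (fun B B' => MinLT B B' ∧ #B' = 1 ∧ MaxLT B' B)]
  have h : ∀ i ∈ ({i | ¬ HasLeft π i} : Finset (Fin n)),
      #{B ∈ π.parts | MinLT B (π.part i) ∧ #(π.part i) = 1 ∧ MaxLT (π.part i) B}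
        = if ¬ HasRight π i then qne π i else 0 := by
    intro i hi
    have hi' : ¬ HasLeft π i := (mem_filter.mp hi).2
    have h1 : #(π.part i) = 1 ↔ ¬ HasRight π i :=
      (isSingleton_iff π i).trans (and_iff_left hi')
    simp only [minLT_part_iff hi', h1]
    by_cases h : HasRight π i
    · simp [h, -not_exists]
    · simp only [h, not_false_eq_true, true_and, if_true]
      rw [card_covering, qne_eq, filter_true_of_mem]
      intro l hl
      refine lt_of_le_of_lt ?_ ((mem_above.mp hl).1.trans_le (le_top (self_mem_part π l)))
      exact not_lt.mp fun hlt => h ⟨_, top_mem π i, hlt⟩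
  rw [sum_congr rfl h, ← sum_filter, filter_filter]
  simp only [and_comm]

variable {R : Type*} [CommRing R]

theorem prod_filter_eq_genWeight (bo bi : Bool) (a : ℕ → ℕ → R) (b : ℕ → R) (d : ℕ → ℕ → R)
    (e : ℕ → R) (π : SetPart n) :
    (∏ i with IsOpener π i, a (lab bo π i) (colab bo π i)) * (∏ i with IsCloser π i, b (qne π i))
      * (∏ i with IsInsider π i, d (lab bi π i) (colab bi π i))
      * ∏ i with IsSingleton π i, e (qne π i) = genWeight bo bi a b d e n π := by
  simp only [Finset.prod_filter, ← Finset.prod_mul_distrib, genWeight]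
  refine Finset.prod_congr rfl fun i _ => ?_
  simp only [isOpener_iff, isCloser_iff, isInsider_iff, isSingleton_iff]
  by_cases c1 : HasRight π i <;> by_cases c2 : HasLeft π i <;> simp [c1, c2, -not_exists]

theorem wMaster1_eq (a : ℕ → ℕ → R) (b : ℕ → R) (d : ℕ → ℕ → R) (e : ℕ → R) :
    wMaster1 a b d e = genWeight false false a b d e :=
  funext fun _ => funext fun π => prod_filter_eq_genWeight false false a b d e π

theorem wMaster2_eq (a : ℕ → ℕ → R) (b : ℕ → R) (d : ℕ → ℕ → R) (e : ℕ → R) :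
    wMaster2 a b d e = genWeight true true a b d e :=
  funext fun _ => funext fun π => prod_filter_eq_genWeight true true a b d e π

theorem wMaster3_eq (a : ℕ → ℕ → R) (b : ℕ → R) (d : ℕ → ℕ → R) (e : ℕ → R) :
    wMaster3 a b d e = genWeight true false a b d e :=
  funext fun _ => funext fun π => prod_filter_eq_genWeight true false a b d e π

theorem wMaster4_eq (a : ℕ → ℕ → R) (b : ℕ → R) (d : ℕ → ℕ → R) (e : ℕ → R) :
    wMaster4 a b d e = genWeight false true a b d e :=
  funext fun _ => funext fun π => prod_filter_eq_genWeight false true a b d e π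

theorem wCrNe_eq (x₁ x₂ y₁ y₂ v₁ v₂ p₁ p₂ q₁ q₂ r : R) :
    wCrNe x₁ x₂ y₁ y₂ v₁ v₂ p₁ p₂ q₁ q₂ r
      = genWeight false false (fun j k => p₂ ^ j * q₂ ^ k * if k = 0 then y₂ else v₂) (fun _ => x₂)
          (fun j k => p₁ ^ j * q₁ ^ k * if k = 0 then y₁ else v₁) (fun k => r ^ k * x₁) := by
  ext n π
  simp only [wCrNe, wErecInOp, m1_eq, m2_eq, erecin, erecop, nerecin, nerecop, crin, crop, nein,
    neop, psne, pow_card_filter, pow_sum_filter, ← Finset.prod_mul_distrib, genWeight]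
  refine Finset.prod_congr rfl fun i _ => ?_
  simp only [isOpener_iff, isInsider_iff, isSingleton_iff, isErec_iff, lab, colab]
  by_cases c1 : HasRight π i <;> by_cases c2 : HasLeft π i <;> by_cases c3 : ne π i = 0 <;>
    simp [c1, c2, c3, -not_exists] <;> ring

theorem wOvCov_eq (x₁ x₂ y₁ y₂ v₁ v₂ p₁ p₂ q₁ q₂ r : R) :
    wOvCov x₁ x₂ y₁ y₂ v₁ v₂ p₁ p₂ q₁ q₂ r
      = genWeight true true (fun j k => p₂ ^ j * q₂ ^ k * if k = 0 then y₂ else v₂) (fun _ => x₂)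
          (fun j k => p₁ ^ j * q₁ ^ k * if k = 0 then y₁ else v₁) (fun k => r ^ k * x₁) := by
  ext n π
  simp only [wOvCov, m1_eq, m2_eq, brecin, brecop, nbrecin, nbrecop, ovin, ov_eq, covin, cov_eq,
    pscov_eq, pow_card_filter, pow_sum_filter, ← Finset.prod_mul_distrib, genWeight]
  refine Finset.prod_congr rfl fun i _ => ?_
  simp only [isOpener_iff, isInsider_iff, isBrec_iff, lab, colab]
  by_cases c1 : HasRight π i <;> by_cases c2 : HasLeft π i <;> by_cases c3 : covAt π i = 0 <;>
    simp [c1, c2, c3, -not_exists] <;> ring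

/-- Exactly `n - |π|` elements have a right neighbour, and an exclusive record is one of them with
nesting number `0`; this resolves the truncated exponent of `v`. -/
theorem wErec_eq (x y v : R) :
    wErec x y v = genWeight false false (fun _ k => if k = 0 then y else v) (fun _ => x)
      (fun _ k => if k = 0 then y else v) (fun _ => x) := by
  ext n π
  have h1 : #({i | HasRight π i} : Finset (Fin n)) + #π.parts = n := by
    rw [card_parts_eq, card_filter_add_card_filter_not, card_univ, Fintype.card_fin]
  have h2 : n - #π.parts - erec π = #{i | HasRight π i ∧ ¬ ne π i = 0} := by
    have := card_filter_add_card_filter_not (s := ({i | HasRight π i} : Finset (Fin n)))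
      (fun i => ne π i = 0)
    rw [filter_filter, filter_filter] at this
    simp only [erec, isErec_iff]
    omega
  rw [wErec, h2]
  simp only [card_parts_eq, erec, isErec_iff, pow_card_filter, ← Finset.prod_mul_distrib,
    genWeight]
  refine Finset.prod_congr rfl fun i _ => ?_
  by_cases c1 : HasRight π i <;> by_cases c2 : HasLeft π i <;> by_cases c3 : ne π i = 0 <;>
    simp [c1, c2, c3, colab, -not_exists]

theorem countsS_genWeight {bo bi : Bool} {a : ℕ → ℕ → R} {b : ℕ → R} {d : ℕ → ℕ → R} {e : ℕ → R}
    (h : ∀ n, starSum d n + e n = starSum a n + b n) :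
    CountsS cc (genWeight bo bi a b d e) (oddEven (fun k => b (k - 1)) (starSum a)) :=
  (countsJ_genWeight bo bi a b d e).toOddEven (by rw [h, starSum_zero, zero_add])
    (fun n => h (n + 1)) fun n => mul_comm _ _

theorem wMaster_counts (a : ℕ → ℕ → R) (b : ℕ → R) (d : ℕ → ℕ → R) (e : ℕ → R) :
    ∀ wt ∈ ({wMaster1 a b d e, wMaster2 a b d e, wMaster3 a b d e, wMaster4 a b d e} :
        Set (∀ n, SetPart n → R)),
      Modifies cc wt ∧
      CountsJ cc wt (fun n => starSum d n + e n) (fun n => starSum a n * b (n - 1)) ∧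
      ((∀ n, starSum d n + e n = starSum a n + b n) →
        CountsS cc wt (oddEven (fun k => b (k - 1)) (starSum a))) := by
  rintro wt (rfl | rfl | rfl | rfl)
  on_goal 1 => rw [wMaster1_eq]
  on_goal 2 => rw [wMaster2_eq]
  on_goal 3 => rw [wMaster3_eq]
  on_goal 4 => rw [wMaster4_eq]
  all_goals exact ⟨(countsJ_genWeight _ _ a b d e).decomposes.modifies,
    countsJ_genWeight _ _ a b d e, countsS_genWeight⟩

theorem countsJ_genWeight_lin (bo bi : Bool) (x₁ x₂ y₁ y₂ v₁ v₂ p₁ p₂ q₁ q₂ r : R) :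
    CountsJ cc (genWeight bo bi (fun j k => p₂ ^ j * q₂ ^ k * if k = 0 then y₂ else v₂)
        (fun _ => x₂) (fun j k => p₁ ^ j * q₁ ^ k * if k = 0 then y₁ else v₁)
        (fun k => r ^ k * x₁))
      (fun n => if n = 0 then x₁ else r ^ n * x₁ + lin p₁ q₁ y₁ v₁ n)
      (fun n => x₂ * lin p₂ q₂ y₂ v₂ n) := by
  refine (countsJ_genWeight _ _ _ _ _ _).congr (fun n => ?_) fun n => ?_
  · rcases n with _ | n
    · simp [starSum_zero]
    · simp only [starSum_lin, Nat.succ_ne_zero, if_false, add_comm]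
  · simp only [starSum_lin, mul_comm]

/-- The factor `r` common to both parameters of `lin` comes out as a power of `r`, which is the one
that `β` needs to split as the product of two S-coefficients. -/
theorem countsS_of_countsJ_lin {w : ∀ n, SetPart n → R} {x y v p q r : R}
    (h : CountsJ cc w (fun n => if n = 0 then x else r ^ n * x + lin p q y v n)
      (fun n => x * lin (r * p) (r * q) y v n)) :
    CountsS cc w (oddEven (fun k => r ^ (k - 1) * x) (lin p q y v)) := by
  refine h.toOddEven (by simp) (fun n => ?_) fun n => ?_
  · simp only [Nat.succ_ne_zero, if_false, show n + 2 - 1 = n + 1 by omega, add_comm]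
  · simp only [lin_mul_mul, Nat.add_sub_cancel]
    ring

theorem wCrNe_counts (x₁ x₂ y₁ y₂ v₁ v₂ p₁ p₂ q₁ q₂ r : R) :
    Modifies cc (wCrNe x₁ x₂ y₁ y₂ v₁ v₂ p₁ p₂ q₁ q₂ r) ∧
    CountsJ cc (wCrNe x₁ x₂ y₁ y₂ v₁ v₂ p₁ p₂ q₁ q₂ r)
      (fun n => if n = 0 then x₁ else r ^ n * x₁ + lin p₁ q₁ y₁ v₁ n)
      (fun n => x₂ * lin p₂ q₂ y₂ v₂ n) := by
  rw [wCrNe_eq]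
  have h := countsJ_genWeight_lin false false x₁ x₂ y₁ y₂ v₁ v₂ p₁ p₂ q₁ q₂ r
  exact ⟨h.decomposes.modifies, h⟩

theorem wOvCov_counts (x₁ x₂ y₁ y₂ v₁ v₂ p₁ p₂ q₁ q₂ r : R) :
    Modifies cc (wOvCov x₁ x₂ y₁ y₂ v₁ v₂ p₁ p₂ q₁ q₂ r) ∧
    CountsJ cc (wOvCov x₁ x₂ y₁ y₂ v₁ v₂ p₁ p₂ q₁ q₂ r)
      (fun n => if n = 0 then x₁ else r ^ n * x₁ + lin p₁ q₁ y₁ v₁ n)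
      (fun n => x₂ * lin p₂ q₂ y₂ v₂ n) := by
  rw [wOvCov_eq]
  have h := countsJ_genWeight_lin true true x₁ x₂ y₁ y₂ v₁ v₂ p₁ p₂ q₁ q₂ r
  exact ⟨h.decomposes.modifies, h⟩

theorem wErecInOp_eq (x₁ x₂ y₁ y₂ v₁ v₂ : R) :
    wErecInOp x₁ x₂ y₁ y₂ v₁ v₂ = wCrNe x₁ x₂ y₁ y₂ v₁ v₂ 1 1 1 1 1 := by
  ext n π
  simp [wCrNe]

theorem wErecInOp_counts (x₁ x₂ y₁ y₂ v₁ v₂ : R) :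
    Modifies cc (wErecInOp x₁ x₂ y₁ y₂ v₁ v₂) ∧
    CountsJ cc (wErecInOp x₁ x₂ y₁ y₂ v₁ v₂)
      (fun n => if n = 0 then x₁ else x₁ + y₁ + ((n : R) - 1) * v₁)
      (fun n => x₂ * (y₂ + ((n : R) - 1) * v₂)) := by
  rw [wErecInOp_eq]
  have h := wCrNe_counts x₁ x₂ y₁ y₂ v₁ v₂ 1 1 1 1 1
  refine ⟨h.1, h.2.congr (fun n => ?_) fun n => ?_⟩
  · rcases n with _ | n
    · rfl
    · simp only [Nat.succ_ne_zero, if_false, lin_one_one, one_pow]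
      ring
  · simp only [lin_one_one]

theorem wErec_counts (x y v : R) :
    Modifies cc (wErec x y v) ∧
    CountsS cc (wErec x y v) (oddEven (fun _ => x) (fun k => y + ((k : R) - 1) * v)) := by
  have h := (countsJ_genWeight_lin false false x x y y v v 1 1 1 1 1)
  have hw : wErec x y v = genWeight false false
      (fun j k => (1 : R) ^ j * 1 ^ k * if k = 0 then y else v) (fun _ => x)
      (fun j k => (1 : R) ^ j * 1 ^ k * if k = 0 then y else v) (fun k => 1 ^ k * x) := by
    rw [wErec_eq]
    simp only [one_pow, one_mul]
  rw [hw]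
  have h' : CountsJ cc (genWeight false false
      (fun j k => (1 : R) ^ j * 1 ^ k * if k = 0 then y else v) (fun _ => x)
      (fun j k => (1 : R) ^ j * 1 ^ k * if k = 0 then y else v) (fun k => 1 ^ k * x)) (fun n => if n = 0 then x else (1 : R) ^ n * x + lin 1 1 y v n)
      (fun n => x * lin ((1 : R) * 1) (1 * 1) y v n) := by
    simpa only [mul_one] using h
  refine ⟨h.decomposes.modifies, (countsS_of_countsJ_lin h').congr (fun n => ?_) fun n => ?_⟩
  · simp
  · simp only [lin_one_one]

end PartStat

namespace CFrac
variable {R : Type*} [CommRing R] {S : ℕ → Type} [∀ n, Fintype (S n)] {cc : ∀ n, S n → ℕ}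
  {w : ∀ n, S n → R}

theorem CountsS.congr_succ {α α' : ℕ → R} (h : CountsS cc w α) (hα : ∀ n, α (n + 1) = α' (n + 1)) :
    CountsS cc w α' := by
  refine h.decomposes.countsS (h.gf_eq.trans (sTail_congr fun n hn => ?_))
  obtain ⟨m, rfl⟩ := Nat.exists_eq_succ_of_ne_zero hn.ne'
  exact hα m

theorem CountsS.of_equiv {S' : ℕ → Type} [∀ n, Fintype (S' n)] {cc' : ∀ n, S' n → ℕ}
    {w' : ∀ n, S' n → R} {α : ℕ → R} (h : CountsS cc' w' α) (e : ∀ n, S n ≃ S' n)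
    (hcc : ∀ n s, cc' n (e n s) = cc n s) (hw : ∀ n s, w' n (e n s) = w n s) :
    CountsS cc w α :=
  ⟨fun ζ => (gfCC_congr e hcc hw ζ).trans (h.1 ζ), (gfIndec_congr e hcc hw).trans h.2⟩

end CFrac

/-! ## Perfect matchings -/

namespace MatchStat
open CFrac PartStat

variable {n : ℕ}

/-- Blocks of size two are characterized by the absence of insiders and singletons, a condition on
the types of the indices. -/
theorem forall_card_eq_two_iff (π : SetPart n) :
    (∀ B ∈ π.parts, #B = 2) ↔ ∀ i, HasRight π i ↔ ¬ HasLeft π i := by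
  constructor
  · intro h i
    have h2 := h _ (π.part_mem.mpr (mem_univ i))
    have h3 := (two_le_card_part π i).mp h2.ge
    have h4 := isInsider_iff π i
    rw [IsInsider, h2] at h4
    constructor
    · intro hr hl
      have := (h4.mpr ⟨hr, hl⟩).1
      omega
    · exact fun hl => h3.resolve_left hl
  · intro h B hB
    obtain ⟨i, hi⟩ := π.nonempty_of_mem_parts hB
    obtain rfl := π.part_eq_of_mem hB hi
    have h2 : 2 ≤ #(π.part i) := by
      rw [two_le_card_part]
      by_cases hl : HasLeft π i
      · exact Or.inl hl
      · exact Or.inr ((h i).mpr hl)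
    refine le_antisymm (not_lt.mp fun h3 => ?_) h2
    obtain ⟨a, ha, b, hb, c, hc, hab, hac, hbc⟩ := two_lt_card.mp h3
    -- The middle one of three elements of a block would be an insider.
    have key : ∀ x ∈ π.part i, ∀ y ∈ π.part i, ∀ z ∈ π.part i, x < y → y < z → False := by
      intro x hx y hy z hz hxy hyz
      have hy' := (mem_part_comm π).mp hy
      exact (h y).mp ⟨z, mem_part_trans hy' hz, hyz⟩ ⟨x, mem_part_trans hy' hx, hxy⟩
    have k1 := key a ha b hb c hc
    have k2 := key a ha c hc b hb
    have k3 := key b hb a ha c hc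
    have k4 := key b hb c hc a ha
    have k5 := key c hc a ha b hb
    have k6 := key c hc b hb a ha
    grind

variable {R : Type*} [CommRing R]

/-- The weights of perfect matchings and of set partitions without insiders and singletons. -/
theorem sum_perfMatch (a : ℕ → ℕ → R) (b : ℕ → R) (n : ℕ) (f : ℕ → R) :
    ∑ π : PerfMatch n, f (ccPart n π) * wMaster a b n π
      = ∑ π : SetPart (2 * n), f (PartStat.cc (2 * n) π)
        * genWeight false false a b 0 0 (2 * n) π := by
  classical
  have h1 := sum_subtype (univ.filter fun π : SetPart (2 * n) => ∀ B ∈ π.parts, #B = 2)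
    (p := fun π => ∀ B ∈ π.parts, #B = 2) (F := inferInstance) (by simp)
    (fun π => f (PartStat.cc (2 * n) π) * genWeight false false a b 0 0 (2 * n) π)
  rw [sum_filter_of_ne] at h1
  · rw [h1]
    refine sum_congr rfl fun π _ => ?_
    have h2 := (forall_card_eq_two_iff π.1).mp π.2
    rw [ccPart, wMaster, ← PartStat.prod_filter_eq_genWeight,
      filter_false_of_mem (p := IsInsider π.1), filter_false_of_mem (p := IsSingleton π.1),
      prod_empty, prod_empty, mul_one, mul_one]
    · rfl
    · intro i _ h
      rw [isSingleton_iff] at h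
      exact h.1 ((h2 i).mpr h.2)
    · intro i _ h
      rw [isInsider_iff] at h
      exact (h2 i).mp h.1 h.2
  · intro π _ hπ
    rw [forall_card_eq_two_iff]
    intro i
    -- An insider or a singleton would contribute a zero factor.
    have h3 : (if HasRight π i then
        if HasLeft π i then (0 : R) else a (lab false π i) (colab false π i)
        else if HasLeft π i then b (qne π i) else 0) ≠ 0 := by
      intro h0
      exact hπ (by rw [genWeight, prod_eq_zero (mem_univ i) h0, mul_zero])
    by_cases c1 : HasRight π i <;> by_cases c2 : HasLeft π i <;>
      simp only [c1, c2, if_true, if_false, _root_.ne_eq, not_true_eq_false, not_false_eq_true] at h3 ⊢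

/-- With the weights of insiders and singletons zero, all `γ` vanish. All three claims are the even
coefficients of the corresponding ones for partitions. -/
theorem wMaster_countsS (a : ℕ → ℕ → R) (b : ℕ → R) :
    CountsS ccPart (wMaster a b) (fun n => starSum a n * b (n - 1)) := by
  have hJ : CountsJ PartStat.cc (genWeight false false a b 0 0) (fun _ => 0)
      (fun n => starSum a n * b (n - 1)) :=
    (countsJ_genWeight false false a b 0 0).congr (fun n => by simp [starSum]) fun n => rfl
  have hS : gfCC ccPart (wMaster a b) 1 = sFrac (fun n => starSum a n * b (n - 1)) := by
    ext n
    have h := congrArg (PowerSeries.coeff (2 * n)) hJ.gf_eq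
    rw [jFrac, jTail_zero_coeff] at h
    rw [sFrac, ← h, gfCC, gfCC, PowerSeries.coeff_mk, PowerSeries.coeff_mk]
    exact sum_perfMatch a b n fun k => 1 ^ k
  refine ⟨fun ζ => ?_, ?_⟩
  · ext n
    have h := congrArg (PowerSeries.coeff (2 * n)) (hJ.1 ζ)
    rw [mul_zero, show (Function.update (fun _ => (0 : R)) 0 0 : ℕ → R) = fun _ => 0 from
      Function.update_eq_self _ _, jFrac, jTail_zero_coeff] at h
    rw [sFrac, ← h, gfCC, gfCC, PowerSeries.coeff_mk, PowerSeries.coeff_mk]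
    exact sum_perfMatch a b n fun k => ζ ^ k
  · ext n
    have h := congrArg (PowerSeries.coeff (2 * n)) hJ.2
    have h' : PowerSeries.coeff n (gfIndec ccPart (wMaster a b))
        = PowerSeries.coeff (2 * n) (gfIndec PartStat.cc (genWeight false false a b 0 0)) := by
      rw [gfIndec, gfIndec, PowerSeries.coeff_mk, PowerSeries.coeff_mk, sum_filter, sum_filter]
      simpa only [ite_mul, one_mul, zero_mul] using
        sum_perfMatch a b n fun k => if k = 1 then 1 else 0
    rw [h', h, map_zero, zero_mul, zero_add, mul_assoc, mul_assoc, PowerSeries.coeff_C_mul,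
      PowerSeries.coeff_C_mul]
    rcases n with _ | n
    · simp [PowerSeries.coeff_zero_X_mul, pow_two, mul_assoc]
    · rw [PowerSeries.coeff_succ_X_mul, pow_two, mul_assoc PowerSeries.X PowerSeries.X,
        show 2 * (n + 1) = 2 * n + 1 + 1 by ring,
        PowerSeries.coeff_succ_X_mul, PowerSeries.coeff_succ_X_mul, jTail_zero_coeff]

/-! ### Fixed-point-free involutions -/

theorem inv_eq_self (σ : FPFInvol n) : σ.1⁻¹ = σ.1 := by
  ext i
  rw [Equiv.Perm.inv_eq_iff_eq.mpr (σ.2 i).1.symm]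

/-- The partition into the pairs of points that are exchanged. -/
def cycles (σ : FPFInvol n) : SetPart (2 * n) := kerPart fun i => min i (σ.1 i)

theorem mem_cycles (σ : FPFInvol n) {i j : Fin (2 * n)} :
    j ∈ (cycles σ).part i ↔ j = i ∨ j = σ.1 i := by
  have h1 := (σ.2 i).1
  have h2 := (σ.2 j).1
  rw [cycles, mem_part_kerPart]
  constructor
  · intro h
    rcases min_choice i (σ.1 i) with e | e <;> rcases min_choice j (σ.1 j) with e' | e' <;>
      rw [e, e'] at h
    · exact Or.inl h.symm
    · exact Or.inr (by rw [h, h2])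
    · exact Or.inr h.symm
    · exact Or.inl (σ.1.injective h).symm
  · rintro (rfl | rfl)
    · rfl
    · rw [h1, min_comm]

theorem hasRight_cycles (σ : FPFInvol n) (i : Fin (2 * n)) :
    HasRight (cycles σ) i ↔ i < σ.1 i := by
  constructor
  · rintro ⟨j, hj, h⟩
    rcases (mem_cycles σ).mp hj with rfl | rfl
    · exact absurd h (lt_irrefl _)
    · exact h
  · exact fun h => ⟨_, (mem_cycles σ).mpr (Or.inr rfl), h⟩

theorem hasLeft_cycles (σ : FPFInvol n) (i : Fin (2 * n)) :
    HasLeft (cycles σ) i ↔ σ.1 i < i := by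
  constructor
  · rintro ⟨j, hj, h⟩
    rcases (mem_cycles σ).mp hj with rfl | rfl
    · exact absurd h (lt_irrefl _)
    · exact h
  · exact fun h => ⟨_, (mem_cycles σ).mpr (Or.inr rfl), h⟩

theorem edge_cycles (σ : FPFInvol n) {i j : Fin (2 * n)} :
    Edge (cycles σ) i j ↔ i < j ∧ j = σ.1 i := by
  refine and_congr_right fun hij => ?_
  constructor
  · rintro ⟨h, -⟩
    exact ((mem_cycles σ).mp h).resolve_left hij.ne'
  · rintro rfl
    refine ⟨(mem_cycles σ).mpr (Or.inr rfl), fun k hk => ?_⟩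
    rcases (mem_cycles σ).mp hk with rfl | rfl <;> simp

theorem hasRight_iff_not_hasLeft (σ : FPFInvol n) (i : Fin (2 * n)) :
    HasRight (cycles σ) i ↔ ¬ HasLeft (cycles σ) i := by
  rw [hasRight_cycles, hasLeft_cycles, not_lt]
  exact ⟨le_of_lt, fun h => lt_of_le_of_ne h (σ.2 i).2.symm⟩

/-- The perfect matching given by a fixed-point-free involution. -/
def toPerfMatch (σ : FPFInvol n) : PerfMatch n :=
  ⟨cycles σ, (forall_card_eq_two_iff _).mpr (hasRight_iff_not_hasLeft σ)⟩

theorem toPerfMatch_bijective : Function.Bijective (toPerfMatch (n := n)) := by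
  constructor
  · intro σ τ h
    have h' : cycles σ = cycles τ := congrArg Subtype.val h
    refine Subtype.ext (Equiv.ext fun i => ?_)
    have : σ.1 i ∈ (cycles τ).part i := by
      rw [← h', mem_cycles]
      exact Or.inr rfl
    exact ((mem_cycles τ).mp this).resolve_left (σ.2 i).2
  · rintro ⟨π, hπ⟩
    have hpair : ∀ i, ∃ j, j ≠ i ∧ π.part i = {i, j} := by
      intro i
      obtain ⟨x, y, hxy, h⟩ := card_eq_two.mp (hπ _ (π.part_mem.mpr (mem_univ i)))
      have hi := self_mem_part π i
      rw [h, mem_insert, mem_singleton] at hi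
      rcases hi with rfl | rfl
      · exact ⟨y, hxy.symm, h⟩
      · exact ⟨x, hxy, by rw [h, pair_comm]⟩
    choose o ho hpart using hpair
    have hinv : Function.Involutive o := by
      intro i
      have h1 : o i ∈ π.part i := by rw [hpart]; simp
      have h2 := hpart (o i)
      rw [(mem_part_iff π).mp h1, hpart] at h2
      have h3 : o (o i) ∈ ({i, o i} : Finset _) := by rw [h2]; simp
      rw [mem_insert, mem_singleton] at h3
      exact h3.resolve_right (ho (o i))
    refine ⟨⟨hinv.toPerm, fun i => ⟨hinv i, ho i⟩⟩, Subtype.ext (ext_part fun i j => ?_)⟩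
    change j ∈ (cycles _).part i ↔ _
    rw [mem_cycles, hpart, mem_insert, mem_singleton]
    rfl

theorem ccPart_toPerfMatch (σ : FPFInvol n) : ccPart n (toPerfMatch σ) = cc n σ := by
  unfold ccPart cc PartStat.cc PermStat.cc
  refine congrArg card (filter_congr fun i _ => ?_)
  refine forall₂_congr fun j hj => ?_
  constructor
  · exact fun h => h _ ((mem_cycles σ).mpr (Or.inr rfl))
  · intro h k hk
    rcases (mem_cycles σ).mp hk with rfl | rfl
    · exact hj
    · exact h

theorem mem_above_cycles (σ : FPFInvol n) {i l : Fin (2 * n)} :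
    l ∈ above (cycles σ) i ↔ σ.1 l < i ∧ i < l := by
  simp only [mem_above, edge_cycles]
  constructor
  · rintro ⟨hil, j, hj, -, rfl⟩
    rw [(σ.2 j).1]
    exact ⟨hj, hil⟩
  · rintro ⟨h, hil⟩
    exact ⟨hil, σ.1 l, h, h.trans hil, ((σ.2 l).1).symm⟩

theorem cr_cycles (σ : FPFInvol n) {i : Fin (2 * n)} (h : i < σ.1 i) :
    cr (cycles σ) i = PermStat.ucross σ.1 i := by
  rw [cr_eq ((edge_cycles σ).mpr ⟨h, rfl⟩), PermStat.ucross]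
  have := PermStat.card_filter_perm σ.1 fun l => σ.1 l < i ∧ i < l ∧ l < σ.1 i
  simp only [(σ.2 _).1] at this
  rw [← this]
  refine congrArg card (Finset.ext fun l => ?_)
  simp only [mem_filter, mem_above_cycles, mem_univ, true_and, and_assoc]

theorem ne_cycles (σ : FPFInvol n) {i : Fin (2 * n)} (h : i < σ.1 i) :
    ne (cycles σ) i = PermStat.unest σ.1 i := by
  rw [PartStat.ne_eq ((edge_cycles σ).mpr ⟨h, rfl⟩), PermStat.unest]
  have := PermStat.card_filter_perm σ.1 fun l => σ.1 l < i ∧ i < σ.1 i ∧ σ.1 i < l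
  simp only [(σ.2 _).1] at this
  rw [← this]
  refine congrArg card (Finset.ext fun l => ?_)
  simp only [mem_filter, mem_above_cycles, mem_univ, true_and, and_assoc]
  exact and_congr_right fun _ => ⟨fun h' => ⟨h, h'.2⟩, fun h' => ⟨h'.1.trans h'.2, h'.2⟩⟩

/-- Each index opens or closes a pair, so every step changes the height by one. -/
theorem even_hgt_iff (σ : FPFInvol n) {m : ℕ} (hm : m ≤ 2 * n) :
    Even (PartStat.hgt (cycles σ) m) ↔ Even m := by
  induction m with
  | zero => simp [PartStat.hgt_zero]
  | succ m ih =>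
    have h1 := PartStat.hgt_eq (cycles σ) ⟨m, hm⟩
    have h2 := PartStat.hgt_succ (cycles σ) ⟨m, hm⟩
    have h3 := hasRight_iff_not_hasLeft σ ⟨m, hm⟩
    have h4 := ih (by omega)
    simp only at h1 h2
    by_cases c : HasLeft (cycles σ) ⟨m, hm⟩
    · rw [if_neg (fun h => h3.mp h c)] at h2
      rw [if_pos c] at h1
      rw [h2, add_zero, Nat.even_add_one, ← h4, h1, Nat.even_add_one, not_not]
    · rw [if_pos (h3.mpr c)] at h2
      rw [if_neg c, add_zero] at h1
      rw [h2, Nat.even_add_one, Nat.even_add_one, ← h4, h1]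

/-- At an opener the height is `ucross + unest` and has the parity of `i`, while the element
modelled by `i` is `i + 1`. The parity of a valley is thus readable from its label. -/
theorem isEven_iff (σ : FPFInvol n) {i : Fin (2 * n)} (h : i < σ.1 i) :
    IsEven i ↔ ¬ Even (PermStat.ucross σ.1 i + PermStat.unest σ.1 i) := by
  have hr := (hasRight_cycles σ i).mpr h
  have h1 := PartStat.hgt_eq (cycles σ) i
  rw [if_neg ((hasRight_iff_not_hasLeft σ i).mp hr), add_zero, ← cr_add_ne hr, cr_cycles σ h,
    ne_cycles σ h] at h1
  rw [IsEven, Nat.even_add_one, ← even_hgt_iff σ i.2.le, h1]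

/-- The label weight of an opener that separates parities and records. -/
def valLabel (x y u v p q : R) (j k : ℕ) : R :=
  p ^ j * q ^ k * if k = 0 then (if Even (j + k) then x else y) else if Even (j + k) then u else v

theorem wMaster_toPerfMatch (x y u v p q : R) (σ : FPFInvol n) :
    wMaster (valLabel x y u v p q) (fun _ => 1) n (toPerfMatch σ) = wValPQ x y u v p q n σ := by
  have hm : wMaster (valLabel x y u v p q) (fun _ => 1) n (toPerfMatch σ)
      = ∏ i with IsOpener (cycles σ) i,
          valLabel x y u v p q (cr (cycles σ) i) (ne (cycles σ) i) := by
    rw [wMaster, prod_const_one, mul_one]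
    rfl
  rw [hm]
  simp only [wValPQ, wVal, PermStat.ucrossT, PermStat.unestT, ← prod_pow_eq_pow_sum,
    PermStat.pow_card_filter, prod_filter, ← prod_mul_distrib]
  refine prod_congr rfl fun i _ => ?_
  have hv : PermStat.IsCval σ.1 i ↔ i < σ.1 i := by rw [PermStat.IsCval, inv_eq_self, and_self]
  have ho : IsOpener (cycles σ) i ↔ i < σ.1 i := by
    rw [isOpener_iff, ← hasRight_iff_not_hasLeft, and_self, hasRight_cycles]
  by_cases h : i < σ.1 i
  · have h1 : PermStat.IsRec σ.1 i ↔ PermStat.unest σ.1 i = 0 := by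
      rw [PermStat.isRec_iff]
      simp [h, h.ne']
    simp only [hv, isEven_iff σ h, h1, cr_cycles σ h, ne_cycles σ h, ho, h, if_true, true_and,
      valLabel]
    by_cases c2 : Even (PermStat.ucross σ.1 i + PermStat.unest σ.1 i) <;>
      simp only [c2, if_true, if_false, not_true_eq_false, not_false_eq_true, true_and,
        false_and] <;>
      by_cases c1 : PermStat.unest σ.1 i = 0 <;>
      simp only [c1, if_true, if_false, not_true_eq_false, not_false_eq_true] <;> ring
  · simp [hv, ho, h, PermStat.ucross_eq_zero, PermStat.unest_eq_zero]

theorem starSum_valLabel_odd (x y u v p q : R) (m : ℕ) :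
    starSum (valLabel x y u v p q) (2 * m + 1) = lin p q x u (2 * m + 1) := by
  rw [← starSum_lin, starSum, starSum]
  refine sum_congr rfl fun j hj => ?_
  rw [mem_range] at hj
  have : Even (j + (2 * m + 1 - 1 - j)) := by
    rw [show j + (2 * m + 1 - 1 - j) = 2 * m by omega]
    exact even_two_mul m
  rw [valLabel, if_pos this, if_pos this]

theorem starSum_valLabel_even (x y u v p q : R) (m : ℕ) :
    starSum (valLabel x y u v p q) (2 * m + 2) = lin p q y v (2 * m + 2) := by
  rw [← starSum_lin, starSum, starSum]
  refine sum_congr rfl fun j hj => ?_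
  rw [mem_range] at hj
  have : ¬ Even (j + (2 * m + 1 + 1 - 1 - j)) := by
    rw [show j + (2 * m + 1 + 1 - 1 - j) = 2 * m + 1 by omega]
    simp
  rw [valLabel, if_neg this, if_neg this]

theorem wValPQ_countsS (x y u v p q : R) :
    CountsS cc (wValPQ x y u v p q)
      (oddEven (fun k => lin p q x u (2 * k - 1)) (fun k => lin p q y v (2 * k))) := by
  have h := (wMaster_countsS (valLabel x y u v p q) fun _ => 1).of_equiv
    (fun n => Equiv.ofBijective _ toPerfMatch_bijective) (cc := cc) (w := wValPQ x y u v p q)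
    (fun n σ => ccPart_toPerfMatch σ) fun n σ => wMaster_toPerfMatch x y u v p q σ
  refine h.congr_succ fun n => ?_
  rw [mul_one]
  rcases Nat.even_or_odd' n with ⟨m, rfl | rfl⟩
  · rw [starSum_valLabel_odd, oddEven_odd]
    rfl
  · rw [starSum_valLabel_even, oddEven_even]
    rfl

/-! ### Reversal -/

/-- Counting the empty prefix as well makes the set of lengths `m` suitable for the symmetry `m ↦ N
- m`. -/
theorem cc_add_one {N : ℕ} (σ : Equiv.Perm (Fin N)) :
    PermStat.cc N σ + 1
      = #{m ∈ range (N + 1) | ∀ j : Fin N, (j : ℕ) < m → (σ j : ℕ) < m} := by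
  rw [card_filter, sum_range_succ', PermStat.cc, card_filter, ← Fin.sum_univ_eq_sum_range
    (fun m => if ∀ j : Fin N, (j : ℕ) < m + 1 → (σ j : ℕ) < m + 1 then 1 else 0)]
  simp only [not_lt_zero, IsEmpty.forall_iff, implies_true, if_true]
  simp only [Fin.le_def, Nat.lt_succ_iff]

/-- Conjugation by the reversal. -/
def reverse (σ : FPFInvol n) : FPFInvol n :=
  ⟨Fin.revPerm * σ.1 * Fin.revPerm, fun i => by
    simp only [Equiv.Perm.mul_apply, Fin.revPerm_apply, Fin.rev_rev, (σ.2 _).1, true_and]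
    intro h
    exact (σ.2 i.rev).2 (by rw [← Fin.rev_rev (σ.1 i.rev), h])⟩

theorem reverse_apply (σ : FPFInvol n) (i : Fin (2 * n)) :
    (reverse σ).1 i = (σ.1 i.rev).rev := rfl

theorem reverse_involutive : Function.Involutive (reverse (n := n)) := fun σ =>
  Subtype.ext (Equiv.ext fun i => by rw [reverse_apply, reverse_apply, Fin.rev_rev, Fin.rev_rev])

/-- By counting, a segment that is mapped into itself is mapped onto itself, and then so is its
complement. -/
theorem maps_initial_iff {N : ℕ} (σ : Equiv.Perm (Fin N)) (m : ℕ) :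
    (∀ j : Fin N, (j : ℕ) < m → (σ j : ℕ) < m) ↔ ∀ j : Fin N, m ≤ (j : ℕ) → m ≤ (σ j : ℕ) := by
  have h : #{j : Fin N | (σ j : ℕ) < m} = #{j : Fin N | (j : ℕ) < m} :=
    (PermStat.card_filter_perm σ fun j => (j : ℕ) < m).symm
  have h' : #{j : Fin N | m ≤ (σ j : ℕ)} = #{j : Fin N | m ≤ (j : ℕ)} :=
    (PermStat.card_filter_perm σ fun j => m ≤ (j : ℕ)).symm
  constructor
  · intro H j hj
    have := eq_of_subset_of_card_le (s := ({j | (j : ℕ) < m} : Finset (Fin N)))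
      (t := ({j | (σ j : ℕ) < m} : Finset (Fin N))) (fun j => by simpa using H j) h.le
    by_contra hlt
    have hm : j ∈ ({j | (σ j : ℕ) < m} : Finset (Fin N)) := by simpa using hlt
    rw [← this] at hm
    simp at hm
    omega
  · intro H j hj
    have := eq_of_subset_of_card_le (s := ({j | m ≤ (j : ℕ)} : Finset (Fin N)))
      (t := ({j | m ≤ (σ j : ℕ)} : Finset (Fin N))) (fun j => by simpa using H j) h'.le
    by_contra hlt
    have hm : j ∈ ({j | m ≤ (σ j : ℕ)} : Finset (Fin N)) := by simpa using hlt
    rw [← this] at hm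
    simp at hm
    omega

theorem cc_reverse (σ : FPFInvol n) : cc n (reverse σ) = cc n σ := by
  refine Nat.add_right_cancel (m := 1) ?_
  rw [cc, cc, cc_add_one, cc_add_one]
  have key : ∀ m ≤ 2 * n, (∀ j : Fin (2 * n), (j : ℕ) < m → ((reverse σ).1 j : ℕ) < m) →
      ∀ j : Fin (2 * n), (j : ℕ) < 2 * n - m → (σ.1 j : ℕ) < 2 * n - m := by
    intro m hm H
    rw [maps_initial_iff] at H
    intro j hj
    have := H j.rev (by rw [Fin.val_rev]; omega)
    rw [reverse_apply, Fin.rev_rev, Fin.val_rev] at this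
    omega
  have key' : ∀ m ≤ 2 * n, (∀ j : Fin (2 * n), (j : ℕ) < m → (σ.1 j : ℕ) < m) →
      ∀ j : Fin (2 * n), (j : ℕ) < 2 * n - m → ((reverse σ).1 j : ℕ) < 2 * n - m := by
    intro m hm H
    rw [maps_initial_iff] at H
    intro j hj
    have := H j.rev (by rw [Fin.val_rev]; omega)
    rw [reverse_apply, Fin.val_rev]
    omega
  refine card_nbij' (fun m => 2 * n - m) (fun m => 2 * n - m) ?_ ?_ ?_ ?_
  · intro m hm
    simp only [coe_filter, Set.mem_ofPred_eq, mem_range] at hm ⊢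
    exact ⟨by omega, key m (by omega) hm.2⟩
  · intro m hm
    simp only [coe_filter, Set.mem_ofPred_eq, mem_range] at hm ⊢
    exact ⟨by omega, key' m (by omega) hm.2⟩
  · intro m hm
    simp only [coe_filter, Set.mem_ofPred_eq, mem_range] at hm
    change 2 * n - (2 * n - m) = m
    omega
  · intro m hm
    simp only [coe_filter, Set.mem_ofPred_eq, mem_range] at hm
    change 2 * n - (2 * n - m) = m
    omega

/-- Reversal moves the point at which a crossing is counted from one of its two arcs to the other,
so only the totals agree, by an exchange of summations. -/
theorem sum_ucross_reverse (σ : FPFInvol n) :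
    PermStat.ucrossT (reverse σ).1 = PermStat.ucrossT σ.1 := by
  have h1 : ∀ c, PermStat.ucross (reverse σ).1 (Fin.rev (σ.1 c))
      = #{b | c < b ∧ b < σ.1 c ∧ σ.1 c < σ.1 b} := by
    intro c
    rw [PermStat.ucross, PermStat.card_filter_perm ((σ.1).trans Fin.revPerm)]
    refine congrArg card (filter_congr fun b _ => ?_)
    simp only [Equiv.trans_apply, Fin.revPerm_apply, reverse_apply, Fin.rev_rev, Fin.rev_lt_rev,
      (σ.2 _).1]
    tauto
  rw [PermStat.ucrossT, ← Equiv.sum_comp ((σ.1).trans Fin.revPerm)]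
  simp only [Equiv.trans_apply, Fin.revPerm_apply, h1]
  simp only [PermStat.ucrossT, PermStat.ucross, card_filter]
  exact sum_comm

/-- A nesting is counted at its inner arc, which remains the inner one, so the numbers agree arc by
arc. -/
theorem sum_unest_reverse (σ : FPFInvol n) :
    PermStat.unestT (reverse σ).1 = PermStat.unestT σ.1 := by
  have h1 : ∀ c, PermStat.unest (reverse σ).1 (Fin.rev (σ.1 c)) = PermStat.unest σ.1 c := by
    intro c
    rw [PermStat.unest, PermStat.unest, PermStat.card_filter_perm ((σ.1).trans Fin.revPerm)]
    refine congrArg card (filter_congr fun b _ => ?_)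
    simp only [Equiv.trans_apply, Fin.revPerm_apply, reverse_apply, Fin.rev_rev, Fin.rev_lt_rev,
      (σ.2 _).1]
    tauto
  rw [PermStat.unestT, ← Equiv.sum_comp ((σ.1).trans Fin.revPerm)]
  simp only [Equiv.trans_apply, Fin.revPerm_apply, h1, PermStat.unestT]

theorem card_filter_rev {N : ℕ} (p q : Fin N → Prop) [DecidablePred p] [DecidablePred q]
    (h : ∀ i, p i.rev ↔ q i) : #{i | p i} = #{i | q i} := by
  rw [PermStat.card_filter_perm Fin.revPerm]
  exact congrArg card (filter_congr fun i _ => h i)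

theorem isCpeak_reverse (σ : FPFInvol n) (i : Fin (2 * n)) :
    PermStat.IsCpeak σ.1 i.rev ↔ PermStat.IsCval (reverse σ).1 i := by
  rw [PermStat.IsCpeak, PermStat.IsCval, inv_eq_self, inv_eq_self, and_self, and_self,
    reverse_apply, Fin.lt_rev_iff]

/-- Reversal sends the element `j` of `{1,…,2n}` to `2n + 1 - j`; this is why the roles of even and
odd differ in `wPeak` and `wVal`. -/
theorem isEven_rev (i : Fin (2 * n)) : IsEven i.rev ↔ ¬ IsEven i := by
  have : (i.rev : ℕ) + 1 + i = 2 * n := by rw [Fin.val_rev]; omega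
  have h2 : Even ((i.rev : ℕ) + 1 + i) := by rw [this]; exact even_two_mul n
  rw [Nat.even_add] at h2
  rw [IsEven, IsEven, h2, Nat.even_add_one, not_not]

theorem isArec_reverse (σ : FPFInvol n) (i : Fin (2 * n)) :
    PermStat.IsArec σ.1 i.rev ↔ PermStat.IsRec (reverse σ).1 i := by
  simp only [PermStat.IsArec, PermStat.IsRec, reverse_apply, Fin.rev_lt_rev]
  refine ⟨fun h j hj => h _ (Fin.rev_lt_rev.mpr hj), fun h j hj => ?_⟩
  have := h j.rev (by rwa [Fin.rev_lt_iff])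
  rwa [Fin.rev_rev] at this

theorem wValPQ_reverse (x y u v p q : R) (σ : FPFInvol n) :
    wValPQ x y u v p q n (reverse σ) = wPeakPQ x y u v p q n σ := by
  rw [wValPQ, wPeakPQ, sum_ucross_reverse, sum_unest_reverse, wVal, wPeak]
  congr 2
  refine congrArg₂ _ (congrArg₂ _ (congrArg₂ _ ?_ ?_) ?_) ?_ <;>
    refine congrArg _ (card_filter_rev _ _ fun i => ?_).symm <;>
    simp only [isCpeak_reverse, isEven_rev, isArec_reverse, not_not]

theorem wPeakPQ_countsS (x y u v p q : R) :
    CountsS cc (wPeakPQ x y u v p q)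
      (oddEven (fun k => lin p q x u (2 * k - 1)) (fun k => lin p q y v (2 * k))) :=
  (wValPQ_countsS x y u v p q).of_equiv (fun _ => reverse_involutive.toPerm)
    (fun _ σ => cc_reverse σ) fun _ σ => wValPQ_reverse x y u v p q σ

theorem involution_counts_pq (x y u v p q : R) :
    ∀ wt ∈ ({wPeakPQ x y u v p q, wValPQ x y u v p q} : Set (∀ n, FPFInvol n → R)),
      Modifies cc wt ∧
      CountsS cc wt
        (oddEven (fun k => lin p q x u (2 * k - 1)) (fun k => lin p q y v (2 * k))) := by
  rintro wt (rfl | rfl)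
  · exact ⟨(wPeakPQ_countsS x y u v p q).decomposes.modifies, wPeakPQ_countsS x y u v p q⟩
  · exact ⟨(wValPQ_countsS x y u v p q).decomposes.modifies, wValPQ_countsS x y u v p q⟩

theorem involution_counts (x y u v : R) :
    ∀ wt ∈ ({wPeak x y u v, wVal x y u v} : Set (∀ n, FPFInvol n → R)),
      Modifies cc wt ∧
      CountsS cc wt
        (oddEven (fun k => x + (2 * (k : R) - 2) * u) (fun k => y + (2 * (k : R) - 1) * v)) := by
  have h1 : wPeak x y u v = wPeakPQ x y u v 1 1 := by ext n σ; simp [wPeakPQ]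
  have h2 : wVal x y u v = wValPQ x y u v 1 1 := by ext n σ; simp [wValPQ]
  rw [h1, h2]
  intro wt hwt
  have h := involution_counts_pq x y u v 1 1 wt hwt
  refine ⟨h.1, h.2.congr (fun n => ?_) fun n => ?_⟩
  · rw [show 2 * (n + 1) - 1 = 2 * n + 1 by omega, lin_one_one]
    push_cast
    ring
  · rw [show 2 * (n + 1) = 2 * n + 1 + 1 by omega, lin_one_one]
    push_cast
    ring

end MatchStat

/-- Each conjunct is about one polynomial, given by its weight. `Modifies` is the effect of the
factor `ζ^{cc}` on an arbitrary continued fraction of the polynomial; `CountsS`, `CountsJ` state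
its continued fractions, before and after the insertion of `ζ^{cc}`, with explicit coefficients,
together with those of the indecomposable objects. -/
theorem theorem2p16 {R : Type*} [CommRing R] :
    -- Permutations: `x^arec y^erec u^(n-exc-arec) v^(exc-erec)`
    (∀ x y u v : R,
      Modifies PermStat.cc (PermStat.wArec x y u v) ∧
      CountsS PermStat.cc (PermStat.wArec x y u v)
        (oddEven (fun k => x + ((k : R) - 1) * u) (fun k => y + ((k : R) - 1) * v))) ∧
    -- `x^cyc y^erec u^(n-exc-cyc) v^(exc-erec)`
    (∀ x y u v : R,
      Modifies PermStat.cc (PermStat.wCyc x y u v) ∧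
      CountsS PermStat.cc (PermStat.wCyc x y u v)
        (oddEven (fun k => x + ((k : R) - 1) * u) (fun k => y + ((k : R) - 1) * v))) ∧
    -- the record-and-cycle classification
    (∀ (x₁ x₂ y₁ y₂ u₁ u₂ v₁ v₂ : R) (w : ℕ → R),
      Modifies PermStat.cc (PermStat.wRecCyc x₁ x₂ y₁ y₂ u₁ u₂ v₁ v₂ w) ∧
      CountsJ PermStat.cc (PermStat.wRecCyc x₁ x₂ y₁ y₂ u₁ u₂ v₁ v₂ w)
        (fun n => if n = 0 then w 0 else
          (x₂ + ((n : R) - 1) * u₂) + (y₂ + ((n : R) - 1) * v₂) + w n)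
        (fun n => (x₁ + ((n : R) - 1) * u₁) * (y₁ + ((n : R) - 1) * v₁))) ∧
    -- the record-and-cycle classification and the number of cycles
    (∀ (x₁ x₂ y₁ y₂ u₁ u₂ v₁ v₂ : R) (w : ℕ → R) (lam : R),
      Modifies PermStat.cc (PermStat.wRecCycHat x₁ x₂ y₁ y₂ u₁ u₂ v₁ v₂ w lam) ∧
      CountsJ PermStat.cc (PermStat.wRecCycHat x₁ x₂ y₁ y₂ u₁ u₂ y₁ y₂ w lam)
        (fun n => if n = 0 then lam * w 0 else
          (x₂ + ((n : R) - 1) * u₂) + (n : R) * y₂ + lam * w n)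
        (fun n => (lam + (n : R) - 1) * (x₁ + ((n : R) - 1) * u₁) * y₁)) ∧
    -- crossings, nestings, joinings and pseudo-nestings
    (∀ pp1 pp2 pm1 pm2 qp1 qp2 qm1 qm2 rp rm s : R,
      Modifies PermStat.cc (PermStat.wPQ pp1 pp2 pm1 pm2 qp1 qp2 qm1 qm2 rp rm s) ∧
      CountsJ PermStat.cc (PermStat.wPQ pp1 pp2 pm1 pm2 qp1 qp2 qm1 qm2 rp rm s)
        (fun n => pq pp2 qp2 n * rp + pq pm2 qm2 n * rm + s ^ n)
        (fun n => pq pp1 qp1 n * pq pm1 qm1 n)) ∧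
    (∀ pp pm qp qm : R,
      CountsS PermStat.cc (PermStat.wPQ pp pp pm pm qp qp qm qm 1 pm qm)
        (oddEven (pq pm qm) (pq pp qp)) ∧
      CountsS PermStat.cc (PermStat.wPQ pp pp pm pm qp qp qm qm pp 1 qp)
        (oddEven (pq pp qp) (pq pm qm))) ∧
    -- the record-and-cycle classification with crossings, nestings and pseudo-nestings
    (∀ (x₁ x₂ y₁ y₂ u₁ u₂ v₁ v₂ : R) (w : ℕ → R) (pp1 pp2 pm1 pm2 qp1 qp2 qm1 qm2 s : R),
      Modifies PermStat.cc
        (PermStat.wBig x₁ x₂ y₁ y₂ u₁ u₂ v₁ v₂ w pp1 pp2 pm1 pm2 qp1 qp2 qm1 qm2 s) ∧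
      CountsJ PermStat.cc
        (PermStat.wBig x₁ x₂ y₁ y₂ u₁ u₂ v₁ v₂ w pp1 pp2 pm1 pm2 qp1 qp2 qm1 qm2 s)
        (fun n => if n = 0 then w 0 else
          lin pm2 qm2 x₂ u₂ n + lin pp2 qp2 y₂ v₂ n + s ^ n * w n)
        (fun n => lin pm1 qm1 x₁ u₁ n * lin pp1 qp1 y₁ v₁ n)) ∧
    (∀ x y u v pp pm qp qm : R,
      CountsS PermStat.cc
        (PermStat.wBig x x y (pp * y) u u v (pp * v) (fun l => if l = 0 then y else v)
          pp pp pm pm qp qp qm qm qp)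
        (oddEven (lin pp qp y v) (lin pm qm x u))) ∧
    -- `x^arec y^erec u^(n-exc-arec) v^(exc-erec) p₊^ucross p₋^(lcross+ljoin) q₊^unest q₋^(lnest+psnest)`
    (∀ x y u v pp pm qp qm : R,
      Modifies PermStat.cc (PermStat.wArecPQ x y u v pp pm qp qm) ∧
      CountsS PermStat.cc (PermStat.wArecPQ x y u v pp pm qp qm)
        (oddEven (lin pm qm x u) (lin pp qp y v))) ∧
    -- the first master polynomial
    (∀ (a b c d : ℕ → ℕ → R) (e : ℕ → R),
      Modifies PermStat.cc (PermStat.wMaster1 a b c d e) ∧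
      CountsJ PermStat.cc (PermStat.wMaster1 a b c d e)
        (fun n => starSum c n + starSum d n + e n)
        (fun n => starSum a n * starSum b n) ∧
      ((∀ n, starSum c n + starSum d n + e n = starSum a n + starSum b (n + 1)) →
        CountsS PermStat.cc (PermStat.wMaster1 a b c d e)
          (oddEven (starSum b) (starSum a))) ∧
      ((∀ n, starSum c n + starSum d n + e n = starSum b n + starSum a (n + 1)) →
        CountsS PermStat.cc (PermStat.wMaster1 a b c d e)
          (oddEven (starSum a) (starSum b)))) ∧
    -- record-and-cycle classification, crossings, nestings, pseudo-nestings and cycles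
    (∀ (x₁ x₂ y₁ y₂ u₁ u₂ v₁ v₂ : R) (w : ℕ → R) (pp1 pp2 pm1 pm2 qp1 qp2 qm1 qm2 s lam : R),
      Modifies PermStat.cc
        (PermStat.wBigHat x₁ x₂ y₁ y₂ u₁ u₂ v₁ v₂ w pp1 pp2 pm1 pm2 qp1 qp2 qm1 qm2 s lam)) ∧
    (∀ (x₁ x₂ y₁ y₂ u₁ u₂ : R) (w : ℕ → R) (pp1 pp2 pm1 pm2 qm1 qm2 s lam : R),
      CountsJ PermStat.cc
        (PermStat.wBigHat x₁ x₂ y₁ y₂ u₁ u₂ y₁ y₂ w pp1 pp2 pm1 pm2 pp1 pp2 qm1 qm2 s lam)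
        (fun n => if n = 0 then lam * w 0 else
          lin pm2 qm2 x₂ u₂ n + (n : R) * pp2 ^ (n - 1) * y₂ + lam * s ^ n * w n)
        (fun n => (lam + (n : R) - 1) * lin pm1 qm1 x₁ u₁ n * (pp1 ^ (n - 1) * y₁))) ∧
    (∀ x y u pp pm qm lam : R,
      CountsS PermStat.cc
        (PermStat.wBigHat x x y (pp * y) u u y (pp * y) (fun _ => y)
          pp pp pm pm pp pp qm qm pp lam)
        (oddEven (fun k => (lam + (k : R) - 1) * pp ^ (k - 1) * y) (lin pm qm x u))) ∧
    -- the second master polynomial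
    (∀ (a : ℕ → R) (b c d : ℕ → ℕ → R) (e : ℕ → R) (lam : R),
      Modifies PermStat.cc (PermStat.wMaster2 a b c d e lam) ∧
      CountsJ PermStat.cc (PermStat.wMaster2 a b c d e lam)
        (fun n => starSum c n + naturalSum d n + lam * e n)
        (fun n => (lam + (n : R) - 1) * a (n - 1) * starSum b n) ∧
      ((∀ n, e n = a n) →
        (∀ n, starSum c n + naturalSum d n = starSum b n + (n : R) * a n) →
        CountsS PermStat.cc (PermStat.wMaster2 a b c d e lam)
          (oddEven (fun k => (lam + (k : R) - 1) * a (k - 1)) (starSum b)))) ∧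
    -- Set partitions: `x^|π| y^erec v^(n-|π|-erec)`
    (∀ x y v : R,
      Modifies PartStat.cc (PartStat.wErec x y v) ∧
      CountsS PartStat.cc (PartStat.wErec x y v)
        (oddEven (fun _ => x) (fun k => y + ((k : R) - 1) * v))) ∧
    -- exclusive records among insiders and openers
    (∀ x₁ x₂ y₁ y₂ v₁ v₂ : R,
      Modifies PartStat.cc (PartStat.wErecInOp x₁ x₂ y₁ y₂ v₁ v₂) ∧
      CountsJ PartStat.cc (PartStat.wErecInOp x₁ x₂ y₁ y₂ v₁ v₂)
        (fun n => if n = 0 then x₁ else x₁ + y₁ + ((n : R) - 1) * v₁)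
        (fun n => x₂ * (y₂ + ((n : R) - 1) * v₂))) ∧
    -- the same with crossings and nestings
    (∀ x₁ x₂ y₁ y₂ v₁ v₂ p₁ p₂ q₁ q₂ r : R,
      Modifies PartStat.cc (PartStat.wCrNe x₁ x₂ y₁ y₂ v₁ v₂ p₁ p₂ q₁ q₂ r) ∧
      CountsJ PartStat.cc (PartStat.wCrNe x₁ x₂ y₁ y₂ v₁ v₂ p₁ p₂ q₁ q₂ r)
        (fun n => if n = 0 then x₁ else r ^ n * x₁ + lin p₁ q₁ y₁ v₁ n)
        (fun n => x₂ * lin p₂ q₂ y₂ v₂ n)) ∧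
    (∀ x y v p q r : R,
      CountsS PartStat.cc (PartStat.wCrNe x x y y v v p (r * p) q (r * q) r)
        (oddEven (fun k => r ^ (k - 1) * x) (lin p q y v))) ∧
    -- block-records, overlaps and coverings
    (∀ x₁ x₂ y₁ y₂ v₁ v₂ p₁ p₂ q₁ q₂ r : R,
      Modifies PartStat.cc (PartStat.wOvCov x₁ x₂ y₁ y₂ v₁ v₂ p₁ p₂ q₁ q₂ r) ∧
      CountsJ PartStat.cc (PartStat.wOvCov x₁ x₂ y₁ y₂ v₁ v₂ p₁ p₂ q₁ q₂ r)
        (fun n => if n = 0 then x₁ else r ^ n * x₁ + lin p₁ q₁ y₁ v₁ n)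
        (fun n => x₂ * lin p₂ q₂ y₂ v₂ n)) ∧
    (∀ x y v p q r : R,
      CountsS PartStat.cc (PartStat.wOvCov x x y y v v p (r * p) q (r * q) r)
        (oddEven (fun k => r ^ (k - 1) * x) (lin p q y v))) ∧
    -- the four master polynomials for set partitions
    (∀ (a : ℕ → ℕ → R) (b : ℕ → R) (d : ℕ → ℕ → R) (e : ℕ → R),
      ∀ wt ∈ ({PartStat.wMaster1 a b d e, PartStat.wMaster2 a b d e, PartStat.wMaster3 a b d e,
          PartStat.wMaster4 a b d e} : Set (∀ n, SetPart n → R)),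
        Modifies PartStat.cc wt ∧
        CountsJ PartStat.cc wt
          (fun n => starSum d n + e n) (fun n => starSum a n * b (n - 1)) ∧
        ((∀ n, starSum d n + e n = starSum a n + b n) →
          CountsS PartStat.cc wt (oddEven (fun k => b (k - 1)) (starSum a)))) ∧
    -- Perfect matchings: antirecords among cycle peaks, records among cycle valleys
    (∀ x y u v : R,
      ∀ wt ∈ ({MatchStat.wPeak x y u v, MatchStat.wVal x y u v} : Set (∀ n, FPFInvol n → R)),
        Modifies MatchStat.cc wt ∧
        CountsS MatchStat.cc wt
          (oddEven (fun k => x + (2 * (k : R) - 2) * u) (fun k => y + (2 * (k : R) - 1) * v))) ∧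
    -- the same with crossings and nestings
    (∀ x y u v p q : R,
      ∀ wt ∈ ({MatchStat.wPeakPQ x y u v p q, MatchStat.wValPQ x y u v p q} :
          Set (∀ n, FPFInvol n → R)),
        Modifies MatchStat.cc wt ∧
        CountsS MatchStat.cc wt
          (oddEven (fun k => lin p q x u (2 * k - 1)) (fun k => lin p q y v (2 * k)))) ∧
    -- the master polynomial for perfect matchings
    (∀ (a : ℕ → ℕ → R) (b : ℕ → R),
      Modifies MatchStat.ccPart (MatchStat.wMaster a b) ∧
      CountsS MatchStat.ccPart (MatchStat.wMaster a b)
        (fun n => starSum a n * b (n - 1))) := by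
  exact ⟨PermStat.wArec_counts, PermStat.wCyc_counts, PermStat.wRecCyc_counts,
    PermStat.wRecCycHat_counts, PermStat.wPQ_counts, PermStat.wPQ_countsS, PermStat.wBig_counts,
    PermStat.wBig_countsS, PermStat.wArecPQ_counts, PermStat.wMaster1_counts,
    PermStat.wBigHat_modifies, PermStat.wBigHat_countsJ, PermStat.wBigHat_countsS,
    PermStat.wMaster2_counts, PartStat.wErec_counts, PartStat.wErecInOp_counts,
    PartStat.wCrNe_counts,
    fun x y v p q r => PartStat.countsS_of_countsJ_lin
      (PartStat.wCrNe_counts x x y y v v p (r * p) q (r * q) r).2,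
    PartStat.wOvCov_counts,
    fun x y v p q r => PartStat.countsS_of_countsJ_lin
      (PartStat.wOvCov_counts x x y y v v p (r * p) q (r * q) r).2,
    PartStat.wMaster_counts, MatchStat.involution_counts, MatchStat.involution_counts_pq,
    fun a b => ⟨(MatchStat.wMaster_countsS a b).decomposes.modifies,
      MatchStat.wMaster_countsS a b⟩⟩
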